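/- **Setting.** Let $a_1,a_2,b_1,b_2$ be nonzero real constants and $a_3\in\mathbb R$. Consider the modified Davey–Stewartson system $$i\psi_t+\psi_{xx}+a_1\psi_{yy}+\psi_{zz}=a_2|\psi|^2\psi+\psi w+ia_3\psi,\qquad w_{xx}+b_1w_{yy}+w_{zz}=b_2\big[(|\psi|^2)_{xx}+(|\psi|^2)_{zz}\big]$$ for complex-valued $\psi=u+iv$ and real-valued $w$, written as the real system $\Delta_1=\Delta_2=\Delta_3=0$ with $$\Delta_1=u_t+v_{xx}+a_1v_{yy}+v_{zz}-a_2v(u^2+v^2)-vw-a_3u,$$ $$\Delta_2=-v_t+u_{xx}+a_1u_{yy}+u_{zz}-a_2u(u^2+v^2)-uw+a_3v,$$ $$\Delta_3=w_{xx}+b_1w_{yy}+w_{zz}-b_2(u^2+v^2)_{xx}-b_2(u^2+v^2)_{zz}.$$ Let $\Omega$ be a nonempty open convex subset of $\mathbb R^7$ (for instance $\mathbb R^7$ itself) with coordinates $(t,x,y,z,u,v,w)$, and let $I\subseteq\mathbb R$ be the open interval of values of $t$ on $\Omega$. A symmetry generator is a $C^\infty$ vector field $V=\sigma_1\partial_t+\sigma_2\partial_x+\sigma_3\partial_y+\sigma_4\partial_z+\phi_1\partial_u+\phi_2\partial_v+\phi_3\partial_w$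 on $\Omega$ whose second prolongation satisfies $\mathsf{Pr}^{(2)}V(\Delta_i)=0$, $i=1,2,3$, at all second-order jets over $\Omega$ with $\Delta_1=\Delta_2=\Delta_3=0$. Put $\rho=x^2+y^2/a_1+z^2$ and $$\mathcal X_1=\partial_t,\qquad \mathcal X_2=2t\partial_t+x\partial_x+y\partial_y+z\partial_z-u\partial_u-v\partial_v-2w\partial_w,\qquad \mathcal X_3=z\partial_x-x\partial_z,$$ $$\tilde{\mathcal X}_2=e^{4a_3t}\Big\{\tfrac1{2a_3}\partial_t+x\partial_x+y\partial_y+z\partial_z-(u+a_3\rho v)\partial_u+(-v+a_3\rho u)\partial_v-(2w+4a_3^2\rho)\partial_w\Big\}\quad(a_3\ne0),$$ and, for $g,h,k,m\in C^\infty(I,\mathbb R)$, $$\mathcal Y(g)=g\,\partial_x-\tfrac x2\big[g'(v\partial_u-u\partial_v)+g''\partial_w\big],\qquad \mathcal Z(h)=h\,\partial_y-\tfrac y{2a_1}\big[h'(v\partial_u-u\partial_v)+h''\partial_w\big],$$ $$\mathcal Q(k)=k\,\partial_z-\tfrac z2\big[k'(v\partial_u-u\partial_v)+k''\partial_w\big],\qquad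 \mathcal W(m)=m(v\partial_u-u\partial_v)+m'\partial_w.$$ Let $N=\{\mathcal Y(g),\mathcal Z(h),\mathcal Q(k),\mathcal W(m)\}$ be the real span of all these fields. **Theorem 2.1.** The symmetry generators form a Lie algebra $L$ under the commutator of vector fields, and the following hold. (i) For all values of the constants, $\mathcal Y(g),\mathcal Z(h),\mathcal Q(k),\mathcal W(m)$ are symmetry generators for all $g,h,k,m\in C^\infty(I,\mathbb R)$; hence $L$ is infinite-dimensional. (ii) If $a_3=0$, then $L$ is the semi-direct sum of the three-dimensional subalgebra $\{\mathcal X_1,\mathcal X_2\}\oplus\mathcal X_3$ and the ideal $N$; here $[\mathcal X_1,\mathcal X_2]=2\mathcal X_1$ and $\mathcal X_3$ commutes with $\mathcal X_1$ and $\mathcal X_2$. (iii) If $a_3\neq0$ and $b_1=-2a_1$, then $L$ is the semi-direct sum of the three-dimensional subalgebra $\{\mathcal X_1,\tilde{\mathcal X}_2\}\oplus\mathcal X_3$ and the ideal $N$; here $[\mathcal X_1,\tilde{\mathcal X}_2]=4a_3\tilde{\mathcal X}_2$ and $\mathcal X_3$ commutes with $\mathcal X_1$ and $\tilde{\mathcal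 X}_2$. (iv) If $a_3\neq0$ and $b_1\neq-2a_1$, then $L$ is the semi-direct sum of the two-dimensional abelian subalgebra $\mathcal X_1\oplus\mathcal X_3$ and the ideal $N$. In all cases $N$ is a non-abelian ideal of $L$ and is an algebra of Kac–Moody type, in the following sense. Its commutation relations are $$[\mathcal Y(g_1),\mathcal Y(g_2)]=\mathcal W\big(\tfrac12(g_1'g_2-g_1g_2')\big),\quad [\mathcal Z(h_1),\mathcal Z(h_2)]=\mathcal W\big(\tfrac1{2a_1}(h_1'h_2-h_1h_2')\big),\quad [\mathcal Q(k_1),\mathcal Q(k_2)]=\mathcal W\big(\tfrac12(k_1'k_2-k_1k_2')\big),$$ all other commutators of the fields $\mathcal Y,\mathcal Z,\mathcal Q,\mathcal W$ being zero; and there is an injective Lie algebra homomorphism of $N$ into the loop algebra $C^\infty(I,\mathfrak{sl}(5,\mathbb R))$ with pointwise commutator, of the form $$\mathcal Y(g)\mapsto gA_1+g'B_1,\quad \mathcal Z(h)\mapsto hA_2+h'B_2,\quad \mathcal Q(k)\mapsto kA_3+k'B_3,\quad \mathcal W(m)\mapsto mC$$ with constant matrices $A_i,B_i,C\in\mathfrak{sl}(5,\mathbb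 R)$. -/

import Mathlib

open Set VectorField
open scoped ContDiff Topology

noncomputable section

namespace MDS

/-! ### Smooth vector fields on an open subset of `(t,x,y,z,u,v,w)`-space -/

/-- The space of the independent and dependent variables. A point `p` has the independent
variables `p.1 = (t, x, y, z)` and the dependent variables `p.2 = (u, v, w)`, `ψ = u + i v`. -/
abbrev E : Type := (Fin 4 → ℝ) × (Fin 3 → ℝ)

/-- The smooth vector fields on the open set `Ω`. A field is a map `E → E` that is smooth
on `Ω`; it is normalised to vanish outside `Ω`, so that two fields are equal exactly if
they agree on `Ω`. -/
def smoothFields (Ω : TopologicalSpace.Opens E) : Submodule ℝ (E → E) where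
  carrier := {V | ContDiffOn ℝ ∞ V Ω ∧ ∀ p ∉ Ω, V p = 0}
  add_mem' := fun hV hW => ⟨hV.1.add hW.1, fun p hp => by
    simp [hV.2 p hp, hW.2 p hp]⟩
  zero_mem' := ⟨contDiffOn_const, fun _ _ => rfl⟩
  smul_mem' := fun c V hV => ⟨contDiffOn_const.smul hV.1, fun p hp => by
    simp [hV.2 p hp]⟩

/-- The real vector space of smooth vector fields on `Ω`. -/
abbrev VF (Ω : TopologicalSpace.Opens E) : Type := smoothFields Ω

variable {Ω : TopologicalSpace.Opens E}

/-- The vector field on `Ω` given by a formula that is smooth on `Ω`. -/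
def VF.of (F : E → E) (hF : ContDiffOn ℝ ∞ F Ω) : VF Ω :=
  ⟨indicator (Ω : Set E) F,
    hF.congr fun _ hp => indicator_of_mem hp F, fun _ hp => indicator_of_notMem hp F⟩

theorem VF.of_apply (F : E → E) (hF : ContDiffOn ℝ ∞ F Ω) {p : E} (hp : p ∈ Ω) :
    (VF.of F hF).1 p = F p := indicator_of_mem hp F

theorem VF.ext_on {V W : VF Ω} (h : ∀ p ∈ Ω, V.1 p = W.1 p) : V = W := by
  apply Subtype.ext
  funext p
  by_cases hp : p ∈ Ω
  · exact h p hp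
  · rw [V.2.2 p hp, W.2.2 p hp]

theorem VF.contDiffAt (V : VF Ω) {p : E} (hp : p ∈ Ω) : ContDiffAt ℝ ∞ V.1 p :=
  V.2.1.contDiffAt (Ω.isOpen.mem_nhds hp)

theorem VF.differentiableAt (V : VF Ω) {p : E} (hp : p ∈ Ω) : DifferentiableAt ℝ V.1 p :=
  (V.contDiffAt hp).differentiableAt (by simp)

/-- The commutator of vector fields, `[V, W] = DW(V) - DV(W)`, which is the commutator
`V ∘ W - W ∘ V` of the corresponding first order differential operators. -/
instance : Bracket (VF Ω) (VF Ω) where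
  bracket V W := VF.of (lieBracket ℝ V.1 W.1) fun _ hp =>
    ((V.contDiffAt hp).lieBracket_vectorField (W.contDiffAt hp)
      (m := ∞) (by simp)).contDiffWithinAt

theorem VF.bracket_apply (V W : VF Ω) {p : E} (hp : p ∈ Ω) :
    (⁅V, W⁆ : VF Ω).1 p = lieBracket ℝ V.1 W.1 p := indicator_of_mem hp _

theorem VF.bracket_eventuallyEq (V W : VF Ω) {p : E} (hp : p ∈ Ω) :
    (⁅V, W⁆ : VF Ω).1 =ᶠ[𝓝 p] lieBracket ℝ V.1 W.1 := by
  filter_upwards [Ω.isOpen.mem_nhds hp] with q hq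
  exact VF.bracket_apply V W hq

instance : LieRing (VF Ω) where
  add_lie U V W := VF.ext_on fun p hp => by
    change _ = (⁅U, W⁆ : VF Ω).1 p + (⁅V, W⁆ : VF Ω).1 p
    rw [VF.bracket_apply _ _ hp, VF.bracket_apply _ _ hp, VF.bracket_apply _ _ hp]
    exact lieBracket_add_left (U.differentiableAt hp) (V.differentiableAt hp)
  lie_add U V W := VF.ext_on fun p hp => by
    change _ = (⁅U, V⁆ : VF Ω).1 p + (⁅U, W⁆ : VF Ω).1 p
    rw [VF.bracket_apply _ _ hp, VF.bracket_apply _ _ hp, VF.bracket_apply _ _ hp]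
    exact lieBracket_add_right (V.differentiableAt hp) (W.differentiableAt hp)
  lie_self U := VF.ext_on fun p hp => by
    rw [VF.bracket_apply _ _ hp, lieBracket_self]
    rfl
  leibniz_lie U V W := VF.ext_on fun p hp => by
    change _ = (⁅⁅U, V⁆, W⁆ : VF Ω).1 p + (⁅V, ⁅U, W⁆⁆ : VF Ω).1 p
    rw [VF.bracket_apply _ _ hp, VF.bracket_apply _ _ hp, VF.bracket_apply _ _ hp,
      (Filter.EventuallyEq.refl _ _).lieBracket_vectorField_eq (VF.bracket_eventuallyEq V W hp),
      (VF.bracket_eventuallyEq U V hp).lieBracket_vectorField_eq (Filter.EventuallyEq.refl _ _),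
      (Filter.EventuallyEq.refl _ _).lieBracket_vectorField_eq (VF.bracket_eventuallyEq U W hp)]
    exact leibniz_identity_lieBracket (n := ∞) (by
        rw [minSmoothness_of_isRCLikeNormedField]; exact WithTop.coe_le_coe.2 le_top) (U.contDiffAt hp) (V.contDiffAt hp)
      (W.contDiffAt hp)

instance : LieAlgebra ℝ (VF Ω) where
  lie_smul c V W := VF.ext_on fun p hp => by
    change _ = c • (⁅V, W⁆ : VF Ω).1 p
    rw [VF.bracket_apply _ _ hp, VF.bracket_apply _ _ hp]
    exact lieBracket_const_smul_right (W.differentiableAt hp)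

/-! ### Second order jets, prolongation and symmetry generators -/

/-- First derivatives `j₁ α i = ∂ᵢ uᵅ` of the dependent variables `(u⁰, u¹, u²) = (u, v, w)`,
where the indices `0, 1, 2, 3` of the independent variables stand for `t, x, y, z`. -/
abbrev Jet1 : Type := Fin 3 → Fin 4 → ℝ

/-- Second derivatives `j₂ α i k = ∂ᵢ∂ₖ uᵅ` of the dependent variables. -/
abbrev Jet2 : Type := Fin 3 → Fin 4 → Fin 4 → ℝ

/-- The coordinates on the second order jet space; an actual jet has symmetric second
derivatives, see `IsJet`. -/
abbrev J : Type := E × Jet1 × Jet2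

/-- The second derivatives in a jet are symmetric. -/
def IsJet (j : J) : Prop := ∀ α i k, j.2.2 α i k = j.2.2 α k i

/-- The vector `∂ᵢ + ∑ α, uᵅᵢ ∂_{uᵅ}`. -/
def liftVec (j : J) (i : Fin 4) : E := (Pi.single i 1, fun α => j.2.1 α i)

/-- The total derivative `Dᵢ F` of a function `F` of the independent and dependent variables. -/
def totalD (F : E → ℝ) (i : Fin 4) (j : J) : ℝ := fderiv ℝ F j.1 (liftVec j i)

/-- The second total derivative `Dᵢ Dₖ F` of a function `F` of the independent and dependent
variables. -/
def totalD2 (F : E → ℝ) (i k : Fin 4) (j : J) : ℝ :=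
  fderiv ℝ (fderiv ℝ F) j.1 (liftVec j i) (liftVec j k)
    + fderiv ℝ F j.1 (0, fun α => j.2.2 α i k)

/-- The coefficients `(σ₁, σ₂, σ₃, σ₄)` of `∂_t, ∂_x, ∂_y, ∂_z` in a vector field. -/
def baseCoef (V : E → E) (i : Fin 4) (p : E) : ℝ := (V p).1 i

/-- The coefficients `(φ₁, φ₂, φ₃)` of `∂_u, ∂_v, ∂_w` in a vector field. -/
def depCoef (V : E → E) (α : Fin 3) (p : E) : ℝ := (V p).2 α

/-- The second prolongation `Pr⁽²⁾ V` of a vector field, a vector field on the jet space, by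
the general prolongation formula: the coefficient of `∂/∂uᵅ_I` is
`D_I (φᵅ - ∑ l, σˡ uᵅ_l) + ∑ l, σˡ uᵅ_{I l}`, from which the derivatives of `uᵅ` of order
`|I| + 1` cancel. -/
def prolong (V : E → E) (j : J) : J :=
  (V j.1,
   fun α i => totalD (depCoef V α) i j - ∑ l, totalD (baseCoef V l) i j * j.2.1 α l,
   fun α i k => totalD2 (depCoef V α) i k j
     - ∑ l, (totalD2 (baseCoef V l) i k j * j.2.1 α l
        + totalD (baseCoef V l) i j * j.2.2 α k l
        + totalD (baseCoef V l) k j * j.2.2 α i l))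

/-- `∂ᵢ² (u² + v²)` on jets. -/
def modSqDD (i : Fin 4) (j : J) : ℝ :=
  2 * ((j.2.1 0 i) ^ 2 + j.1.2 0 * j.2.2 0 i i + (j.2.1 1 i) ^ 2 + j.1.2 1 * j.2.2 1 i i)

/-- The differential functions `Δ₁, Δ₂, Δ₃` of the modified Davey--Stewartson system
`i ψ_t + ψ_xx + a₁ ψ_yy + ψ_zz = a₂ |ψ|² ψ + ψ w + i a₃ ψ`,
`w_xx + b₁ w_yy + w_zz = b₂ ((|ψ|²)_xx + (|ψ|²)_zz)`
for `ψ = u + i v`: imaginary and real part of the first equation, and the second equation. -/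
def mds (a₁ a₂ a₃ b₁ b₂ : ℝ) (m : Fin 3) (j : J) : ℝ :=
  let u := j.1.2 0
  let v := j.1.2 1
  let w := j.1.2 2
  let dt := fun α => j.2.1 α 0
  let dxx := fun α => j.2.2 α 1 1
  let dyy := fun α => j.2.2 α 2 2
  let dzz := fun α => j.2.2 α 3 3
  ![dt 0 + dxx 1 + a₁ * dyy 1 + dzz 1 - a₂ * v * (u ^ 2 + v ^ 2) - v * w - a₃ * u,
    -dt 1 + dxx 0 + a₁ * dyy 0 + dzz 0 - a₂ * u * (u ^ 2 + v ^ 2) - u * w + a₃ * v,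
    dxx 2 + b₁ * dyy 2 + dzz 2 - b₂ * modSqDD 1 j - b₂ * modSqDD 3 j] m

/-- `V` is a generator of Lie point symmetries of the system on `Ω`: its second prolongation
annihilates `Δ₁, Δ₂, Δ₃` at all jets over `Ω` that solve `Δ₁ = Δ₂ = Δ₃ = 0`. -/
def IsSymmetry (a₁ a₂ a₃ b₁ b₂ : ℝ) (V : VF Ω) : Prop :=
  ∀ j : J, j.1 ∈ Ω → IsJet j → (∀ m, mds a₁ a₂ a₃ b₁ b₂ m j = 0) →
    ∀ m, fderiv ℝ (mds a₁ a₂ a₃ b₁ b₂ m) j (prolong V.1 j) = 0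

/-! ### The vector fields -/

/-- The vector field `τ ∂_t + ξ ∂_x + η ∂_y + ζ ∂_z + φ₁ ∂_u + φ₂ ∂_v + φ₃ ∂_w`. -/
def mkField (τ ξ η ζ φ₁ φ₂ φ₃ : E → ℝ) (p : E) : E :=
  (![τ p, ξ p, η p, ζ p], ![φ₁ p, φ₂ p, φ₃ p])

theorem contDiffOn_mkField {s : Set E} {τ ξ η ζ φ₁ φ₂ φ₃ : E → ℝ}
    (h0 : ContDiffOn ℝ ∞ τ s) (h1 : ContDiffOn ℝ ∞ ξ s) (h2 : ContDiffOn ℝ ∞ η s)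
    (h3 : ContDiffOn ℝ ∞ ζ s) (h4 : ContDiffOn ℝ ∞ φ₁ s) (h5 : ContDiffOn ℝ ∞ φ₂ s)
    (h6 : ContDiffOn ℝ ∞ φ₃ s) : ContDiffOn ℝ ∞ (mkField τ ξ η ζ φ₁ φ₂ φ₃) s := by
  apply ContDiffOn.prodMk
  · rw [contDiffOn_pi]
    intro i
    fin_cases i <;> assumption
  · rw [contDiffOn_pi]
    intro i
    fin_cases i <;> assumption

/-- The coordinate functions `t, x, y, z, u, v, w`. -/
abbrev ct (p : E) : ℝ := p.1 0
abbrev cx (p : E) : ℝ := p.1 1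
abbrev cy (p : E) : ℝ := p.1 2
abbrev cz (p : E) : ℝ := p.1 3
abbrev cu (p : E) : ℝ := p.2 0
abbrev cv (p : E) : ℝ := p.2 1
abbrev cw (p : E) : ℝ := p.2 2

variable (Ω) in
/-- `X₁ = ∂_t`. -/
def X1 : VF Ω :=
  VF.of (mkField (fun _ => 1) (fun _ => 0) (fun _ => 0) (fun _ => 0)
    (fun _ => 0) (fun _ => 0) (fun _ => 0)) <| by
  apply contDiffOn_mkField <;> fun_prop

variable (Ω) in
/-- `X₂ = 2t∂_t + x∂_x + y∂_y + z∂_z - u∂_u - v∂_v - 2w∂_w`. -/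
def X2 : VF Ω :=
  VF.of (mkField (fun p => 2 * ct p) cx cy cz
    (fun p => -cu p) (fun p => -cv p) (fun p => -2 * cw p)) <| by
  apply contDiffOn_mkField <;> fun_prop

/-- The quadratic form `x² + y²/a₁ + z²`. -/
def rho (a₁ : ℝ) (p : E) : ℝ := cx p ^ 2 + cy p ^ 2 / a₁ + cz p ^ 2

variable (Ω) in
/-- `X̃₂ = e^{4a₃t} ( (1/(2a₃)) ∂_t + x∂_x + y∂_y + z∂_z - (u + a₃ρv)∂_u + (-v + a₃ρu)∂_v
- (2w + 4a₃²ρ)∂_w )` with `ρ = x² + y²/a₁ + z²`; it is used for nonzero `a₁` and `a₃`. -/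
def X2t (a₁ a₃ : ℝ) : VF Ω :=
  VF.of (fun p => Real.exp (4 * a₃ * ct p) •
    mkField (fun _ => 1 / (2 * a₃)) cx cy cz
      (fun p => -(cu p + a₃ * rho a₁ p * cv p))
      (fun p => -cv p + a₃ * rho a₁ p * cu p)
      (fun p => -(2 * cw p + 4 * a₃ ^ 2 * rho a₁ p)) p) <| by
  have he : ContDiffOn ℝ ∞ (fun p : E => Real.exp (4 * a₃ * ct p)) (Ω : Set E) := by
    fun_prop
  refine he.smul ?_
  apply contDiffOn_mkField <;> (try unfold rho) <;> fun_prop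

variable (Ω) in
/-- `X₃ = z∂_x - x∂_z`. -/
def X3 : VF Ω :=
  VF.of (mkField (fun _ => 0) cz (fun _ => 0) (fun p => -cx p)
    (fun _ => 0) (fun _ => 0) (fun _ => 0)) <| by
  apply contDiffOn_mkField <;> fun_prop

variable (Ω) in
/-- The set of all values of `t` on `Ω`. It is open, and an interval if `Ω` is convex. -/
def timeSet : Set ℝ := ct '' (Ω : Set E)

theorem isOpen_timeSet : IsOpen (timeSet Ω) :=
  ((isOpenMap_eval (0 : Fin 4)).comp isOpenMap_fst) _ Ω.isOpen

theorem mapsTo_ct : MapsTo ct (Ω : Set E) (timeSet Ω) := mapsTo_image _ _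

variable (Ω) in
/-- The smooth functions of `t`, defined where `t` ranges on `Ω` (the values of `toFun`
elsewhere are irrelevant). -/
structure TimeFun where
  toFun : ℝ → ℝ
  smooth : ContDiffOn ℝ ∞ toFun (timeSet Ω)

instance : CoeFun (TimeFun Ω) fun _ => ℝ → ℝ := ⟨TimeFun.toFun⟩

/-- The derivative of a function of `t`. -/
def TimeFun.d (g : TimeFun Ω) : TimeFun Ω :=
  ⟨deriv g, g.smooth.deriv_of_isOpen isOpen_timeSet (by simp)⟩

/-- The function `c (g₁' g₂ - g₁ g₂')`. -/
def TimeFun.wr (c : ℝ) (g₁ g₂ : TimeFun Ω) : TimeFun Ω :=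
  ⟨fun t => c * (g₁.d t * g₂ t - g₁ t * g₂.d t),
    contDiffOn_const.mul ((g₁.d.smooth.mul g₂.smooth).sub (g₁.smooth.mul g₂.d.smooth))⟩

theorem TimeFun.contDiffOn_comp (g : TimeFun Ω) :
    ContDiffOn ℝ ∞ (fun p : E => g (ct p)) (Ω : Set E) :=
  g.smooth.comp (by fun_prop) mapsTo_ct

/-- `𝒴(g) = g ∂_x - (x/2) (g' (v∂_u - u∂_v) + g'' ∂_w)`. -/
def Yf (g : TimeFun Ω) : VF Ω :=
  VF.of (mkField (fun _ => 0) (fun p => g (ct p)) (fun _ => 0) (fun _ => 0)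
    (fun p => -(cx p / 2) * (g.d (ct p) * cv p))
    (fun p => -(cx p / 2) * (-(g.d (ct p) * cu p)))
    (fun p => -(cx p / 2) * g.d.d (ct p))) <| by
  have h0 := g.contDiffOn_comp
  have h1 := g.d.contDiffOn_comp
  have h2 := g.d.d.contDiffOn_comp
  apply contDiffOn_mkField <;> fun_prop

/-- `𝒵(h) = h ∂_y - (y/(2a₁)) (h' (v∂_u - u∂_v) + h'' ∂_w)`. -/
def Zf (a₁ : ℝ) (h : TimeFun Ω) : VF Ω :=
  VF.of (mkField (fun _ => 0) (fun _ => 0) (fun p => h (ct p)) (fun _ => 0)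
    (fun p => -(cy p / (2 * a₁)) * (h.d (ct p) * cv p))
    (fun p => -(cy p / (2 * a₁)) * (-(h.d (ct p) * cu p)))
    (fun p => -(cy p / (2 * a₁)) * h.d.d (ct p))) <| by
  have h0 := h.contDiffOn_comp
  have h1 := h.d.contDiffOn_comp
  have h2 := h.d.d.contDiffOn_comp
  apply contDiffOn_mkField <;> fun_prop

/-- `𝒬(k) = k ∂_z - (z/2) (k' (v∂_u - u∂_v) + k'' ∂_w)`. -/
def Qf (k : TimeFun Ω) : VF Ω :=
  VF.of (mkField (fun _ => 0) (fun _ => 0) (fun _ => 0) (fun p => k (ct p))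
    (fun p => -(cz p / 2) * (k.d (ct p) * cv p))
    (fun p => -(cz p / 2) * (-(k.d (ct p) * cu p)))
    (fun p => -(cz p / 2) * k.d.d (ct p))) <| by
  have h0 := k.contDiffOn_comp
  have h1 := k.d.contDiffOn_comp
  have h2 := k.d.d.contDiffOn_comp
  apply contDiffOn_mkField <;> fun_prop

/-- `𝒲(m) = m (v∂_u - u∂_v) + m' ∂_w`. -/
def Wf (m : TimeFun Ω) : VF Ω :=
  VF.of (mkField (fun _ => 0) (fun _ => 0) (fun _ => 0) (fun _ => 0)
    (fun p => m (ct p) * cv p) (fun p => -(m (ct p) * cu p)) (fun p => m.d (ct p))) <| by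
  have h0 := m.contDiffOn_comp
  have h1 := m.d.contDiffOn_comp
  apply contDiffOn_mkField <;> fun_prop

/-! ### The structure of the symmetry algebra -/

/-- `{𝒴(g), 𝒵(h), 𝒬(k), 𝒲(m)}`: the span of all these vector fields. -/
def kmSpan (Ω : TopologicalSpace.Opens E) (a₁ : ℝ) : Submodule ℝ (VF Ω) :=
  Submodule.span ℝ (range Yf ∪ range (Zf a₁) ∪ range Qf ∪ range Wf)

/-- `L` is the internal semidirect sum of its subalgebra `S` and its ideal `N`. -/
structure IsSemidirectSum {A : Type*} [LieRing A] [LieAlgebra ℝ A]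
    (L S N : LieSubalgebra ℝ A) : Prop where
  le_left : S ≤ L
  le_right : N ≤ L
  ideal : ∀ X ∈ L, ∀ Y ∈ N, ⁅X, Y⁆ ∈ N
  disjoint : Disjoint S.toSubmodule N.toSubmodule
  sup_eq : S.toSubmodule ⊔ N.toSubmodule = L.toSubmodule

/-- The commutation relations of the Kac--Moody algebra `{𝒴(g), 𝒵(h), 𝒬(k), 𝒲(m)}`. -/
structure KMRelations (Ω : TopologicalSpace.Opens E) (a₁ : ℝ) : Prop where
  YY : ∀ g₁ g₂ : TimeFun Ω, ⁅Yf g₁, Yf g₂⁆ = Wf (TimeFun.wr (1 / 2) g₁ g₂)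
  ZZ : ∀ h₁ h₂ : TimeFun Ω, ⁅Zf a₁ h₁, Zf a₁ h₂⁆ = Wf (TimeFun.wr (1 / (2 * a₁)) h₁ h₂)
  QQ : ∀ k₁ k₂ : TimeFun Ω, ⁅Qf k₁, Qf k₂⁆ = Wf (TimeFun.wr (1 / 2) k₁ k₂)
  YZ : ∀ g h : TimeFun Ω, ⁅Yf g, Zf a₁ h⁆ = 0
  YQ : ∀ g k : TimeFun Ω, ⁅Yf g, Qf k⁆ = 0
  ZQ : ∀ h k : TimeFun Ω, ⁅Zf a₁ h, Qf k⁆ = 0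
  YW : ∀ g m : TimeFun Ω, ⁅Yf g, Wf m⁆ = 0
  ZW : ∀ h m : TimeFun Ω, ⁅Zf a₁ h, Wf m⁆ = 0
  QW : ∀ k m : TimeFun Ω, ⁅Qf k, Wf m⁆ = 0
  WW : ∀ m₁ m₂ : TimeFun Ω, ⁅Wf m₁, Wf m₂⁆ = 0

/-- The Lie algebra `N = {𝒴(g), 𝒵(h), 𝒬(k), 𝒲(m)}` is of Kac--Moody type, in the sense in which
this is said of symmetry algebras that involve arbitrary functions of time: it embeds, as a Lie
algebra, into the loop algebra of smooth functions of `t` with values in a finite-dimensional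
simple Lie algebra, here `𝔰𝔩(5, ℝ)`, the trace-free matrices with the commutator; the images of
the generators depend linearly, with constant coefficients, on the arbitrary functions and their
first derivatives. -/
def IsKacMoodyType (a₁ : ℝ) (N : LieSubalgebra ℝ (VF Ω)) : Prop :=
  ∃ ρ : N →ₗ[ℝ] (timeSet Ω → Matrix (Fin 5) (Fin 5) ℝ),
    Function.Injective ρ ∧
    (∀ X Y : N, ∀ t, ρ ⁅X, Y⁆ t = ρ X t * ρ Y t - ρ Y t * ρ X t) ∧
    ∃ (A B : Fin 3 → Matrix (Fin 5) (Fin 5) ℝ) (C : Matrix (Fin 5) (Fin 5) ℝ),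
      (∀ i, (A i).trace = 0) ∧ (∀ i, (B i).trace = 0) ∧ C.trace = 0 ∧
      (∀ (g : TimeFun Ω) (X : N), (X : VF Ω) = Yf g →
        ∀ t, ρ X t = g (t : ℝ) • A 0 + g.d (t : ℝ) • B 0) ∧
      (∀ (h : TimeFun Ω) (X : N), (X : VF Ω) = Zf a₁ h →
        ∀ t, ρ X t = h (t : ℝ) • A 1 + h.d (t : ℝ) • B 1) ∧
      (∀ (k : TimeFun Ω) (X : N), (X : VF Ω) = Qf k →
        ∀ t, ρ X t = k (t : ℝ) • A 2 + k.d (t : ℝ) • B 2) ∧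
      (∀ (m : TimeFun Ω) (X : N), (X : VF Ω) = Wf m →
        ∀ t, ρ X t = m (t : ℝ) • C)

end MDS

end

/-!
The symmetry generators are determined completely, in the form `IsGen`: a time change `τ ∂_t` with
the induced scaling of the other variables, a rotation with constant speed `q` in the
`(x, z)`-plane, translations by functions `g, h, k` of `t`, and a rotation of `ψ = u + i v` by a
`phase` that is quadratic in `x, y, z`, contains one more function `m` of `t`, and is compensated
by minus its derivative with respect to `t` in the coefficient of `∂_w`. Such a field is a symmetry
generator if and only if `τ'' = 4 a₃ τ'` and `(2 a₁ + b₁) τ''' = 0` (`Admissible`).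

* That these fields are symmetry generators is a computation of the prolongation
  (`IsGen.isSymmetry`).
* The converse (`IsSymmetry.exists_isGen`) is the solution of the determining equations. The
  invariance conditions are polynomials in the free jet coordinates. The coefficients of the mixed
  second derivatives determine the dependence of the coefficients of `∂_t, ∂_x, ∂_y, ∂_z` on most
  variables (`IsSymmetry.baseFacts`); here the second equation of the system, in which `y` is
  separated from `x, z`, excludes rotations that involve `y`. The remaining coefficients
  (`IsSymmetry.detEqs`) force the field to act on `(u, v)` as multiplication by a complex-valued
  function whose real part is `-τ'/2` and whose imaginary part has the gradient prescribed by the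
  motion of `x, y, z` (`DetEqs.exists_rotation`). The cubic term ties the scaling to `τ'`, which
  with the first equation gives `τ'' = 4 a₃ τ'`, and the second equation gives the condition on
  `τ'''`. As `Ω` is convex, functions with vanishing derivatives are constant, and the equations
  can be integrated.

The parameters of a field are unique (`IsGen.unique`), linear in the field, and the commutator acts
on them by an explicit formula (`IsGen.lie`). Everything else is read off from them. The symmetry
generators form a Lie algebra since the conditions on `τ` are preserved by `τ₁ τ₂' - τ₁' τ₂`. The
span `N` consists of the fields with `τ = 0` and `q = 0` (`mem_kmSpan`) and is an ideal, because the
commutator with such a field has again `τ = 0`, `q = 0`. A complement is given by the fields with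
`g = h = k = m = 0`, and the conditions on `τ` are linear differential equations whose solutions are
spanned by `1, t` if `a₃ = 0`, by `1, exp (4 a₃ t)` if `a₃ ≠ 0` and `b₁ = -2 a₁`, and by `1`
otherwise. Finally `N` is at each time a Heisenberg algebra with `g, h, k` and their derivatives as
conjugate variables and `m` in the centre, which embeds into `𝔰𝔩(5, ℝ)` as matrices supported in
the first row and the last column (`isKacMoodyType`).
-/

namespace MDS

noncomputable section

variable {Ω : TopologicalSpace.Opens E}

/-! ### Directional derivatives on the space of variables -/

/-- The coordinate vector `∂_t, ∂_x, ∂_y, ∂_z` for `i = 0, 1, 2, 3`. -/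
def eB (i : Fin 4) : E := (Pi.single i 1, 0)

/-- The coordinate vector `∂_u, ∂_v, ∂_w` for `α = 0, 1, 2`. -/
def eD (α : Fin 3) : E := (0, Pi.single α 1)

/-- The derivative of `F` in the direction of the fixed vector `d`. -/
def pd (d : E) (F : E → ℝ) (p : E) : ℝ := fderiv ℝ F p d

/-- `F` is differentiable at `p`, with derivative `c` in the direction `d`. -/
structure HasPD {X : Type*} [NormedAddCommGroup X] [NormedSpace ℝ X] (F : X → ℝ) (p d : X)
    (c : ℝ) : Prop where
  diff : DifferentiableAt ℝ F p
  eq : fderiv ℝ F p d = c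

namespace HasPD

section

variable {X : Type*} [NormedAddCommGroup X] [NormedSpace ℝ X] {F G : X → ℝ} {p d : X} {a b c : ℝ}

theorem of_eq (h : HasPD F p d a) (hab : a = b) : HasPD F p d b := hab ▸ h

theorem const (c : ℝ) (p d : X) : HasPD (fun _ => c) p d 0 :=
  ⟨differentiableAt_const c, by simp⟩

theorem of_line (hF : DifferentiableAt ℝ F p) (h : ∀ s : ℝ, F (p + s • d) = F p + s * c) :
    HasPD F p d c := by
  refine ⟨hF, ?_⟩
  have h1 : HasDerivAt (fun s : ℝ => p + s • d) d 0 := by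
    simpa using ((hasDerivAt_id (0 : ℝ)).smul_const d).const_add p
  have h2 : HasDerivAt (fun s : ℝ => F (p + s • d)) (fderiv ℝ F p d) 0 := by
    refine HasFDerivAt.comp_hasDerivAt (l := F) (0 : ℝ) ?_ h1
    simpa using hF.hasFDerivAt
  have h3 : HasDerivAt (fun s : ℝ => F (p + s • d)) c 0 := by
    simp only [h]
    simpa using ((hasDerivAt_id (0 : ℝ)).mul_const c).const_add (F p)
  exact h2.unique h3

theorem add (hF : HasPD F p d a) (hG : HasPD G p d b) :
    HasPD (fun p => F p + G p) p d (a + b) :=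
  ⟨hF.diff.add hG.diff, by
    have := fderiv_add hF.diff hG.diff
    change fderiv ℝ (F + G) p d = _
    rw [this, ← hF.eq, ← hG.eq]; rfl⟩

theorem sub (hF : HasPD F p d a) (hG : HasPD G p d b) :
    HasPD (fun p => F p - G p) p d (a - b) :=
  ⟨hF.diff.sub hG.diff, by
    have := fderiv_sub hF.diff hG.diff
    change fderiv ℝ (F - G) p d = _
    rw [this, ← hF.eq, ← hG.eq]; rfl⟩

theorem neg (hF : HasPD F p d a) : HasPD (fun p => -F p) p d (-a) :=
  ⟨hF.diff.neg, by
    change fderiv ℝ (-F) p d = _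
    rw [fderiv_neg, ← hF.eq]; rfl⟩

theorem mul (hF : HasPD F p d a) (hG : HasPD G p d b) :
    HasPD (fun p => F p * G p) p d (a * G p + F p * b) :=
  ⟨hF.diff.mul hG.diff, by
    have := fderiv_mul hF.diff hG.diff
    change fderiv ℝ (F * G) p d = _
    rw [this, ← hF.eq, ← hG.eq]
    simp only [add_apply, smul_apply, smul_eq_mul]
    ring⟩

theorem div_const (hF : HasPD F p d a) (c : ℝ) : HasPD (fun p => F p / c) p d (a / c) := by
  simp only [div_eq_mul_inv]
  exact (hF.mul (const c⁻¹ p d)).of_eq (by ring)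

theorem sq (hF : HasPD F p d a) : HasPD (fun p => F p ^ 2) p d (2 * F p * a) := by
  simp only [pow_two]
  exact (hF.mul hF).of_eq (by ring)

theorem congr_of_eventuallyEq (h : HasPD F p d a) (hFG : G =ᶠ[𝓝 p] F) : HasPD G p d a :=
  ⟨h.diff.congr_of_eventuallyEq hFG, by rw [hFG.fderiv_eq, h.eq]⟩

end

variable {F G : E → ℝ} {p d : E} {a : ℝ}

theorem base (i : Fin 4) (p d : E) : HasPD (fun p => p.1 i) p d (d.1 i) :=
  of_line (by fun_prop) fun s => by simp

theorem dep (α : Fin 3) (p d : E) : HasPD (fun p => p.2 α) p d (d.2 α) :=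
  of_line (by fun_prop) fun s => by simp

/-- The chain rule for a function of `t`. -/
theorem time {f : ℝ → ℝ} {c : ℝ} (hf : HasDerivAt f c (p.1 0)) (d : E) :
    HasPD (fun p => f (p.1 0)) p d (c * d.1 0) := by
  have h := base 0 p d
  have := hf.comp_hasFDerivAt p h.diff.hasFDerivAt
  refine ⟨this.differentiableAt, ?_⟩
  change fderiv ℝ (f ∘ fun p : E => p.1 0) p d = _
  rw [this.fderiv, ← h.eq]
  simp

theorem congr_on (h : HasPD F p d a) (hp : p ∈ Ω) (hFG : ∀ q ∈ Ω, G q = F q) :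
    HasPD G p d a :=
  h.congr_of_eventuallyEq (Filter.eventuallyEq_of_mem (Ω.isOpen.mem_nhds hp) hFG)

end HasPD

theorem decomp_E (d : E) : d = ∑ i, d.1 i • eB i + ∑ α, d.2 α • eD α := by
  ext i
  · fin_cases i <;> simp [eB, eD, Fin.sum_univ_four, Fin.sum_univ_three]
  · fin_cases i <;> simp [eB, eD, Fin.sum_univ_four, Fin.sum_univ_three]

theorem fderiv_eq_sum (F : E → ℝ) (p d : E) :
    fderiv ℝ F p d = ∑ i, d.1 i * pd (eB i) F p + ∑ α, d.2 α * pd (eD α) F p := by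
  conv_lhs => rw [decomp_E d]
  simp [pd, map_add, map_sum, map_smul]

theorem liftVec_eq (j : J) (i : Fin 4) :
    liftVec j i = eB i + (j.2.1 0 i • eD 0 + j.2.1 1 i • eD 1 + j.2.1 2 i • eD 2) := by
  ext k
  · simp [liftVec, eB, eD]
  · fin_cases k <;> simp [liftVec, eB, eD]

/-- Expansion of a total derivative in partial derivatives. -/
theorem totalD_eq (F : E → ℝ) (i : Fin 4) (j : J) :
    totalD F i j = pd (eB i) F j.1 + (j.2.1 0 i * pd (eD 0) F j.1
      + j.2.1 1 i * pd (eD 1) F j.1 + j.2.1 2 i * pd (eD 2) F j.1) := by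
  simp [totalD, liftVec_eq, pd]

/-! ### Smooth functions on an open set -/

/-- `F` is smooth at all points of `Ω`. -/
def SmoothOn (Ω : TopologicalSpace.Opens E) (F : E → ℝ) : Prop :=
  ∀ p ∈ Ω, ContDiffAt ℝ ∞ F p

namespace SmoothOn

variable {F G : E → ℝ}

theorem diff (hF : SmoothOn Ω F) {p : E} (hp : p ∈ Ω) : DifferentiableAt ℝ F p :=
  (hF p hp).differentiableAt (by simp)

theorem fderiv_contDiffAt (hF : SmoothOn Ω F) {p : E} (hp : p ∈ Ω) :
    ContDiffAt ℝ ∞ (fderiv ℝ F) p :=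
  (hF p hp).fderiv_right (m := ∞) (by simp)

theorem pd (hF : SmoothOn Ω F) (d : E) : SmoothOn Ω (pd d F) := fun _ hp =>
  (hF.fderiv_contDiffAt hp).clm_apply contDiffAt_const

theorem hasPD (hF : SmoothOn Ω F) {p : E} (hp : p ∈ Ω) (d : E) :
    HasPD F p d (MDS.pd d F p) := ⟨hF.diff hp, rfl⟩

/-- The second derivative as an iterated directional derivative. -/
theorem fderiv_fderiv (hF : SmoothOn Ω F) {p : E} (hp : p ∈ Ω) (d e : E) :
    fderiv ℝ (fderiv ℝ F) p d e = MDS.pd d (MDS.pd e F) p := by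
  have h := (hF.fderiv_contDiffAt hp).differentiableAt (by simp)
  have h2 := h.hasFDerivAt.clm_apply (hasFDerivAt_const e p)
  change _ = fderiv ℝ (fun y => fderiv ℝ F y e) p d
  rw [h2.fderiv]
  simp

theorem pd_comm (hF : SmoothOn Ω F) {p : E} (hp : p ∈ Ω) (d e : E) :
    MDS.pd d (MDS.pd e F) p = MDS.pd e (MDS.pd d F) p := by
  rw [← hF.fderiv_fderiv hp, ← hF.fderiv_fderiv hp]
  exact (hF p hp).isSymmSndFDerivAt
    (by rw [minSmoothness_of_isRCLikeNormedField]; exact WithTop.coe_le_coe.2 le_top) d e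

end SmoothOn

theorem pd_congr_on {F G : E → ℝ} (h : ∀ p ∈ Ω, F p = G p) (d : E) {p : E} (hp : p ∈ Ω) :
    pd d F p = pd d G p := by
  rw [pd, pd, (Filter.eventuallyEq_of_mem (Ω.isOpen.mem_nhds hp) h).fderiv_eq]

theorem pd_eq_zero_on {F : E → ℝ} {c : ℝ} (h : ∀ p ∈ Ω, F p = c) (d : E) {p : E} (hp : p ∈ Ω) :
    pd d F p = 0 := by
  rw [pd_congr_on h d hp]
  simp [pd]

theorem smoothOn_baseCoef (V : VF Ω) (l : Fin 4) : SmoothOn Ω (baseCoef V.1 l) := fun _ hp =>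
  contDiffAt_pi.1 (contDiffAt_fst.comp _ (V.contDiffAt hp)) l

theorem smoothOn_depCoef (V : VF Ω) (α : Fin 3) : SmoothOn Ω (depCoef V.1 α) := fun _ hp =>
  contDiffAt_pi.1 (contDiffAt_snd.comp _ (V.contDiffAt hp)) α

/-- Expansion of a repeated total derivative in partial derivatives. -/
theorem totalD2_eq {F : E → ℝ} (hF : SmoothOn Ω F) (i : Fin 4) {j : J} (hj : j.1 ∈ Ω) :
    totalD2 F i i j = pd (eB i) (pd (eB i) F) j.1
      + 2 * (j.2.1 0 i * pd (eB i) (pd (eD 0) F) j.1 + j.2.1 1 i * pd (eB i) (pd (eD 1) F) j.1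
        + j.2.1 2 i * pd (eB i) (pd (eD 2) F) j.1)
      + (j.2.1 0 i ^ 2 * pd (eD 0) (pd (eD 0) F) j.1 + j.2.1 1 i ^ 2 * pd (eD 1) (pd (eD 1) F) j.1
        + j.2.1 2 i ^ 2 * pd (eD 2) (pd (eD 2) F) j.1
        + 2 * (j.2.1 0 i * j.2.1 1 i * pd (eD 0) (pd (eD 1) F) j.1
          + j.2.1 0 i * j.2.1 2 i * pd (eD 0) (pd (eD 2) F) j.1
          + j.2.1 1 i * j.2.1 2 i * pd (eD 1) (pd (eD 2) F) j.1))
      + (j.2.2 0 i i * pd (eD 0) F j.1 + j.2.2 1 i i * pd (eD 1) F j.1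
        + j.2.2 2 i i * pd (eD 2) F j.1) := by
  have h2 : fderiv ℝ F j.1 (0, fun α => j.2.2 α i i) = (j.2.2 0 i i * pd (eD 0) F j.1
      + j.2.2 1 i i * pd (eD 1) F j.1 + j.2.2 2 i i * pd (eD 2) F j.1) := by
    rw [fderiv_eq_sum]
    simp [Fin.sum_univ_three]
  rw [totalD2, h2, liftVec_eq]
  simp only [map_add, map_smul, add_apply, smul_apply, smul_eq_mul, hF.fderiv_fderiv hj]
  rw [hF.pd_comm hj (eD 0) (eB i), hF.pd_comm hj (eD 1) (eB i), hF.pd_comm hj (eD 2) (eB i),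
    hF.pd_comm hj (eD 1) (eD 0), hF.pd_comm hj (eD 2) (eD 0), hF.pd_comm hj (eD 2) (eD 1)]
  ring

/-! ### Functions of time -/

namespace TimeFun

theorem hasDerivAt (f : TimeFun Ω) {t : ℝ} (ht : t ∈ timeSet Ω) : HasDerivAt f (f.d t) t :=
  ((f.smooth.contDiffAt (isOpen_timeSet.mem_nhds ht)).differentiableAt (by simp)).hasDerivAt

theorem d_eq {f : TimeFun Ω} {φ : ℝ → ℝ} {c t : ℝ} (h : ∀ s ∈ timeSet Ω, f s = φ s)
    (ht : t ∈ timeSet Ω) (hφ : HasDerivAt φ c t) : f.d t = c :=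
  (hφ.congr_of_eventuallyEq
    (Filter.eventuallyEq_of_mem (isOpen_timeSet.mem_nhds ht) h)).deriv

theorem d_congr {f g : TimeFun Ω} (h : ∀ s ∈ timeSet Ω, f s = g s) :
    ∀ s ∈ timeSet Ω, f.d s = g.d s := fun _ hs => d_eq h hs (g.hasDerivAt hs)

instance : Add (TimeFun Ω) := ⟨fun f g => ⟨fun t => f t + g t, f.smooth.add g.smooth⟩⟩
instance : Sub (TimeFun Ω) := ⟨fun f g => ⟨fun t => f t - g t, f.smooth.sub g.smooth⟩⟩
instance : Mul (TimeFun Ω) := ⟨fun f g => ⟨fun t => f t * g t, f.smooth.mul g.smooth⟩⟩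
instance : SMul ℝ (TimeFun Ω) := ⟨fun c f => ⟨fun t => c * f t, contDiffOn_const.mul f.smooth⟩⟩
instance : Zero (TimeFun Ω) := ⟨⟨fun _ => 0, contDiffOn_const⟩⟩

variable (f g : TimeFun Ω) (c t : ℝ)

@[simp] theorem add_apply : (f + g) t = f t + g t := rfl
@[simp] theorem sub_apply : (f - g) t = f t - g t := rfl
@[simp] theorem mul_apply : (f * g) t = f t * g t := rfl
@[simp] theorem smul_apply : (c • f) t = c * f t := rfl
@[simp] theorem zero_apply : (0 : TimeFun Ω) t = 0 := rfl

variable {t}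

theorem d_add (ht : t ∈ timeSet Ω) : (f + g).d t = (f.d + g.d) t :=
  d_eq (fun _ _ => rfl) ht ((f.hasDerivAt ht).add (g.hasDerivAt ht))

theorem d_sub (ht : t ∈ timeSet Ω) : (f - g).d t = (f.d - g.d) t :=
  d_eq (fun _ _ => rfl) ht ((f.hasDerivAt ht).sub (g.hasDerivAt ht))

theorem d_mul (ht : t ∈ timeSet Ω) : (f * g).d t = (f.d * g + f * g.d) t :=
  d_eq (fun _ _ => rfl) ht ((f.hasDerivAt ht).mul (g.hasDerivAt ht))

theorem d_smul (ht : t ∈ timeSet Ω) : (c • f).d t = (c • f.d) t :=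
  d_eq (fun _ _ => rfl) ht ((f.hasDerivAt ht).const_mul c)

theorem d_zero : (0 : TimeFun Ω).d = 0 := by
  change TimeFun.mk _ _ = TimeFun.mk _ _
  congr 1
  funext t
  exact deriv_const t 0

end TimeFun

theorem ct_mem {p : E} (hp : p ∈ Ω) : p.1 0 ∈ timeSet Ω := mem_image_of_mem ct hp

theorem HasPD.timeFun (f : TimeFun Ω) {p : E} (hp : p ∈ Ω) (d : E) :
    HasPD (fun p => f (p.1 0)) p d (f.d (p.1 0) * d.1 0) :=
  .time (f.hasDerivAt (ct_mem hp)) d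

theorem smoothOn_timeFun (f : TimeFun Ω) : SmoothOn Ω (fun p => f (p.1 0)) := fun _ hp =>
  f.contDiffOn_comp.contDiffAt (Ω.isOpen.mem_nhds hp)

theorem pd_timeFun (f : TimeFun Ω) {p : E} (hp : p ∈ Ω) (d : E) :
    pd d (fun p => f (p.1 0)) p = f.d (p.1 0) * d.1 0 := (HasPD.timeFun f hp d).eq

/-! ### Functions with vanishing derivatives on a convex set -/

/-- A function on a convex open set that has zero derivative in the direction of `q - p` takes
the same value at `p` and `q`. -/
theorem eq_of_fderiv_sub_eq_zero (hconv : Convex ℝ (Ω : Set E)) {F : E → ℝ} (hF : SmoothOn Ω F)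
    {p q : E} (hp : p ∈ Ω) (hq : q ∈ Ω) (h : ∀ r ∈ Ω, fderiv ℝ F r (q - p) = 0) : F p = F q := by
  have hmem : ∀ s ∈ Icc (0 : ℝ) 1, p + s • (q - p) ∈ Ω := fun s hs =>
    hconv.add_smul_sub_mem hp hq hs
  have hd : ∀ s ∈ Icc (0 : ℝ) 1, HasDerivAt (fun s : ℝ => F (p + s • (q - p))) 0 s := fun s hs => by
    have h1 : HasDerivAt (fun s : ℝ => p + s • (q - p)) (q - p) s := by
      simpa using ((hasDerivAt_id s).smul_const (q - p)).const_add p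
    have h2 := (hF.diff (hmem s hs)).hasFDerivAt.comp_hasDerivAt s h1
    rwa [h _ (hmem s hs)] at h2
  have := constant_of_has_deriv_right_zero (f := fun s : ℝ => F (p + s • (q - p))) (a := 0) (b := 1)
    (fun s hs => (hd s hs).continuousAt.continuousWithinAt)
    (fun s hs => (hd s (Ico_subset_Icc_self hs)).hasDerivWithinAt) 1 (by simp)
  simpa using this.symm

theorem exists_const_of_pd_eq_zero (hconv : Convex ℝ (Ω : Set E)) {F : E → ℝ}
    (hF : SmoothOn Ω F) (hB : ∀ i, ∀ p ∈ Ω, pd (eB i) F p = 0)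
    (hD : ∀ α, ∀ p ∈ Ω, pd (eD α) F p = 0) : ∃ c, ∀ p ∈ Ω, F p = c := by
  rcases (Ω : Set E).eq_empty_or_nonempty with h0 | ⟨q, hq⟩
  · exact ⟨0, fun p hp => absurd (show p ∈ (Ω : Set E) from hp) (h0 ▸ notMem_empty p)⟩
  · refine ⟨F q, fun p hp => eq_of_fderiv_sub_eq_zero hconv hF hp hq fun r hr => ?_⟩
    rw [fderiv_eq_sum]
    simp [hB _ r hr, hD _ r hr]

/-- A smooth function on a convex open set all of whose derivatives except the one with respect
to `t` vanish is a smooth function of `t`. -/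
theorem exists_timeFun (hconv : Convex ℝ (Ω : Set E)) {F : E → ℝ} (hF : SmoothOn Ω F)
    (hB : ∀ i, i ≠ 0 → ∀ p ∈ Ω, pd (eB i) F p = 0)
    (hD : ∀ α, ∀ p ∈ Ω, pd (eD α) F p = 0) : ∃ f : TimeFun Ω, ∀ p ∈ Ω, F p = f (p.1 0) := by
  have key : ∀ p ∈ Ω, ∀ q ∈ Ω, p.1 0 = q.1 0 → F p = F q := fun p hp q hq hpq =>
    eq_of_fderiv_sub_eq_zero hconv hF hp hq fun r hr => by
      rw [fderiv_eq_sum, Fin.sum_univ_four]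
      simp [hB 1 (by decide) r hr, hB 2 (by decide) r hr, hB 3 (by decide) r hr, hD _ r hr, hpq]
  choose! s hs using fun (t : ℝ) (ht : t ∈ timeSet Ω) => ht
  have hval : ∀ p ∈ Ω, F p = F (s (p.1 0)) := fun p hp =>
    key p hp _ (hs _ (ct_mem hp)).1 (hs _ (ct_mem hp)).2.symm
  refine ⟨⟨fun t => F (s t), ?_⟩, hval⟩
  rintro t ⟨p, hp, rfl⟩
  -- near `t` the function is `F` along the line through `p` parallel to the `t`-axis
  have hline : ContDiff ℝ ∞ (fun r : ℝ => p + (r - ct p) • eB 0) := by fun_prop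
  have h0 : p + (ct p - ct p) • eB 0 = p := by simp
  have hsm : ContDiffAt ℝ ∞ (fun r : ℝ => F (p + (r - ct p) • eB 0)) (ct p) :=
    ContDiffAt.comp (g := F) (ct p) (by simpa only [h0] using hF p hp) hline.contDiffAt
  refine (hsm.congr_of_eventuallyEq ?_).contDiffWithinAt
  have hmem : ∀ᶠ r in 𝓝 (ct p), p + (r - ct p) • eB 0 ∈ (Ω : Set E) := by
    apply hline.continuous.continuousAt.eventually_mem
    rw [h0]
    exact Ω.isOpen.mem_nhds hp
  filter_upwards [hmem] with r hr
  have := hval _ hr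
  rw [this]
  simp [eB]

/-- A smooth function on `Ω` whose product with a dependent variable vanishes is zero. -/
theorem eq_zero_of_dep_mul_eq_zero {F : E → ℝ} (hF : SmoothOn Ω F) (α : Fin 3)
    (h : ∀ p ∈ Ω, p.2 α * F p = 0) : ∀ p ∈ Ω, F p = 0 := by
  intro p hp
  by_cases hα : p.2 α = 0
  · have h1 := ((HasPD.dep α p (eD α)).mul (hF.hasPD hp (eD α))).eq
    have h2 := pd_eq_zero_on h (eD α) hp
    rw [pd, h1, hα] at h2
    simpa [eD] using h2
  · exact (mul_eq_zero.1 (h p hp)).resolve_left hα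

/-! ### The linearised system -/

section Linearised

variable (a₁ a₂ a₃ b₁ b₂ : ℝ)

theorem mds_zero (j : J) : mds a₁ a₂ a₃ b₁ b₂ 0 j =
    j.2.1 0 0 + j.2.2 1 1 1 + a₁ * j.2.2 1 2 2 + j.2.2 1 3 3
      - a₂ * j.1.2 1 * (j.1.2 0 ^ 2 + j.1.2 1 ^ 2) - j.1.2 1 * j.1.2 2 - a₃ * j.1.2 0 := rfl

theorem mds_one (j : J) : mds a₁ a₂ a₃ b₁ b₂ 1 j =
    -j.2.1 1 0 + j.2.2 0 1 1 + a₁ * j.2.2 0 2 2 + j.2.2 0 3 3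
      - a₂ * j.1.2 0 * (j.1.2 0 ^ 2 + j.1.2 1 ^ 2) - j.1.2 0 * j.1.2 2 + a₃ * j.1.2 1 := rfl

theorem mds_two (j : J) : mds a₁ a₂ a₃ b₁ b₂ 2 j =
    j.2.2 2 1 1 + b₁ * j.2.2 2 2 2 + j.2.2 2 3 3
      - b₂ * (2 * (j.2.1 0 1 ^ 2 + j.1.2 0 * j.2.2 0 1 1 + j.2.1 1 1 ^ 2 + j.1.2 1 * j.2.2 1 1 1))
      - b₂ * (2 * (j.2.1 0 3 ^ 2 + j.1.2 0 * j.2.2 0 3 3 + j.2.1 1 3 ^ 2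
        + j.1.2 1 * j.2.2 1 3 3)) := rfl

theorem HasPD.jetDep (α : Fin 3) (j δ : J) : HasPD (fun j : J => j.1.2 α) j δ (δ.1.2 α) :=
  of_line (by fun_prop) fun s => by simp

theorem HasPD.jetFst (α : Fin 3) (i : Fin 4) (j δ : J) :
    HasPD (fun j : J => j.2.1 α i) j δ (δ.2.1 α i) :=
  of_line (by fun_prop) fun s => by simp

theorem HasPD.jetSnd (α : Fin 3) (i k : Fin 4) (j δ : J) :
    HasPD (fun j : J => j.2.2 α i k) j δ (δ.2.2 α i k) :=
  of_line (by fun_prop) fun s => by simp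

theorem fderiv_mds_zero (j δ : J) : fderiv ℝ (mds a₁ a₂ a₃ b₁ b₂ 0) j δ =
    δ.2.1 0 0 + δ.2.2 1 1 1 + a₁ * δ.2.2 1 2 2 + δ.2.2 1 3 3
      - a₂ * (δ.1.2 1 * (j.1.2 0 ^ 2 + j.1.2 1 ^ 2)
        + j.1.2 1 * (2 * j.1.2 0 * δ.1.2 0 + 2 * j.1.2 1 * δ.1.2 1))
      - (δ.1.2 1 * j.1.2 2 + j.1.2 1 * δ.1.2 2) - a₃ * δ.1.2 0 := by
  apply HasPD.eq
  rw [show mds a₁ a₂ a₃ b₁ b₂ 0 = _ from funext (mds_zero a₁ a₂ a₃ b₁ b₂)]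
  apply HasPD.of_eq
  · repeat' first
      | exact HasPD.const _ _ _ | exact HasPD.jetDep _ _ _ | exact HasPD.jetFst _ _ _ _
      | exact HasPD.jetSnd _ _ _ _ _ | apply HasPD.sub | apply HasPD.add | apply HasPD.sq
      | apply HasPD.mul
  · ring

theorem fderiv_mds_one (j δ : J) : fderiv ℝ (mds a₁ a₂ a₃ b₁ b₂ 1) j δ =
    -δ.2.1 1 0 + δ.2.2 0 1 1 + a₁ * δ.2.2 0 2 2 + δ.2.2 0 3 3
      - a₂ * (δ.1.2 0 * (j.1.2 0 ^ 2 + j.1.2 1 ^ 2)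
        + j.1.2 0 * (2 * j.1.2 0 * δ.1.2 0 + 2 * j.1.2 1 * δ.1.2 1))
      - (δ.1.2 0 * j.1.2 2 + j.1.2 0 * δ.1.2 2) + a₃ * δ.1.2 1 := by
  apply HasPD.eq
  rw [show mds a₁ a₂ a₃ b₁ b₂ 1 = _ from funext (mds_one a₁ a₂ a₃ b₁ b₂)]
  apply HasPD.of_eq
  · repeat' first
      | exact HasPD.const _ _ _ | exact HasPD.jetDep _ _ _ | exact HasPD.jetFst _ _ _ _
      | exact HasPD.jetSnd _ _ _ _ _ | apply HasPD.sub | apply HasPD.add | apply HasPD.sq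
      | apply HasPD.mul | apply HasPD.neg
  · ring

theorem fderiv_mds_two (j δ : J) : fderiv ℝ (mds a₁ a₂ a₃ b₁ b₂ 2) j δ =
    δ.2.2 2 1 1 + b₁ * δ.2.2 2 2 2 + δ.2.2 2 3 3
      - 2 * b₂ * (2 * j.2.1 0 1 * δ.2.1 0 1 + δ.1.2 0 * j.2.2 0 1 1 + j.1.2 0 * δ.2.2 0 1 1
        + 2 * j.2.1 1 1 * δ.2.1 1 1 + δ.1.2 1 * j.2.2 1 1 1 + j.1.2 1 * δ.2.2 1 1 1)
      - 2 * b₂ * (2 * j.2.1 0 3 * δ.2.1 0 3 + δ.1.2 0 * j.2.2 0 3 3 + j.1.2 0 * δ.2.2 0 3 3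
        + 2 * j.2.1 1 3 * δ.2.1 1 3 + δ.1.2 1 * j.2.2 1 3 3 + j.1.2 1 * δ.2.2 1 3 3) := by
  apply HasPD.eq
  rw [show mds a₁ a₂ a₃ b₁ b₂ 2 = _ from funext (mds_two a₁ a₂ a₃ b₁ b₂)]
  apply HasPD.of_eq
  · repeat' first
      | exact HasPD.const _ _ _ | exact HasPD.jetDep _ _ _ | exact HasPD.jetFst _ _ _ _
      | exact HasPD.jetSnd _ _ _ _ _ | apply HasPD.sub | apply HasPD.add | apply HasPD.sq
      | apply HasPD.mul
  · ring

end Linearised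

/-! ### Total derivatives of explicit expressions -/

/-- `F` is smooth near the base point of the jet `j`, with total derivatives `Dᵢ F = a` and
`Dᵢ Dᵢ F = b`. -/
structure HasTD (F : E → ℝ) (i : Fin 4) (j : J) (a b : ℝ) : Prop where
  smooth : ContDiffAt ℝ ∞ F j.1
  fst : totalD F i j = a
  snd : totalD2 F i i j = b

namespace HasTD

variable {F G : E → ℝ} {i : Fin 4} {j : J} {a b a' b' : ℝ}

theorem diff (h : HasTD F i j a b) : DifferentiableAt ℝ F j.1 :=
  h.smooth.differentiableAt (by simp)

theorem eventually_diff (h : HasTD F i j a b) : ∀ᶠ q in 𝓝 j.1, DifferentiableAt ℝ F q := by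
  have := (h.smooth.of_le (m := 1) (by simp)).eventually (by simp)
  filter_upwards [this] with q hq
  exact hq.differentiableAt (by simp)

theorem fderiv_diff (h : HasTD F i j a b) : DifferentiableAt ℝ (fderiv ℝ F) j.1 :=
  (h.smooth.fderiv_right (m := ∞) (by simp)).differentiableAt (by simp)

theorem of_eq (h : HasTD F i j a b) (ha : a = a') (hb : b = b') : HasTD F i j a' b' :=
  ha ▸ hb ▸ h

theorem congr_on (h : HasTD F i j a b) (hj : j.1 ∈ Ω) (hFG : ∀ q ∈ Ω, G q = F q) :
    HasTD G i j a b := by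
  have he : G =ᶠ[𝓝 j.1] F := Filter.eventuallyEq_of_mem (Ω.isOpen.mem_nhds hj) hFG
  refine ⟨h.smooth.congr_of_eventuallyEq he, ?_, ?_⟩
  · rw [totalD, he.fderiv_eq]
    exact h.fst
  · rw [totalD2, he.fderiv_eq, he.fderiv.fderiv_eq]
    exact h.snd

theorem const (c : ℝ) (i : Fin 4) (j : J) : HasTD (fun _ => c) i j 0 0 :=
  ⟨contDiffAt_const, by simp [totalD], by simp [totalD2]⟩

theorem base (l i : Fin 4) (j : J) :
    HasTD (fun p => p.1 l) i j (Pi.single (M := fun _ => ℝ) i 1 l) 0 := by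
  refine ⟨by fun_prop, (HasPD.base l _ _).eq, ?_⟩
  have h : fderiv ℝ (fun p : E => p.1 l) = fun _ => fderiv ℝ (fun p : E => p.1 l) 0 := by
    funext p
    ext d <;> simp [(HasPD.base l _ _).eq]
  rw [totalD2, (HasPD.base l _ _).eq, h]
  simp

theorem dep (α : Fin 3) (i : Fin 4) (j : J) :
    HasTD (fun p => p.2 α) i j (j.2.1 α i) (j.2.2 α i i) := by
  refine ⟨by fun_prop, (HasPD.dep α _ _).eq, ?_⟩
  have h : fderiv ℝ (fun p : E => p.2 α) = fun _ => fderiv ℝ (fun p : E => p.2 α) 0 := by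
    funext p
    ext d <;> simp [(HasPD.dep α _ _).eq]
  rw [totalD2, (HasPD.dep α _ _).eq, h]
  simp

theorem add (hF : HasTD F i j a b) (hG : HasTD G i j a' b') :
    HasTD (fun p => F p + G p) i j (a + a') (b + b') := by
  have h1 : fderiv ℝ (fun p => F p + G p) =ᶠ[𝓝 j.1] fun q => fderiv ℝ F q + fderiv ℝ G q := by
    filter_upwards [hF.eventually_diff, hG.eventually_diff] with q h1 h2
    exact fderiv_add h1 h2
  refine ⟨hF.smooth.add hG.smooth, ?_, ?_⟩
  · rw [totalD, h1.eq_of_nhds, ← hF.fst, ← hG.fst]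
    rfl
  · have h2 : fderiv ℝ (fun q => fderiv ℝ F q + fderiv ℝ G q) j.1 = _ :=
      fderiv_add hF.fderiv_diff hG.fderiv_diff
    rw [totalD2, h1.fderiv_eq, h2, h1.eq_of_nhds, ← hF.snd, ← hG.snd, totalD2, totalD2]
    simp only [add_apply]
    ring

theorem mul (hF : HasTD F i j a b) (hG : HasTD G i j a' b') :
    HasTD (fun p => F p * G p) i j (a * G j.1 + F j.1 * a')
      (b * G j.1 + 2 * a * a' + F j.1 * b') := by
  have h1 : fderiv ℝ (fun p => F p * G p) =ᶠ[𝓝 j.1]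
      fun q => F q • fderiv ℝ G q + G q • fderiv ℝ F q := by
    filter_upwards [hF.eventually_diff, hG.eventually_diff] with q h1 h2
    exact fderiv_mul h1 h2
  refine ⟨hF.smooth.mul hG.smooth, ?_, ?_⟩
  · rw [totalD, h1.eq_of_nhds, ← hF.fst, ← hG.fst]
    simp only [add_apply, smul_apply, smul_eq_mul, totalD]
    ring
  · have h2 := ((hF.diff.hasFDerivAt.smul hG.fderiv_diff.hasFDerivAt).add
      (hG.diff.hasFDerivAt.smul hF.fderiv_diff.hasFDerivAt)).fderiv
    rw [totalD2, h1.fderiv_eq, h1.eq_of_nhds, ← hF.snd, ← hG.snd, totalD2, totalD2, ← hF.fst,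
      ← hG.fst, totalD, totalD]
    erw [h2]
    simp only [add_apply, smul_apply, smul_eq_mul, ContinuousLinearMap.smulRight_apply]
    ring

theorem neg (hF : HasTD F i j a b) : HasTD (fun p => -F p) i j (-a) (-b) := by
  have h := ((const (-1) i j).mul hF).of_eq (a' := -a) (b' := -b) (by ring) (by ring)
  simpa only [neg_one_mul] using h

theorem sub (hF : HasTD F i j a b) (hG : HasTD G i j a' b') :
    HasTD (fun p => F p - G p) i j (a - a') (b - b') := by
  simpa only [sub_eq_add_neg] using hF.add hG.neg

theorem div_const (hF : HasTD F i j a b) (c : ℝ) :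
    HasTD (fun p => F p / c) i j (a / c) (b / c) := by
  simp only [div_eq_mul_inv]
  exact (hF.mul (const c⁻¹ i j)).of_eq (by ring) (by ring)

theorem sq (hF : HasTD F i j a b) :
    HasTD (fun p => F p ^ 2) i j (2 * F j.1 * a) (2 * (a ^ 2 + F j.1 * b)) := by
  simp only [pow_two]
  exact (hF.mul hF).of_eq (by ring) (by ring)

/-- Functions of `t` have vanishing total derivatives with respect to the other variables. -/
theorem timeFun (f : TimeFun Ω) (i : Fin 4) {j : J} (hj : j.1 ∈ Ω) :
    HasTD (fun p => f (p.1 0)) i j (f.d (j.1.1 0) * Pi.single (M := fun _ => ℝ) i 1 0)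
      (f.d.d (j.1.1 0) * (Pi.single (M := fun _ => ℝ) i 1 0) ^ 2) := by
  refine ⟨smoothOn_timeFun f _ hj, (HasPD.timeFun f hj _).eq, ?_⟩
  rw [totalD2, (HasPD.timeFun f hj _).eq, (smoothOn_timeFun f).fderiv_fderiv hj,
    pd_congr_on (fun q hq => pd_timeFun f hq _) _ hj, pd,
    ((HasPD.timeFun f.d hj _).mul (HasPD.const _ _ _)).eq]
  simp [liftVec, pow_two]
  ring

end HasTD

/-! ### The general symmetry generator -/

/-- The phase `τ''ρ/8 + (x g' + y h'/a₁ + z k')/2 - m` by which a symmetry generator rotates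
`ψ = u + i v`. -/
def phase (a₁ : ℝ) (τ g h k m : TimeFun Ω) (p : E) : ℝ :=
  τ.d.d (p.1 0) * ((p.1 1) ^ 2 + (p.1 2) ^ 2 / a₁ + (p.1 3) ^ 2) / 8
    + (p.1 1 * g.d (p.1 0) + p.1 2 * h.d (p.1 0) / a₁ + p.1 3 * k.d (p.1 0)) / 2 - m (p.1 0)

/-- On `Ω` the field `V` has the form that solves the determining equations of the system up to
the conditions on `τ`: a time change `τ` with the induced scaling, a rotation `q` in the
`(x, z)`-plane, time-dependent translations `g, h, k`, and the rotation of `ψ` by `phase`. -/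
structure IsGen (a₁ : ℝ) (V : VF Ω) (τ : TimeFun Ω) (q : ℝ) (g h k m : TimeFun Ω) : Prop where
  base0 : ∀ p ∈ Ω, baseCoef V.1 0 p = τ (p.1 0)
  base1 : ∀ p ∈ Ω, baseCoef V.1 1 p = τ.d (p.1 0) / 2 * p.1 1 + q * p.1 3 + g (p.1 0)
  base2 : ∀ p ∈ Ω, baseCoef V.1 2 p = τ.d (p.1 0) / 2 * p.1 2 + h (p.1 0)
  base3 : ∀ p ∈ Ω, baseCoef V.1 3 p = τ.d (p.1 0) / 2 * p.1 3 - q * p.1 1 + k (p.1 0)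
  dep0 : ∀ p ∈ Ω, depCoef V.1 0 p = -(τ.d (p.1 0) / 2 * p.2 0) - phase a₁ τ g h k m p * p.2 1
  dep1 : ∀ p ∈ Ω, depCoef V.1 1 p = phase a₁ τ g h k m p * p.2 0 - τ.d (p.1 0) / 2 * p.2 1
  dep2 : ∀ p ∈ Ω, depCoef V.1 2 p =
    -phase a₁ τ.d g.d h.d k.d m.d p - τ.d (p.1 0) * p.2 2

/-- The fields of the form `IsGen` with `τ'' = 4 a₃ τ'` and `(2 a₁ + b₁) τ''' = 0` are symmetry
generators. -/
theorem IsGen.isSymmetry {a₁ a₂ a₃ b₁ b₂ : ℝ} (ha₁ : a₁ ≠ 0) {V : VF Ω} {τ : TimeFun Ω} {q : ℝ}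
    {g h k m : TimeFun Ω} (H : IsGen a₁ V τ q g h k m)
    (hτ : ∀ t ∈ timeSet Ω, τ.d.d t = 4 * a₃ * τ.d t)
    (hτ3 : ∀ t ∈ timeSet Ω, (2 * a₁ + b₁) * τ.d.d.d t = 0) : IsSymmetry a₁ a₂ a₃ b₁ b₂ V := by
  intro j hj hJ hm
  have h0 := hm 0
  have h1 := hm 1
  have h2 := hm 2
  rw [mds_zero] at h0
  rw [mds_one] at h1
  rw [mds_two] at h2
  have e1 := hτ _ (ct_mem hj)
  have e2 := hτ3 _ (ct_mem hj)
  have TP := fun (τ g h k m : TimeFun Ω) (i : Fin 4) =>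
    ((((HasTD.timeFun τ.d.d i hj).mul (((HasTD.base 1 i j).sq.add
      ((HasTD.base 2 i j).sq.div_const a₁)).add (HasTD.base 3 i j).sq)).div_const 8).add
      (((((HasTD.base 1 i j).mul (HasTD.timeFun g.d i hj)).add
        (((HasTD.base 2 i j).mul (HasTD.timeFun h.d i hj)).div_const a₁)).add
        ((HasTD.base 3 i j).mul (HasTD.timeFun k.d i hj))).div_const 2)).sub
      (HasTD.timeFun m i hj)
  have S0 := fun i => (HasTD.timeFun τ i hj).congr_on hj H.base0
  have S1 := fun i => (((((HasTD.timeFun τ.d i hj).div_const 2).mul (HasTD.base 1 i j)).add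
    ((HasTD.const q i j).mul (HasTD.base 3 i j))).add (HasTD.timeFun g i hj)).congr_on hj H.base1
  have S2 := fun i => ((((HasTD.timeFun τ.d i hj).div_const 2).mul (HasTD.base 2 i j)).add
    (HasTD.timeFun h i hj)).congr_on hj H.base2
  have S3 := fun i => (((((HasTD.timeFun τ.d i hj).div_const 2).mul (HasTD.base 3 i j)).sub
    ((HasTD.const q i j).mul (HasTD.base 1 i j))).add (HasTD.timeFun k i hj)).congr_on hj H.base3
  have P0 := fun i => ((((HasTD.timeFun τ.d i hj).div_const 2).mul (HasTD.dep 0 i j)).neg.sub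
    ((TP τ g h k m i).mul (HasTD.dep 1 i j))).congr_on hj H.dep0
  have P1 := fun i => (((TP τ g h k m i).mul (HasTD.dep 0 i j)).sub
    (((HasTD.timeFun τ.d i hj).div_const 2).mul (HasTD.dep 1 i j))).congr_on hj H.dep1
  have P2 := fun i => ((TP τ.d g.d h.d k.d m.d i).neg.sub
    ((HasTD.timeFun τ.d i hj).mul (HasTD.dep 2 i j))).congr_on hj H.dep2
  have S0a := fun i => (S0 i).fst
  have S1a := fun i => (S1 i).fst
  have S2a := fun i => (S2 i).fst
  have S3a := fun i => (S3 i).fst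
  have P0a := fun i => (P0 i).fst
  have P1a := fun i => (P1 i).fst
  have S0b := fun i => (S0 i).snd
  have S1b := fun i => (S1 i).snd
  have S2b := fun i => (S2 i).snd
  have S3b := fun i => (S3 i).snd
  have P0b := fun i => (P0 i).snd
  have P1b := fun i => (P1 i).snd
  have P2b := fun i => (P2 i).snd
  have V0 : (V.1 j.1).2 0 = _ := H.dep0 _ hj
  have V1 : (V.1 j.1).2 1 = _ := H.dep1 _ hj
  have V2 : (V.1 j.1).2 2 = _ := H.dep2 _ hj
  have E0 : fderiv ℝ (mds a₁ a₂ a₃ b₁ b₂ 0) j (prolong V.1 j) = 0 := by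
    rw [fderiv_mds_zero]
    simp only [prolong, Fin.sum_univ_four, S0a, S1a, S2a, S3a, S0b, S1b, S2b, S3b,
      P0a, P1b, V0, V1, V2, hJ _ 3 1, phase]
    simp
    linear_combination (norm := skip) (-3 / 2 * τ.d (j.1.1 0)) * h0
      + phase a₁ τ g h k m j.1 * h1 + j.1.2 0 / 4 * e1
    unfold phase
    field_simp
    ring
  have E1 : fderiv ℝ (mds a₁ a₂ a₃ b₁ b₂ 1) j (prolong V.1 j) = 0 := by
    rw [fderiv_mds_one]
    simp only [prolong, Fin.sum_univ_four, S0a, S1a, S2a, S3a, S0b, S1b, S2b, S3b,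
      P1a, P0b, V0, V1, V2, hJ _ 3 1, phase]
    simp
    linear_combination (norm := skip) (-3 / 2 * τ.d (j.1.1 0)) * h1
      - phase a₁ τ g h k m j.1 * h0 - j.1.2 1 / 4 * e1
    unfold phase
    field_simp
    ring
  have E2 : fderiv ℝ (mds a₁ a₂ a₃ b₁ b₂ 2) j (prolong V.1 j) = 0 := by
    rw [fderiv_mds_two]
    simp only [prolong, Fin.sum_univ_four, S0a, S1a, S2a, S3a, S0b, S1b, S2b, S3b,
      P0a, P1a, P0b, P1b, P2b, V0, V1, hJ _ 3 1, phase]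
    simp
    linear_combination (norm := skip) (-2 * τ.d (j.1.1 0)) * h2 - 1 / (4 * a₁) * e2
    field_simp
    ring
  intro m
  fin_cases m
  exacts [E0, E1, E2]

/-! ### The commutator of two fields of the general form -/

theorem HasPD.baseCoef_lie (V W : VF Ω) {p : E} (hp : p ∈ Ω) (l : Fin 4) {a b : ℝ}
    (hV : HasPD (baseCoef V.1 l) p (W.1 p) a) (hW : HasPD (baseCoef W.1 l) p (V.1 p) b) :
    baseCoef (⁅V, W⁆ : VF Ω).1 l p = b - a := by
  have h : ∀ (U : VF Ω) (d : E), (fderiv ℝ U.1 p d).1 l = fderiv ℝ (baseCoef U.1 l) p d := by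
    intro U d
    have := (HasPD.base l (U.1 p) (fderiv ℝ U.1 p d))
    rw [← this.eq]
    have h2 := this.diff.hasFDerivAt.comp p (U.differentiableAt hp).hasFDerivAt
    change _ = fderiv ℝ ((fun q : E => q.1 l) ∘ U.1) p d
    rw [h2.fderiv]
    rfl
  rw [← hV.eq, ← hW.eq, ← h, ← h, baseCoef, VF.bracket_apply V W hp]
  rfl

theorem HasPD.depCoef_lie (V W : VF Ω) {p : E} (hp : p ∈ Ω) (α : Fin 3) {a b : ℝ}
    (hV : HasPD (depCoef V.1 α) p (W.1 p) a) (hW : HasPD (depCoef W.1 α) p (V.1 p) b) :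
    depCoef (⁅V, W⁆ : VF Ω).1 α p = b - a := by
  have h : ∀ (U : VF Ω) (d : E), (fderiv ℝ U.1 p d).2 α = fderiv ℝ (depCoef U.1 α) p d := by
    intro U d
    have := (HasPD.dep α (U.1 p) (fderiv ℝ U.1 p d))
    rw [← this.eq]
    have h2 := this.diff.hasFDerivAt.comp p (U.differentiableAt hp).hasFDerivAt
    change _ = fderiv ℝ ((fun q : E => q.2 α) ∘ U.1) p d
    rw [h2.fderiv]
    rfl
  rw [← hV.eq, ← hW.eq, ← h, ← h, depCoef, VF.bracket_apply V W hp]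
  rfl

theorem HasPD.phase (a₁ : ℝ) (τ g h k m : TimeFun Ω) {p : E} (hp : p ∈ Ω) (d : E) :
    HasPD (phase a₁ τ g h k m) p d (phase a₁ τ.d g.d h.d k.d m.d p * d.1 0
      + τ.d.d (p.1 0) * (p.1 1 * d.1 1 + p.1 2 * d.1 2 / a₁ + p.1 3 * d.1 3) / 4
      + (d.1 1 * g.d (p.1 0) + d.1 2 * h.d (p.1 0) / a₁ + d.1 3 * k.d (p.1 0)) / 2) :=
  HasPD.of_eq (((((HasPD.timeFun τ.d.d hp d).mul (((HasPD.base 1 p d).sq.add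
    ((HasPD.base 2 p d).sq.div_const a₁)).add (HasPD.base 3 p d).sq)).div_const 8).add
    (((((HasPD.base 1 p d).mul (HasPD.timeFun g.d hp d)).add
      (((HasPD.base 2 p d).mul (HasPD.timeFun h.d hp d)).div_const a₁)).add
      ((HasPD.base 3 p d).mul (HasPD.timeFun k.d hp d))).div_const 2)).sub
    (HasPD.timeFun m hp d)) (by unfold MDS.phase; ring)

namespace IsGen

variable {a₁ : ℝ} {V W : VF Ω} {τ g h k m τ' g' h' k' m' : TimeFun Ω} {q q' : ℝ}

theorem hasPD_base0 (H : IsGen a₁ V τ q g h k m) {p : E} (hp : p ∈ Ω) (d : E) :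
    HasPD (baseCoef V.1 0) p d (τ.d (p.1 0) * d.1 0) :=
  (HasPD.timeFun τ hp d).congr_on hp H.base0

theorem hasPD_base1 (H : IsGen a₁ V τ q g h k m) {p : E} (hp : p ∈ Ω) (d : E) :
    HasPD (baseCoef V.1 1) p d (τ.d.d (p.1 0) * d.1 0 / 2 * p.1 1
    + τ.d (p.1 0) / 2 * d.1 1 + q * d.1 3 + g.d (p.1 0) * d.1 0) :=
  ((((((HasPD.timeFun τ.d hp d).div_const 2).mul (HasPD.base 1 p d)).add
    ((HasPD.const q p d).mul (HasPD.base 3 p d))).add (HasPD.timeFun g hp d)).congr_on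
    hp H.base1).of_eq (by ring)

theorem hasPD_base2 (H : IsGen a₁ V τ q g h k m) {p : E} (hp : p ∈ Ω) (d : E) :
    HasPD (baseCoef V.1 2) p d (τ.d.d (p.1 0) * d.1 0 / 2 * p.1 2
    + τ.d (p.1 0) / 2 * d.1 2 + h.d (p.1 0) * d.1 0) :=
  ((((HasPD.timeFun τ.d hp d).div_const 2).mul (HasPD.base 2 p d)).add
    (HasPD.timeFun h hp d)).congr_on hp H.base2

theorem hasPD_base3 (H : IsGen a₁ V τ q g h k m) {p : E} (hp : p ∈ Ω) (d : E) :
    HasPD (baseCoef V.1 3) p d (τ.d.d (p.1 0) * d.1 0 / 2 * p.1 3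
    + τ.d (p.1 0) / 2 * d.1 3 - q * d.1 1 + k.d (p.1 0) * d.1 0) :=
  ((((((HasPD.timeFun τ.d hp d).div_const 2).mul (HasPD.base 3 p d)).sub
    ((HasPD.const q p d).mul (HasPD.base 1 p d))).add (HasPD.timeFun k hp d)).congr_on
    hp H.base3).of_eq (by ring)

theorem hasPD_dep0 (H : IsGen a₁ V τ q g h k m) {p : E} (hp : p ∈ Ω) (d : E) {c : ℝ}
    (hc : HasPD (phase a₁ τ g h k m) p d c) :
    HasPD (depCoef V.1 0) p d (-(τ.d.d (p.1 0) * d.1 0 / 2 * p.2 0 + τ.d (p.1 0) / 2 * d.2 0)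
      - (c * p.2 1 + phase a₁ τ g h k m p * d.2 1)) :=
  ((((HasPD.timeFun τ.d hp d).div_const 2).mul (HasPD.dep 0 p d)).neg.sub
    (hc.mul (HasPD.dep 1 p d))).congr_on hp H.dep0

theorem hasPD_dep1 (H : IsGen a₁ V τ q g h k m) {p : E} (hp : p ∈ Ω) (d : E) {c : ℝ}
    (hc : HasPD (phase a₁ τ g h k m) p d c) :
    HasPD (depCoef V.1 1) p d (c * p.2 0 + phase a₁ τ g h k m p * d.2 0
      - (τ.d.d (p.1 0) * d.1 0 / 2 * p.2 1 + τ.d (p.1 0) / 2 * d.2 1)) :=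
  ((hc.mul (HasPD.dep 0 p d)).sub
    (((HasPD.timeFun τ.d hp d).div_const 2).mul (HasPD.dep 1 p d))).congr_on hp H.dep1

theorem hasPD_dep2 (H : IsGen a₁ V τ q g h k m) {p : E} (hp : p ∈ Ω) (d : E) {c : ℝ}
    (hc : HasPD (phase a₁ τ.d g.d h.d k.d m.d) p d c) :
    HasPD (depCoef V.1 2) p d (-c - (τ.d.d (p.1 0) * d.1 0 * p.2 2 + τ.d (p.1 0) * d.2 2)) :=
  (hc.neg.sub ((HasPD.timeFun τ.d hp d).mul (HasPD.dep 2 p d))).congr_on hp H.dep2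

/-- The commutator of two fields of the general form is of this form, with the parameters
computed from those of the two fields. -/
theorem lie (H : IsGen a₁ V τ q g h k m) (H' : IsGen a₁ W τ' q' g' h' k' m') :
    IsGen a₁ ⁅V, W⁆ (τ * τ'.d - τ.d * τ') 0
      (τ * g'.d - τ' * g.d + (1 / 2 : ℝ) • (τ'.d * g - τ.d * g') + (q' • k - q • k'))
      (τ * h'.d - τ' * h.d + (1 / 2 : ℝ) • (τ'.d * h - τ.d * h'))
      (τ * k'.d - τ' * k.d + (1 / 2 : ℝ) • (τ'.d * k - τ.d * k') - (q' • g - q • g'))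
      (τ * m'.d - τ' * m.d + (1 / 2 : ℝ) • (g.d * g' - g * g'.d)
        + (1 / (2 * a₁)) • (h.d * h' - h * h'.d) + (1 / 2 : ℝ) • (k.d * k' - k * k'.d)) := by
  set T := τ * τ'.d - τ.d * τ' with hT
  set G := τ * g'.d - τ' * g.d + (1 / 2 : ℝ) • (τ'.d * g - τ.d * g') + (q' • k - q • k') with hG
  set R := τ * h'.d - τ' * h.d + (1 / 2 : ℝ) • (τ'.d * h - τ.d * h') with hR
  set K := τ * k'.d - τ' * k.d + (1 / 2 : ℝ) • (τ'.d * k - τ.d * k') - (q' • g - q • g') with hK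
  set M := τ * m'.d - τ' * m.d + (1 / 2 : ℝ) • (g.d * g' - g * g'.d)
        + (1 / (2 * a₁)) • (h.d * h' - h * h'.d) + (1 / 2 : ℝ) • (k.d * k' - k * k'.d) with hM
  have T1 : ∀ s ∈ timeSet Ω, T.d s = (τ * τ'.d.d - τ.d.d * τ') s := fun s hs => by
    simp only [hT, TimeFun.d_sub _ _ hs, TimeFun.d_mul _ _ hs,
      TimeFun.add_apply, TimeFun.sub_apply, TimeFun.mul_apply]
    ring
  have T2 : ∀ s ∈ timeSet Ω, T.d.d s =
      (τ * τ'.d.d.d + τ.d * τ'.d.d - τ.d.d * τ'.d - τ.d.d.d * τ') s := fun s hs => by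
    rw [TimeFun.d_congr T1 s hs]
    simp only [TimeFun.d_sub _ _ hs, TimeFun.d_mul _ _ hs,
      TimeFun.add_apply, TimeFun.sub_apply, TimeFun.mul_apply]
    ring
  have T3 : ∀ s ∈ timeSet Ω, T.d.d.d s =
      (τ * τ'.d.d.d.d + τ.d * τ'.d.d.d + τ.d * τ'.d.d.d - τ.d.d.d * τ'.d - τ.d.d.d * τ'.d
        - τ.d.d.d.d * τ') s := fun s hs => by
    rw [TimeFun.d_congr T2 s hs]
    simp only [TimeFun.d_sub _ _ hs, TimeFun.d_mul _ _ hs, TimeFun.d_add _ _ hs,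
      TimeFun.add_apply, TimeFun.sub_apply, TimeFun.mul_apply]
    ring
  have G1 : ∀ s ∈ timeSet Ω, G.d s = (τ * g'.d.d - τ' * g.d.d
      + (1 / 2 : ℝ) • (τ.d * g'.d - τ'.d * g.d) + (1 / 2 : ℝ) • (τ'.d.d * g - τ.d.d * g')
      + (q' • k.d - q • k'.d)) s := fun s hs => by
    simp only [hG, TimeFun.d_sub _ _ hs, TimeFun.d_mul _ _ hs, TimeFun.d_add _ _ hs,
      TimeFun.d_smul _ _ hs, TimeFun.add_apply, TimeFun.sub_apply, TimeFun.mul_apply,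
      TimeFun.smul_apply]
    ring
  have G2 := TimeFun.d_congr G1
  have R1 : ∀ s ∈ timeSet Ω, R.d s = (τ * h'.d.d - τ' * h.d.d
      + (1 / 2 : ℝ) • (τ.d * h'.d - τ'.d * h.d) + (1 / 2 : ℝ) • (τ'.d.d * h - τ.d.d * h')) s :=
    fun s hs => by
    simp only [hR, TimeFun.d_sub _ _ hs, TimeFun.d_mul _ _ hs, TimeFun.d_add _ _ hs,
      TimeFun.d_smul _ _ hs, TimeFun.add_apply, TimeFun.sub_apply, TimeFun.mul_apply,
      TimeFun.smul_apply]
    ring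
  have R2 := TimeFun.d_congr R1
  have K1 : ∀ s ∈ timeSet Ω, K.d s = (τ * k'.d.d - τ' * k.d.d
      + (1 / 2 : ℝ) • (τ.d * k'.d - τ'.d * k.d) + (1 / 2 : ℝ) • (τ'.d.d * k - τ.d.d * k')
      - (q' • g.d - q • g'.d)) s := fun s hs => by
    simp only [hK, TimeFun.d_sub _ _ hs, TimeFun.d_mul _ _ hs, TimeFun.d_add _ _ hs,
      TimeFun.d_smul _ _ hs, TimeFun.add_apply, TimeFun.sub_apply, TimeFun.mul_apply,
      TimeFun.smul_apply]
    ring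
  have K2 := TimeFun.d_congr K1
  have M1 : ∀ s ∈ timeSet Ω, M.d s = (τ * m'.d.d + τ.d * m'.d - τ' * m.d.d - τ'.d * m.d
      + (1 / 2 : ℝ) • (g.d.d * g' - g * g'.d.d) + (1 / (2 * a₁)) • (h.d.d * h' - h * h'.d.d)
      + (1 / 2 : ℝ) • (k.d.d * k' - k * k'.d.d)) s := fun s hs => by
    simp only [hM, TimeFun.d_sub _ _ hs, TimeFun.d_mul _ _ hs, TimeFun.d_add _ _ hs,
      TimeFun.d_smul _ _ hs, TimeFun.add_apply, TimeFun.sub_apply, TimeFun.mul_apply,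
      TimeFun.smul_apply]
    ring
  constructor
  all_goals intro p hp
  all_goals
    have hs := ct_mem hp
    have v0 : (V.1 p).1 0 = _ := H.base0 p hp
    have v1 : (V.1 p).1 1 = _ := H.base1 p hp
    have v2 : (V.1 p).1 2 = _ := H.base2 p hp
    have v3 : (V.1 p).1 3 = _ := H.base3 p hp
    have v4 : (V.1 p).2 0 = _ := H.dep0 p hp
    have v5 : (V.1 p).2 1 = _ := H.dep1 p hp
    have v6 : (V.1 p).2 2 = _ := H.dep2 p hp
    have w0 : (W.1 p).1 0 = _ := H'.base0 p hp
    have w1 : (W.1 p).1 1 = _ := H'.base1 p hp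
    have w2 : (W.1 p).1 2 = _ := H'.base2 p hp
    have w3 : (W.1 p).1 3 = _ := H'.base3 p hp
    have w4 : (W.1 p).2 0 = _ := H'.dep0 p hp
    have w5 : (W.1 p).2 1 = _ := H'.dep1 p hp
    have w6 : (W.1 p).2 2 = _ := H'.dep2 p hp
  · rw [HasPD.baseCoef_lie V W hp 0 (H.hasPD_base0 hp _) (H'.hasPD_base0 hp _), v0, w0]
    simp only [hT, TimeFun.sub_apply, TimeFun.mul_apply]
    ring
  · rw [HasPD.baseCoef_lie V W hp 1 (H.hasPD_base1 hp _) (H'.hasPD_base1 hp _), T1 _ hs]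
    simp only [v0, w0, v1, w1, v3, w3, hG, TimeFun.add_apply, TimeFun.sub_apply,
      TimeFun.mul_apply, TimeFun.smul_apply]
    ring
  · rw [HasPD.baseCoef_lie V W hp 2 (H.hasPD_base2 hp _) (H'.hasPD_base2 hp _), T1 _ hs]
    simp only [v0, w0, v2, w2, hR, TimeFun.add_apply, TimeFun.sub_apply,
      TimeFun.mul_apply, TimeFun.smul_apply]
    ring
  · rw [HasPD.baseCoef_lie V W hp 3 (H.hasPD_base3 hp _) (H'.hasPD_base3 hp _), T1 _ hs]
    simp only [v0, w0, v1, w1, v3, w3, hK, TimeFun.add_apply, TimeFun.sub_apply,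
      TimeFun.mul_apply, TimeFun.smul_apply]
    ring
  · rw [HasPD.depCoef_lie V W hp 0 (H.hasPD_dep0 hp _ (.phase _ _ _ _ _ _ hp _))
      (H'.hasPD_dep0 hp _ (.phase _ _ _ _ _ _ hp _))]
    simp only [v0, w0, v1, w1, v2, w2, v3, w3, v4, w4, v5, w5, phase, T1 _ hs, T2 _ hs, G1 _ hs,
      R1 _ hs, K1 _ hs, hM, TimeFun.add_apply, TimeFun.sub_apply,
      TimeFun.mul_apply, TimeFun.smul_apply]
    ring
  · rw [HasPD.depCoef_lie V W hp 1 (H.hasPD_dep1 hp _ (.phase _ _ _ _ _ _ hp _))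
      (H'.hasPD_dep1 hp _ (.phase _ _ _ _ _ _ hp _))]
    simp only [v0, w0, v1, w1, v2, w2, v3, w3, v4, w4, v5, w5, phase, T1 _ hs, T2 _ hs, G1 _ hs,
      R1 _ hs, K1 _ hs, hM, TimeFun.add_apply, TimeFun.sub_apply,
      TimeFun.mul_apply, TimeFun.smul_apply]
    ring
  · rw [HasPD.depCoef_lie V W hp 2 (H.hasPD_dep2 hp _ (.phase _ _ _ _ _ _ hp _))
      (H'.hasPD_dep2 hp _ (.phase _ _ _ _ _ _ hp _))]
    simp only [v0, w0, v1, w1, v2, w2, v3, w3, v6, w6, phase, T1 _ hs, T3 _ hs, G2 _ hs,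
      R2 _ hs, K2 _ hs, M1 _ hs, TimeFun.d_sub _ _ hs, TimeFun.d_mul _ _ hs, TimeFun.d_add _ _ hs,
      TimeFun.d_smul _ _ hs, TimeFun.add_apply, TimeFun.sub_apply,
      TimeFun.mul_apply, TimeFun.smul_apply]
    ring

end IsGen

/-! ### Determining equations: the coefficients of the independent variables -/

/-- `j` is an admissible jet over `Ω`: second derivatives are symmetric and the system holds. -/
structure Solves (a₁ a₂ a₃ b₁ b₂ : ℝ) (Ω : TopologicalSpace.Opens E) (j : J) : Prop where
  mem : j.1 ∈ Ω
  isJet : IsJet j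
  eq0 : mds a₁ a₂ a₃ b₁ b₂ 0 j = 0
  eq1 : mds a₁ a₂ a₃ b₁ b₂ 1 j = 0
  eq2 : mds a₁ a₂ a₃ b₁ b₂ 2 j = 0

theorem IsSymmetry.apply {a₁ a₂ a₃ b₁ b₂ : ℝ} {V : VF Ω} (hV : IsSymmetry a₁ a₂ a₃ b₁ b₂ V) {j : J}
    (hj : Solves a₁ a₂ a₃ b₁ b₂ Ω j) (m : Fin 3) :
    fderiv ℝ (mds a₁ a₂ a₃ b₁ b₂ m) j (prolong V.1 j) = 0 :=
  hV j hj.mem hj.isJet (by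
    intro m
    fin_cases m
    exacts [hj.eq0, hj.eq1, hj.eq2]) m

/-- Every first order jet extends to an admissible second order jet, since the equations can be
solved for `v_xx, u_xx, w_xx`. -/
theorem exists_solves (a₁ a₂ a₃ b₁ b₂ : ℝ) {p : E} (hp : p ∈ Ω) (X : Jet1) :
    ∃ H : Jet2, Solves a₁ a₂ a₃ b₁ b₂ Ω (p, X, H) := by
  let c : Fin 3 → ℝ := ![-mds a₁ a₂ a₃ b₁ b₂ 1 (p, X, 0), -mds a₁ a₂ a₃ b₁ b₂ 0 (p, X, 0),
    -mds a₁ a₂ a₃ b₁ b₂ 2 (p, X, 0) - 2 * b₂ * (p.2 0 * mds a₁ a₂ a₃ b₁ b₂ 1 (p, X, 0)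
      + p.2 1 * mds a₁ a₂ a₃ b₁ b₂ 0 (p, X, 0))]
  refine ⟨fun α i k => if i = 1 ∧ k = 1 then c α else 0, hp, ?_, ?_, ?_, ?_⟩
  · intro α i k
    simp only [and_comm]
  · simp [mds_zero, c]
    ring
  · simp [mds_one, c]
    ring
  · simp [mds_two, mds_one, mds_zero, c]
    ring

/-- The jet obtained from `j` by adding `1` to the mixed derivative `∂ₖ∂ₗ uᵅ`. -/
def addMixed (α : Fin 3) (k l : Fin 4) (j : J) : J :=
  (j.1, j.2.1, fun β i n => j.2.2 β i n
    + if β = α ∧ ((i = k ∧ n = l) ∨ (i = l ∧ n = k)) then 1 else 0)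

theorem addMixed_diag (α : Fin 3) {k l : Fin 4} (hkl : k ≠ l) (j : J) (β : Fin 3) (i : Fin 4) :
    (addMixed α k l j).2.2 β i i = j.2.2 β i i := by
  have : ¬ (β = α ∧ ((i = k ∧ i = l) ∨ (i = l ∧ i = k))) := by
    rintro ⟨-, ⟨rfl, h⟩ | ⟨rfl, h⟩⟩
    exacts [hkl h, hkl h.symm]
  simp [addMixed, this]

theorem Solves.addMixed {a₁ a₂ a₃ b₁ b₂ : ℝ} {j : J} (hj : Solves a₁ a₂ a₃ b₁ b₂ Ω j) (α : Fin 3)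
    {k l : Fin 4} (hkl : k ≠ l) : Solves a₁ a₂ a₃ b₁ b₂ Ω (addMixed α k l j) := by
  have hdiag := addMixed_diag α hkl j
  refine ⟨hj.mem, fun β i n => ?_, ?_, ?_, ?_⟩
  · simp only [MDS.addMixed, hj.isJet β i n]
    congr 2
    simp only [eq_iff_iff]
    tauto
  · rw [mds_zero]; simp only [hdiag]; exact hj.eq0
  · rw [mds_one]; simp only [hdiag]; exact hj.eq1
  · rw [mds_two]; simp only [hdiag]; exact hj.eq2

theorem prolong_addMixed (V : VF Ω) (α β : Fin 3) {k l : Fin 4} (hkl : k ≠ l) (i : Fin 4) (j : J) :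
    (prolong V.1 (addMixed α k l j)).2.2 β i i = (prolong V.1 j).2.2 β i i
      - if β = α then 2 * ((if i = k then totalD (baseCoef V.1 l) k j else 0)
        + (if i = l then totalD (baseCoef V.1 k) l j else 0)) else 0 := by
  have h1 : ∀ F, totalD F i (addMixed α k l j) = totalD F i j := fun _ => rfl
  have h2 : ∀ F, totalD2 F i i (addMixed α k l j) = totalD2 F i i j := fun F => by
    simp only [totalD2, addMixed_diag α hkl j]
    rfl
  have h3 : ∀ n, (addMixed α k l j).2.2 β i n = j.2.2 β i n
      + if β = α then (if i = k then (if n = l then 1 else 0) else 0)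
        + (if i = l then (if n = k then 1 else 0) else 0) else 0 := by
    intro n
    have : ¬ (i = k ∧ i = l) := fun h => hkl (h.1.symm.trans h.2)
    simp only [addMixed]
    congr 1
    split_ifs <;> simp_all
  simp only [prolong, h1, h2, h3]
  have h4 : (addMixed α k l j).2.1 = j.2.1 := rfl
  rw [h4]
  by_cases hβ : β = α
  · simp only [hβ, if_true, mul_add, Finset.sum_add_distrib, mul_ite, mul_one, mul_zero]
    by_cases hik : i = k
    · subst hik
      simp [hkl]
      ring
    · by_cases hil : i = l
      · subst hil
        simp [hkl.symm]
        ring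
      · simp [hik, hil]
  · simp [hβ]

section

variable {a₁ a₂ a₃ b₁ b₂ : ℝ} {V : VF Ω}

/-- The coefficient of `v_{kl}` in `Pr⁽²⁾V(Δ₁)` vanishes. The second order part of `Δ₁` enters with
the weights `0, 1, a₁, 1` of `v_tt, v_xx, v_yy, v_zz`. -/
theorem IsSymmetry.totalD_mixed (hV : IsSymmetry a₁ a₂ a₃ b₁ b₂ V) {p : E} (hp : p ∈ Ω) (X : Jet1)
    {k l : Fin 4} (hkl : k ≠ l) :
    (![0, 1, a₁, 1] : Fin 4 → ℝ) k * totalD (baseCoef V.1 l) k (p, X, 0)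
      + (![0, 1, a₁, 1] : Fin 4 → ℝ) l * totalD (baseCoef V.1 k) l (p, X, 0) = 0 := by
  obtain ⟨H, hH⟩ := exists_solves a₁ a₂ a₃ b₁ b₂ hp X
  have h1 := hV.apply hH 0
  have h2 := hV.apply (hH.addMixed 1 hkl) 0
  rw [fderiv_mds_zero] at h1 h2
  simp only [prolong_addMixed V _ _ hkl] at h2
  rw [show (prolong V.1 (addMixed 1 k l (p, X, H))).1 = (prolong V.1 (p, X, H)).1 from rfl,
    show (prolong V.1 (addMixed 1 k l (p, X, H))).2.1 = (prolong V.1 (p, X, H)).2.1 from rfl,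
    show (addMixed 1 k l (p, X, H)).1 = p from rfl] at h2
  change _ * totalD _ _ (p, X, H) + _ * totalD _ _ (p, X, H) = 0
  have hA : ∀ (k : Fin 4) (x : ℝ), (![0, 1, a₁, 1] : Fin 4 → ℝ) k * x =
      (if 1 = k then x else 0) + a₁ * (if 2 = k then x else 0) + (if 3 = k then x else 0) := by
    intro k x
    fin_cases k <;> simp
  rw [hA, hA]
  simp only [if_true] at h2
  linear_combination (1 / 2) * (h1 - h2)

/-- The coefficient of `u_{kl}` in `Pr⁽²⁾V(Δ₃)` vanishes. Here `u_xx` and `u_zz`, but not `u_yy`,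
occur in `Δ₃`, which gives a condition independent of `totalD_mixed`. -/
theorem IsSymmetry.totalD_mixed' (hb₂ : b₂ ≠ 0) (hV : IsSymmetry a₁ a₂ a₃ b₁ b₂ V) {p : E}
    (hp : p ∈ Ω) (X : Jet1) {k l : Fin 4} (hkl : k ≠ l) :
    p.2 0 * ((![0, 1, 0, 1] : Fin 4 → ℝ) k * totalD (baseCoef V.1 l) k (p, X, 0)
      + (![0, 1, 0, 1] : Fin 4 → ℝ) l * totalD (baseCoef V.1 k) l (p, X, 0)) = 0 := by
  obtain ⟨H, hH⟩ := exists_solves a₁ a₂ a₃ b₁ b₂ hp X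
  have h1 := hV.apply hH 2
  have h2 := hV.apply (hH.addMixed 0 hkl) 2
  rw [fderiv_mds_two] at h1 h2
  simp only [prolong_addMixed V _ _ hkl, addMixed_diag _ hkl] at h2
  rw [show (prolong V.1 (addMixed 0 k l (p, X, H))).1 = (prolong V.1 (p, X, H)).1 from rfl,
    show (prolong V.1 (addMixed 0 k l (p, X, H))).2.1 = (prolong V.1 (p, X, H)).2.1 from rfl,
    show (addMixed 0 k l (p, X, H)).1 = p from rfl,
    show (addMixed 0 k l (p, X, H)).2.1 = X from rfl] at h2
  apply mul_left_cancel₀ hb₂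
  change _ * (_ * (_ * totalD _ _ (p, X, H) + _ * totalD _ _ (p, X, H))) = _ * 0
  have hA : ∀ (k : Fin 4) (x : ℝ), (![0, 1, 0, 1] : Fin 4 → ℝ) k * x =
      (if 1 = k then x else 0) + 0 * (if 2 = k then x else 0) + (if 3 = k then x else 0) := by
    intro k x
    fin_cases k <;> simp
  rw [hA, hA]
  simp only [if_true, if_false, Fin.isValue, Fin.reduceEq] at h2
  linear_combination (1 / 4) * (h2 - h1)

end

section

variable {a₁ a₂ a₃ b₁ b₂ : ℝ} {V : VF Ω}

/-- `totalD_mixed` at the jet with vanishing first derivatives. -/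
theorem IsSymmetry.pd_mixed (hV : IsSymmetry a₁ a₂ a₃ b₁ b₂ V) {p : E} (hp : p ∈ Ω)
    {k l : Fin 4} (hkl : k ≠ l) :
    (![0, 1, a₁, 1] : Fin 4 → ℝ) k * pd (eB k) (baseCoef V.1 l) p
      + (![0, 1, a₁, 1] : Fin 4 → ℝ) l * pd (eB l) (baseCoef V.1 k) p = 0 := by
  simpa only [totalD_eq, Pi.zero_apply, zero_mul, add_zero] using hV.totalD_mixed hp 0 hkl

/-- `totalD_mixed` is affine in the first derivatives of the dependent variables; this is the
coefficient of `∂ₖ uᵝ`. -/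
theorem IsSymmetry.pd_dep (hV : IsSymmetry a₁ a₂ a₃ b₁ b₂ V) {p : E} (hp : p ∈ Ω)
    {k l : Fin 4} (hkl : k ≠ l) (β : Fin 3) :
    (![0, 1, a₁, 1] : Fin 4 → ℝ) k * pd (eD β) (baseCoef V.1 l) p = 0 := by
  have h1 := hV.totalD_mixed hp (fun γ i => if γ = β ∧ i = k then 1 else 0) hkl
  have h2 := hV.pd_mixed hp hkl
  have h3 : totalD (baseCoef V.1 l) k (p, fun γ i => if γ = β ∧ i = k then 1 else 0, 0)
      = pd (eB k) (baseCoef V.1 l) p + pd (eD β) (baseCoef V.1 l) p := by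
    rw [totalD_eq]
    fin_cases β <;> simp
  have h4 : totalD (baseCoef V.1 k) l (p, fun γ i => if γ = β ∧ i = k then 1 else 0, 0)
      = pd (eB l) (baseCoef V.1 k) p := by
    rw [totalD_eq]
    simp [hkl.symm]
  rw [h3, h4] at h1
  linear_combination h1 - h2

/-- The coefficients of `∂_t, ∂_x, ∂_y, ∂_z` in a symmetry generator do not depend on the dependent
variables, that of `∂_t` depends on `t` only, that of `∂_y` on `t, y` only, and the other two on
`t, x, z` only, where the `x`-derivative of the one is minus the `z`-derivative of the other. -/
structure BaseFacts (V : VF Ω) : Prop where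
  dep : ∀ l β, ∀ p ∈ Ω, pd (eD β) (baseCoef V.1 l) p = 0
  time : ∀ k, k ≠ 0 → ∀ p ∈ Ω, pd (eB k) (baseCoef V.1 0) p = 0
  d12 : ∀ p ∈ Ω, pd (eB 1) (baseCoef V.1 2) p = 0
  d32 : ∀ p ∈ Ω, pd (eB 3) (baseCoef V.1 2) p = 0
  d21 : ∀ p ∈ Ω, pd (eB 2) (baseCoef V.1 1) p = 0
  d23 : ∀ p ∈ Ω, pd (eB 2) (baseCoef V.1 3) p = 0
  d13 : ∀ p ∈ Ω, pd (eB 1) (baseCoef V.1 3) p = -pd (eB 3) (baseCoef V.1 1) p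

theorem IsSymmetry.baseFacts (ha₁ : a₁ ≠ 0) (hb₂ : b₂ ≠ 0) (hV : IsSymmetry a₁ a₂ a₃ b₁ b₂ V) :
    BaseFacts V := by
  have d12 : ∀ p ∈ Ω, pd (eB 1) (baseCoef V.1 2) p = 0 := by
    refine eq_zero_of_dep_mul_eq_zero ((smoothOn_baseCoef V 2).pd _) 0 fun p hp => ?_
    simpa [totalD_eq] using hV.totalD_mixed' hb₂ hp 0 (k := 1) (l := 2) (by decide)
  have d32 : ∀ p ∈ Ω, pd (eB 3) (baseCoef V.1 2) p = 0 := by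
    refine eq_zero_of_dep_mul_eq_zero ((smoothOn_baseCoef V 2).pd _) 0 fun p hp => ?_
    simpa [totalD_eq] using hV.totalD_mixed' hb₂ hp 0 (k := 3) (l := 2) (by decide)
  refine ⟨fun l β p hp => ?_, fun k hk p hp => ?_, d12, d32, fun p hp => ?_, fun p hp => ?_,
    fun p hp => ?_⟩
  · fin_cases l
    · simpa using hV.pd_dep hp (k := 1) (l := 0) (by decide) β
    · simpa using hV.pd_dep hp (k := 3) (l := 1) (by decide) β
    · simpa using hV.pd_dep hp (k := 1) (l := 2) (by decide) β
    · simpa using hV.pd_dep hp (k := 1) (l := 3) (by decide) β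
  · have h := hV.pd_mixed hp hk
    fin_cases k
    · exact absurd rfl hk
    · simpa using h
    · simpa [ha₁] using h
    · simpa using h
  · simpa [ha₁, d12 p hp] using hV.pd_mixed hp (k := 1) (l := 2) (by decide)
  · simpa [ha₁, d32 p hp] using hV.pd_mixed hp (k := 3) (l := 2) (by decide)
  · have := hV.pd_mixed hp (k := 1) (l := 3) (by decide)
    simp at this
    linarith

/-! ### Determining equations: the coefficients of the dependent variables -/

/-- The repeated total derivative of `F` in the direction of the independent variable with
coordinate vector `e`, when `u, v, w` have the first derivatives `a, b, c` and the second
derivatives `A, B, C` in this direction. -/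
def secondTD (F : E → ℝ) (e p : E) (a b c A B C : ℝ) : ℝ :=
  pd e (pd e F) p
      + 2 * (a * pd e (pd (eD 0) F) p + b * pd e (pd (eD 1) F) p + c * pd e (pd (eD 2) F) p)
      + (a ^ 2 * pd (eD 0) (pd (eD 0) F) p + b ^ 2 * pd (eD 1) (pd (eD 1) F) p
        + c ^ 2 * pd (eD 2) (pd (eD 2) F) p
        + 2 * (a * b * pd (eD 0) (pd (eD 1) F) p + a * c * pd (eD 0) (pd (eD 2) F) p
          + b * c * pd (eD 1) (pd (eD 2) F) p))
      + (A * pd (eD 0) F p + B * pd (eD 1) F p + C * pd (eD 2) F p)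

/-- The coefficient of `∂/∂uᵅ_{ii}`, where `i ≠ 0`, in the prolongation of a field with coefficients
subject to `BaseFacts`. -/
theorem BaseFacts.prolong_snd (hB : BaseFacts V) (α : Fin 3) {i : Fin 4} (hi : i ≠ 0) {j : J}
    (hj : j.1 ∈ Ω) (hd : ∀ n, i ≠ n → j.2.2 α i n = 0) :
    (prolong V.1 j).2.2 α i i = secondTD (depCoef V.1 α) (eB i) j.1 (j.2.1 0 i) (j.2.1 1 i)
        (j.2.1 2 i) (j.2.2 0 i i) (j.2.2 1 i i) (j.2.2 2 i i)
      - (pd (eB i) (pd (eB i) (baseCoef V.1 1)) j.1 * j.2.1 α 1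
        + pd (eB i) (pd (eB i) (baseCoef V.1 2)) j.1 * j.2.1 α 2
        + pd (eB i) (pd (eB i) (baseCoef V.1 3)) j.1 * j.2.1 α 3)
      - 2 * pd (eB i) (baseCoef V.1 i) j.1 * j.2.2 α i i := by
  have h1 : ∀ l, totalD (baseCoef V.1 l) i j = pd (eB i) (baseCoef V.1 l) j.1 := fun l => by
    rw [totalD_eq, hB.dep _ _ _ hj, hB.dep _ _ _ hj, hB.dep _ _ _ hj]
    ring
  have h2 : ∀ l, totalD2 (baseCoef V.1 l) i i j = pd (eB i) (pd (eB i) (baseCoef V.1 l)) j.1 :=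
    fun l => by
    rw [totalD2_eq (smoothOn_baseCoef V l) i hj]
    simp only [hB.dep _ _ _ hj, pd_eq_zero_on (hB.dep _ _) _ hj]
    ring
  have h3 : pd (eB i) (pd (eB i) (baseCoef V.1 0)) j.1 = 0 := pd_eq_zero_on (hB.time i hi) _ hj
  have h4 : ∑ l, pd (eB i) (baseCoef V.1 l) j.1 * j.2.2 α i l
      = pd (eB i) (baseCoef V.1 i) j.1 * j.2.2 α i i :=
    Finset.sum_eq_single i (fun n _ hn => by rw [hd n hn.symm, mul_zero]) (by simp)
  simp only [prolong, h1, h2, Finset.sum_add_distrib, h4]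
  rw [totalD2_eq (smoothOn_depCoef V α) i hj, Fin.sum_univ_four, h3, secondTD]
  ring

theorem BaseFacts.prolong_fst (hB : BaseFacts V) (α : Fin 3) (i : Fin 4) {j : J} (hj : j.1 ∈ Ω) :
    (prolong V.1 j).2.1 α i = pd (eB i) (depCoef V.1 α) j.1
      + (j.2.1 0 i * pd (eD 0) (depCoef V.1 α) j.1 + j.2.1 1 i * pd (eD 1) (depCoef V.1 α) j.1
        + j.2.1 2 i * pd (eD 2) (depCoef V.1 α) j.1)
      - (pd (eB i) (baseCoef V.1 0) j.1 * j.2.1 α 0 + pd (eB i) (baseCoef V.1 1) j.1 * j.2.1 α 1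
        + pd (eB i) (baseCoef V.1 2) j.1 * j.2.1 α 2
        + pd (eB i) (baseCoef V.1 3) j.1 * j.2.1 α 3) := by
  have h1 : ∀ l, totalD (baseCoef V.1 l) i j = pd (eB i) (baseCoef V.1 l) j.1 := fun l => by
    rw [totalD_eq, hB.dep _ _ _ hj, hB.dep _ _ _ hj, hB.dep _ _ _ hj]
    ring
  simp only [prolong, h1, Fin.sum_univ_four]
  rw [totalD_eq]

/-- The invariance conditions at the jets without mixed second derivatives. -/
theorem IsSymmetry.determining (hV : IsSymmetry a₁ a₂ a₃ b₁ b₂ V) (hB : BaseFacts V) {p : E}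
    (hp : p ∈ Ω) (ut ux uy uz vt vx vy vz wt wx wy wz uxx uyy uzz vxx vyy vzz wxx wyy wzz : ℝ)
    (h0 : ut + vxx + a₁ * vyy + vzz - a₂ * p.2 1 * (p.2 0 ^ 2 + p.2 1 ^ 2) - p.2 1 * p.2 2
      - a₃ * p.2 0 = 0)
    (h1 : -vt + uxx + a₁ * uyy + uzz - a₂ * p.2 0 * (p.2 0 ^ 2 + p.2 1 ^ 2) - p.2 0 * p.2 2
      + a₃ * p.2 1 = 0)
    (h2 : wxx + b₁ * wyy + wzz
      - 2 * b₂ * (ux ^ 2 + p.2 0 * uxx + vx ^ 2 + p.2 1 * vxx)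
      - 2 * b₂ * (uz ^ 2 + p.2 0 * uzz + vz ^ 2 + p.2 1 * vzz) = 0) :
    (pd (eB 0) (depCoef V.1 0) p + (ut * pd (eD 0) (depCoef V.1 0) p
        + vt * pd (eD 1) (depCoef V.1 0) p + wt * pd (eD 2) (depCoef V.1 0) p)
      - (pd (eB 0) (baseCoef V.1 0) p * ut + pd (eB 0) (baseCoef V.1 1) p * ux
        + pd (eB 0) (baseCoef V.1 2) p * uy + pd (eB 0) (baseCoef V.1 3) p * uz)
      + (secondTD (depCoef V.1 1) (eB 1) p ux vx wx uxx vxx wxx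
        + a₁ * secondTD (depCoef V.1 1) (eB 2) p uy vy wy uyy vyy wyy
        + secondTD (depCoef V.1 1) (eB 3) p uz vz wz uzz vzz wzz)
      - (vx * (pd (eB 1) (pd (eB 1) (baseCoef V.1 1)) p + pd (eB 3) (pd (eB 3) (baseCoef V.1 1)) p)
        + vy * (a₁ * pd (eB 2) (pd (eB 2) (baseCoef V.1 2)) p)
        + vz * (pd (eB 1) (pd (eB 1) (baseCoef V.1 3)) p
          + pd (eB 3) (pd (eB 3) (baseCoef V.1 3)) p))
      - 2 * (pd (eB 1) (baseCoef V.1 1) p * vxx + a₁ * pd (eB 2) (baseCoef V.1 2) p * vyy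
        + pd (eB 3) (baseCoef V.1 3) p * vzz)
      - a₂ * (depCoef V.1 1 p * (p.2 0 ^ 2 + p.2 1 ^ 2)
        + p.2 1 * (2 * p.2 0 * depCoef V.1 0 p + 2 * p.2 1 * depCoef V.1 1 p))
      - (depCoef V.1 1 p * p.2 2 + p.2 1 * depCoef V.1 2 p) - a₃ * depCoef V.1 0 p = 0) ∧
    (-(pd (eB 0) (depCoef V.1 1) p + (ut * pd (eD 0) (depCoef V.1 1) p
        + vt * pd (eD 1) (depCoef V.1 1) p + wt * pd (eD 2) (depCoef V.1 1) p)
      - (pd (eB 0) (baseCoef V.1 0) p * vt + pd (eB 0) (baseCoef V.1 1) p * vx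
        + pd (eB 0) (baseCoef V.1 2) p * vy + pd (eB 0) (baseCoef V.1 3) p * vz))
      + (secondTD (depCoef V.1 0) (eB 1) p ux vx wx uxx vxx wxx
        + a₁ * secondTD (depCoef V.1 0) (eB 2) p uy vy wy uyy vyy wyy
        + secondTD (depCoef V.1 0) (eB 3) p uz vz wz uzz vzz wzz)
      - (ux * (pd (eB 1) (pd (eB 1) (baseCoef V.1 1)) p + pd (eB 3) (pd (eB 3) (baseCoef V.1 1)) p)
        + uy * (a₁ * pd (eB 2) (pd (eB 2) (baseCoef V.1 2)) p)
        + uz * (pd (eB 1) (pd (eB 1) (baseCoef V.1 3)) p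
          + pd (eB 3) (pd (eB 3) (baseCoef V.1 3)) p))
      - 2 * (pd (eB 1) (baseCoef V.1 1) p * uxx + a₁ * pd (eB 2) (baseCoef V.1 2) p * uyy
        + pd (eB 3) (baseCoef V.1 3) p * uzz)
      - a₂ * (depCoef V.1 0 p * (p.2 0 ^ 2 + p.2 1 ^ 2)
        + p.2 0 * (2 * p.2 0 * depCoef V.1 0 p + 2 * p.2 1 * depCoef V.1 1 p))
      - (depCoef V.1 0 p * p.2 2 + p.2 0 * depCoef V.1 2 p) + a₃ * depCoef V.1 1 p = 0) ∧
    (ux = 0 → uz = 0 → vx = 0 → vz = 0 → wx = 0 → wy = 0 → wz = 0 →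
      secondTD (depCoef V.1 2) (eB 1) p ux vx wx uxx vxx wxx
        + b₁ * secondTD (depCoef V.1 2) (eB 2) p uy vy wy uyy vyy wyy
        + secondTD (depCoef V.1 2) (eB 3) p uz vz wz uzz vzz wzz
      - 2 * (pd (eB 1) (baseCoef V.1 1) p * wxx + b₁ * pd (eB 2) (baseCoef V.1 2) p * wyy
        + pd (eB 3) (baseCoef V.1 3) p * wzz)
      - 2 * b₂ * (depCoef V.1 0 p * (uxx + uzz) + depCoef V.1 1 p * (vxx + vzz)
        + p.2 0 * (secondTD (depCoef V.1 0) (eB 1) p ux vx wx uxx vxx wxx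
          + secondTD (depCoef V.1 0) (eB 3) p uz vz wz uzz vzz wzz
          - 2 * pd (eB 1) (baseCoef V.1 1) p * uxx - 2 * pd (eB 3) (baseCoef V.1 3) p * uzz)
        + p.2 1 * (secondTD (depCoef V.1 1) (eB 1) p ux vx wx uxx vxx wxx
          + secondTD (depCoef V.1 1) (eB 3) p uz vz wz uzz vzz wzz
          - 2 * pd (eB 1) (baseCoef V.1 1) p * vxx - 2 * pd (eB 3) (baseCoef V.1 3) p * vzz)) = 0) := by
  let X : Jet1 := ![![ut, ux, uy, uz], ![vt, vx, vy, vz], ![wt, wx, wy, wz]]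
  let Y : Fin 3 → Fin 4 → ℝ := ![![0, uxx, uyy, uzz], ![0, vxx, vyy, vzz], ![0, wxx, wyy, wzz]]
  let H : Jet2 := fun α i k => if i = k then Y α i else 0
  have hH : ∀ α i, H α i i = Y α i := fun α i => if_pos rfl
  have hs : Solves a₁ a₂ a₃ b₁ b₂ Ω (p, X, H) := by
    refine ⟨hp, fun α i k => ?_, ?_, ?_, ?_⟩
    · by_cases h : i = k
      · rw [h]
      · simp [H, h, Ne.symm h]
    · rw [mds_zero]
      simp only [hH]
      exact h0
    · rw [mds_one]
      simp only [hH]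
      exact h1
    · rw [mds_two]
      simp only [hH]
      change wxx + b₁ * wyy + wzz - b₂ * (2 * (ux ^ 2 + p.2 0 * uxx + vx ^ 2 + p.2 1 * vxx))
        - b₂ * (2 * (uz ^ 2 + p.2 0 * uzz + vz ^ 2 + p.2 1 * vzz)) = 0
      linear_combination h2
  have hoff : ∀ α i n, i ≠ n → H α i n = 0 := fun α i n h => if_neg h
  have hf : ∀ (α : Fin 3) (i : Fin 4), _ := fun α i => hB.prolong_fst α i (j := (p, X, H)) hp
  have h2' : ∀ (α : Fin 3) (i : Fin 4), i ≠ 0 → _ := fun α i hi =>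
    hB.prolong_snd α (i := i) hi (j := (p, X, H)) hp (hoff α i)
  have hV0 : ∀ α, (prolong V.1 (p, X, H)).1.2 α = depCoef V.1 α p := fun α => rfl
  have n1 : (1 : Fin 4) ≠ 0 := by decide
  have n2 : (2 : Fin 4) ≠ 0 := by decide
  have n3 : (3 : Fin 4) ≠ 0 := by decide
  have z1 := pd_eq_zero_on hB.d12 (eB 1) hp
  have z2 := pd_eq_zero_on hB.d32 (eB 3) hp
  have z3 := pd_eq_zero_on hB.d21 (eB 2) hp
  have z4 := pd_eq_zero_on hB.d23 (eB 2) hp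
  have E0 := hV.apply hs 0
  have E1 := hV.apply hs 1
  have E2 := hV.apply hs 2
  refine ⟨?_, ?_, ?_⟩
  · rw [fderiv_mds_zero, hf, h2' _ _ n1, h2' _ _ n2, h2' _ _ n3] at E0
    simp only [hV0, hH, z1, z2, z3, z4] at E0
    simp only [X, Y, Matrix.cons_val] at E0
    linear_combination E0
  · rw [fderiv_mds_one, hf, h2' _ _ n1, h2' _ _ n2, h2' _ _ n3] at E1
    simp only [hV0, hH, z1, z2, z3, z4] at E1
    simp only [X, Y, Matrix.cons_val] at E1
    linear_combination E1
  · rintro e1 e2 e3 e4 e5 e6 e7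
    rw [fderiv_mds_two] at E2
    simp only [h2' _ _ n1, h2' _ _ n2, h2' _ _ n3, hV0, hH, z1, z2, z3, z4] at E2
    simp only [X, Y, Matrix.cons_val, e1, e2, e3, e4, e5, e6, e7] at E2 ⊢
    linear_combination E2

end

section

variable {a₁ a₂ a₃ b₁ b₂ : ℝ} {V : VF Ω}

/-- The determining equations for the coefficients `S` of `∂_t, ∂_x, ∂_y, ∂_z` and `P` of
`∂_u, ∂_v, ∂_w`, beyond those of `BaseFacts`. In the last three, `U` and `W` are the values of
`u_xx` and `v_xx` at the jet all of whose other derivatives of `u` and `v` vanish. -/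
structure DetEqs (Ω : TopologicalSpace.Opens E) (a₁ a₂ a₃ b₁ b₂ : ℝ) (S : Fin 4 → E → ℝ)
    (P : Fin 3 → E → ℝ) : Prop where
  w1 : ∀ p ∈ Ω, pd (eD 2) (P 1) p = 0
  s1 : ∀ p ∈ Ω, pd (eB 1) (S 1) p = pd (eB 0) (S 0) p / 2
  s2 : ∀ p ∈ Ω, pd (eB 2) (S 2) p = pd (eB 0) (S 0) p / 2
  s3 : ∀ p ∈ Ω, pd (eB 3) (S 3) p = pd (eB 0) (S 0) p / 2
  u0 : ∀ p ∈ Ω, pd (eD 0) (P 0) p = pd (eD 1) (P 1) p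
  v0 : ∀ p ∈ Ω, pd (eD 1) (P 0) p = -pd (eD 0) (P 1) p
  uu : ∀ p ∈ Ω, pd (eD 0) (pd (eD 0) (P 1)) p = 0
  uv : ∀ p ∈ Ω, pd (eD 0) (pd (eD 1) (P 1)) p = 0
  vv : ∀ p ∈ Ω, pd (eD 1) (pd (eD 1) (P 1)) p = 0
  x1 : ∀ p ∈ Ω, pd (eB 1) (pd (eD 0) (P 1)) p = 1 / 2 * pd (eB 0) (S 1) p
  x2 : ∀ p ∈ Ω, pd (eB 2) (pd (eD 0) (P 1)) p = 1 / (2 * a₁) * pd (eB 0) (S 2) p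
  x3 : ∀ p ∈ Ω, pd (eB 3) (pd (eD 0) (P 1)) p = 1 / 2 * pd (eB 0) (S 3) p
  y1 : ∀ p ∈ Ω, 2 * pd (eB 1) (pd (eD 1) (P 1)) p =
    pd (eB 1) (pd (eB 1) (S 1)) p + pd (eB 3) (pd (eB 3) (S 1)) p
  y2 : ∀ p ∈ Ω, 2 * pd (eB 2) (pd (eD 1) (P 1)) p = pd (eB 2) (pd (eB 2) (S 2)) p
  y3 : ∀ p ∈ Ω, 2 * pd (eB 3) (pd (eD 1) (P 1)) p =
    pd (eB 1) (pd (eB 1) (S 3)) p + pd (eB 3) (pd (eB 3) (S 3)) p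
  u2 : ∀ p ∈ Ω, pd (eD 0) (P 2) p = 0
  v2 : ∀ p ∈ Ω, pd (eD 1) (P 2) p = 0
  i0 : ∀ p ∈ Ω, p.2 0 * pd (eD 2) (P 2) p =
    P 0 p + p.2 0 * pd (eD 0) (P 0) p + p.2 1 * pd (eD 0) (P 1) p
  i1 : ∀ p ∈ Ω, p.2 1 * pd (eD 2) (P 2) p =
    P 1 p + p.2 0 * pd (eD 1) (P 0) p + p.2 1 * pd (eD 1) (P 1) p
  z0 : ∀ p ∈ Ω, ∀ U W, U = a₂ * p.2 0 * (p.2 0 ^ 2 + p.2 1 ^ 2) + p.2 0 * p.2 2 - a₃ * p.2 1 →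
    W = a₂ * p.2 1 * (p.2 0 ^ 2 + p.2 1 ^ 2) + p.2 1 * p.2 2 + a₃ * p.2 0 →
    pd (eB 0) (P 0) p + (pd (eB 1) (pd (eB 1) (P 1)) p + a₁ * pd (eB 2) (pd (eB 2) (P 1)) p
      + pd (eB 3) (pd (eB 3) (P 1)) p) + U * pd (eD 0) (P 1) p
      + W * (pd (eD 1) (P 1) p - pd (eB 0) (S 0) p)
      - a₂ * (P 1 p * (p.2 0 ^ 2 + p.2 1 ^ 2) + p.2 1 * (2 * p.2 0 * P 0 p + 2 * p.2 1 * P 1 p))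
      - (P 1 p * p.2 2 + p.2 1 * P 2 p) - a₃ * P 0 p = 0
  z1 : ∀ p ∈ Ω, ∀ U W, U = a₂ * p.2 0 * (p.2 0 ^ 2 + p.2 1 ^ 2) + p.2 0 * p.2 2 - a₃ * p.2 1 →
    W = a₂ * p.2 1 * (p.2 0 ^ 2 + p.2 1 ^ 2) + p.2 1 * p.2 2 + a₃ * p.2 0 →
    -pd (eB 0) (P 1) p + (pd (eB 1) (pd (eB 1) (P 0)) p + a₁ * pd (eB 2) (pd (eB 2) (P 0)) p
      + pd (eB 3) (pd (eB 3) (P 0)) p) + U * (pd (eD 0) (P 0) p - pd (eB 0) (S 0) p)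
      + W * pd (eD 1) (P 0) p
      - a₂ * (P 0 p * (p.2 0 ^ 2 + p.2 1 ^ 2) + p.2 0 * (2 * p.2 0 * P 0 p + 2 * p.2 1 * P 1 p))
      - (P 0 p * p.2 2 + p.2 0 * P 2 p) + a₃ * P 1 p = 0
  z2 : ∀ p ∈ Ω, ∀ U W, U = a₂ * p.2 0 * (p.2 0 ^ 2 + p.2 1 ^ 2) + p.2 0 * p.2 2 - a₃ * p.2 1 →
    W = a₂ * p.2 1 * (p.2 0 ^ 2 + p.2 1 ^ 2) + p.2 1 * p.2 2 + a₃ * p.2 0 →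
    pd (eB 1) (pd (eB 1) (P 2)) p + b₁ * pd (eB 2) (pd (eB 2) (P 2)) p
      + pd (eB 3) (pd (eB 3) (P 2)) p
      + 2 * b₂ * (p.2 0 * U + p.2 1 * W) * (pd (eD 2) (P 2) p - pd (eB 0) (S 0) p)
      - 2 * b₂ * (P 0 p * U + P 1 p * W
        + p.2 0 * (pd (eB 1) (pd (eB 1) (P 0)) p + pd (eB 3) (pd (eB 3) (P 0)) p
          + U * (pd (eD 0) (P 0) p - pd (eB 0) (S 0) p) + W * pd (eD 1) (P 0) p)
        + p.2 1 * (pd (eB 1) (pd (eB 1) (P 1)) p + pd (eB 3) (pd (eB 3) (P 1)) p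
          + U * pd (eD 0) (P 1) p + W * (pd (eD 1) (P 1) p - pd (eB 0) (S 0) p))) = 0

theorem IsSymmetry.detEqs (ha₁ : a₁ ≠ 0) (hb₁ : b₁ ≠ 0) (hb₂ : b₂ ≠ 0)
    (hV : IsSymmetry a₁ a₂ a₃ b₁ b₂ V) (hB : BaseFacts V) :
    DetEqs Ω a₁ a₂ a₃ b₁ b₂ (baseCoef V.1) (depCoef V.1) := by
  -- each equation is a combination of invariance conditions at suitable jets: the equations of
  -- the system are solved for `u_xx, v_xx, w_xx`; the other jet coordinates are free
  have D := fun (p : E) (hp : p ∈ Ω) (ut ux uy uz vt vx vy vz wt uyy vyy vzz : ℝ) =>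
    hV.determining hB hp ut ux uy uz vt vx vy vz wt 0 0 0
      (vt - a₁ * uyy + (a₂ * p.2 0 * (p.2 0 ^ 2 + p.2 1 ^ 2) + p.2 0 * p.2 2 - a₃ * p.2 1)) uyy 0
      (-ut - a₁ * vyy - vzz
        + (a₂ * p.2 1 * (p.2 0 ^ 2 + p.2 1 ^ 2) + p.2 1 * p.2 2 + a₃ * p.2 0)) vyy vzz
      (2 * b₂ * (ux ^ 2 + p.2 0 *
        (vt - a₁ * uyy + (a₂ * p.2 0 * (p.2 0 ^ 2 + p.2 1 ^ 2) + p.2 0 * p.2 2 - a₃ * p.2 1))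
        + vx ^ 2 + p.2 1 * (-ut - a₁ * vyy - vzz
        + (a₂ * p.2 1 * (p.2 0 ^ 2 + p.2 1 ^ 2) + p.2 1 * p.2 2 + a₃ * p.2 0)))
        + 2 * b₂ * (uz ^ 2 + vz ^ 2 + p.2 1 * vzz)) 0 0
      (by ring) (by ring) (by ring)
  simp only [secondTD] at D
  have w0 : ∀ p ∈ Ω, pd (eD 2) (depCoef V.1 0) p = 0 := fun p hp => by
    linear_combination (D p hp 0 0 0 0 0 0 0 0 1 0 0 0).1 - (D p hp 0 0 0 0 0 0 0 0 0 0 0 0).1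
  have w1 : ∀ p ∈ Ω, pd (eD 2) (depCoef V.1 1) p = 0 := fun p hp => by
    linear_combination (D p hp 0 0 0 0 0 0 0 0 0 0 0 0).2.1 - (D p hp 0 0 0 0 0 0 0 0 1 0 0 0).2.1
  have D' := fun (p : E) (hp : p ∈ Ω) => by
    have h := D p hp
    simp only [w0 p hp, w1 p hp] at h
    exact h
  have A : ∀ p ∈ Ω, pd (eD 0) (depCoef V.1 0) p - pd (eB 0) (baseCoef V.1 0) p
    - pd (eD 1) (depCoef V.1 1) p
      + 2 * pd (eB 1) (baseCoef V.1 1) p = 0 := fun p hp => by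
    linear_combination (D' p hp 1 0 0 0 0 0 0 0 0 0 0 0).1 - (D' p hp 0 0 0 0 0 0 0 0 0 0 0 0).1
  have B : ∀ p ∈ Ω, pd (eB 2) (baseCoef V.1 2) p = pd (eB 1) (baseCoef V.1 1) p := fun p hp => by
    apply mul_left_cancel₀ ha₁
    linear_combination (1 / 2) * ((D' p hp 0 0 0 0 0 0 0 0 0 0 0 0).1
      - (D' p hp 0 0 0 0 0 0 0 0 0 0 1 0).1)
  have C : ∀ p ∈ Ω, pd (eB 3) (baseCoef V.1 3) p = pd (eB 1) (baseCoef V.1 1) p := fun p hp => by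
    linear_combination (1 / 2) * ((D' p hp 0 0 0 0 0 0 0 0 0 0 0 0).1
      - (D' p hp 0 0 0 0 0 0 0 0 0 0 0 1).1)
  have v0 : ∀ p ∈ Ω, pd (eD 1) (depCoef V.1 0) p = -pd (eD 0) (depCoef V.1 1) p := fun p hp => by
    linear_combination (D' p hp 0 0 0 0 1 0 0 0 0 0 0 0).1 - (D' p hp 0 0 0 0 0 0 0 0 0 0 0 0).1
  have G : ∀ p ∈ Ω, -pd (eD 1) (depCoef V.1 1) p + pd (eB 0) (baseCoef V.1 0) p
    + pd (eD 0) (depCoef V.1 0) p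
      - 2 * pd (eB 1) (baseCoef V.1 1) p = 0 := fun p hp => by
    linear_combination (D' p hp 0 0 0 0 1 0 0 0 0 0 0 0).2.1 - (D' p hp 0 0 0 0 0 0 0 0 0 0 0 0).2.1
  have s1 : ∀ p ∈ Ω, pd (eB 1) (baseCoef V.1 1) p = pd (eB 0) (baseCoef V.1 0) p / 2 :=
    fun p hp => by
    linear_combination (1 / 4) * (A p hp - G p hp)
  have u2 : ∀ p ∈ Ω, pd (eD 0) (depCoef V.1 2) p = 0 := fun p hp => by
    apply mul_left_cancel₀ hb₁
    linear_combination (D' p hp 0 0 0 0 a₁ 0 0 0 0 1 0 0).2.2 rfl rfl rfl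
      rfl trivial trivial trivial
      - (D' p hp 0 0 0 0 0 0 0 0 0 0 0 0).2.2 rfl rfl rfl rfl trivial trivial trivial
  have v2 : ∀ p ∈ Ω, pd (eD 1) (depCoef V.1 2) p = 0 := fun p hp => by
    apply mul_left_cancel₀ hb₁
    linear_combination (D' p hp (-a₁) 0 0 0 0 0 0 0 0 0 1 0).2.2 rfl rfl rfl
      rfl trivial trivial trivial
      - (D' p hp 0 0 0 0 0 0 0 0 0 0 0 0).2.2 rfl rfl rfl rfl trivial trivial trivial
  exact {
    w1 := w1
    s1 := s1
    s2 := fun p hp => (B p hp).trans (s1 p hp)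
    s3 := fun p hp => (C p hp).trans (s1 p hp)
    u0 := fun p hp => by
      linear_combination (1 / 2) * (A p hp + G p hp)
    v0 := v0
    uu := fun p hp => by
      linear_combination (1 / 2) * ((D' p hp 0 1 0 0 0 0 0 0 0 0 0 0).1
        + (D' p hp 0 (-1) 0 0 0 0 0 0 0 0 0 0).1) - (D' p hp 0 0 0 0 0 0 0 0 0 0 0 0).1
    uv := fun p hp => by
      linear_combination (1 / 2) * ((D' p hp 0 1 0 0 0 1 0 0 0 0 0 0).1
        - (D' p hp 0 1 0 0 0 0 0 0 0 0 0 0).1 - (D' p hp 0 0 0 0 0 1 0 0 0 0 0 0).1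
        + (D' p hp 0 0 0 0 0 0 0 0 0 0 0 0).1)
    vv := fun p hp => by
      linear_combination (1 / 2) * ((D' p hp 0 0 0 0 0 1 0 0 0 0 0 0).1
        + (D' p hp 0 0 0 0 0 (-1) 0 0 0 0 0 0).1) - (D' p hp 0 0 0 0 0 0 0 0 0 0 0 0).1
    x1 := fun p hp => by
      linear_combination (1 / 4) * ((D' p hp 0 1 0 0 0 0 0 0 0 0 0 0).1
        - (D' p hp 0 (-1) 0 0 0 0 0 0 0 0 0 0).1)
    x2 := fun p hp => by
      rw [one_div_mul_eq_div, eq_div_iff (by positivity)]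
      linear_combination (1 / 2) * ((D' p hp 0 0 1 0 0 0 0 0 0 0 0 0).1
        - (D' p hp 0 0 (-1) 0 0 0 0 0 0 0 0 0).1)
    x3 := fun p hp => by
      linear_combination (1 / 4) * ((D' p hp 0 0 0 1 0 0 0 0 0 0 0 0).1
        - (D' p hp 0 0 0 (-1) 0 0 0 0 0 0 0 0).1)
    y1 := fun p hp => by
      linear_combination (1 / 2) * ((D' p hp 0 0 0 0 0 1 0 0 0 0 0 0).1
        - (D' p hp 0 0 0 0 0 (-1) 0 0 0 0 0 0).1)
    y2 := fun p hp => by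
      apply mul_left_cancel₀ ha₁
      linear_combination (1 / 2) * ((D' p hp 0 0 0 0 0 0 1 0 0 0 0 0).1
        - (D' p hp 0 0 0 0 0 0 (-1) 0 0 0 0 0).1)
    y3 := fun p hp => by
      linear_combination (1 / 2) * ((D' p hp 0 0 0 0 0 0 0 1 0 0 0 0).1
        - (D' p hp 0 0 0 0 0 0 0 (-1) 0 0 0 0).1)
    u2 := u2
    v2 := v2
    i0 := fun p hp => by
      apply mul_left_cancel₀ hb₂
      linear_combination (1 / 2) * ((D' p hp 0 0 0 0 1 0 0 0 0 0 0 0).2.2 rfl rfl rfl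
        rfl trivial trivial trivial
        - (D' p hp 0 0 0 0 0 0 0 0 0 0 0 0).2.2 rfl rfl rfl rfl trivial trivial trivial - u2 p hp)
    i1 := fun p hp => by
      apply mul_left_cancel₀ hb₂
      linear_combination (1 / 2) * ((D' p hp (-1) 0 0 0 0 0 0 0 0 0 0 0).2.2 rfl rfl rfl
        rfl trivial trivial trivial
        - (D' p hp 0 0 0 0 0 0 0 0 0 0 0 0).2.2 rfl rfl rfl rfl trivial trivial trivial - v2 p hp)
    z0 := fun p hp U W hU hW => by
      have e : pd (eB 0) (baseCoef V.1 0) p = 2 * pd (eB 1) (baseCoef V.1 1) p := by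
        linear_combination -2 * s1 p hp
      rw [e]
      subst hU hW
      linear_combination (D' p hp 0 0 0 0 0 0 0 0 0 0 0 0).1
    z1 := fun p hp U W hU hW => by
      have e : pd (eB 0) (baseCoef V.1 0) p = 2 * pd (eB 1) (baseCoef V.1 1) p := by
        linear_combination -2 * s1 p hp
      rw [e]
      subst hU hW
      linear_combination (D' p hp 0 0 0 0 0 0 0 0 0 0 0 0).2.1
    z2 := fun p hp U W hU hW => by
      subst hU hW
      linear_combination (D' p hp 0 0 0 0 0 0 0 0 0 0 0 0).2.2 rfl rfl rfl
        rfl trivial trivial trivial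
        - (a₂ * p.2 0 * (p.2 0 ^ 2 + p.2 1 ^ 2) + p.2 0 * p.2 2 - a₃ * p.2 1) * u2 p hp
        - (a₂ * p.2 1 * (p.2 0 ^ 2 + p.2 1 ^ 2) + p.2 1 * p.2 2 + a₃ * p.2 0) * v2 p hp
  }

end

/-! ### Solution of the determining equations -/

theorem pd_const_mul {F : E → ℝ} (hF : SmoothOn Ω F) (c : ℝ) (d : E) {p : E} (hp : p ∈ Ω) :
    pd d (fun p => c * F p) p = c * pd d F p :=
  ((HasPD.const c p d).mul (hF.hasPD hp d)).eq.trans (by ring)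

theorem pd_eB_linear {F A B : E → ℝ} {c : ℝ} (hA : SmoothOn Ω A) (hB : SmoothOn Ω B)
    (h : ∀ p ∈ Ω, F p = A p * p.2 0 + c * (B p * p.2 1)) (i : Fin 4) :
    ∀ p ∈ Ω, pd (eB i) F p = pd (eB i) A p * p.2 0 + c * (pd (eB i) B p * p.2 1) := fun p hp => by
  rw [pd_congr_on h (eB i) hp, pd, (((hA.hasPD hp _).mul (HasPD.dep 0 p _)).add
    ((HasPD.const c p _).mul ((hB.hasPD hp _).mul (HasPD.dep 1 p _)))).eq]
  simp [eB]

section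

variable {a₁ a₂ a₃ b₁ b₂ : ℝ} {V : VF Ω}

theorem BaseFacts.pd_time (hB : BaseFacts V) (k : Fin 4) (hk : k ≠ 0) (p : E) (hp : p ∈ Ω) :
    pd (eB k) (pd (eB 0) (baseCoef V.1 0)) p = 0 := by
  rw [(smoothOn_baseCoef V 0).pd_comm hp, pd_eq_zero_on (hB.time k hk) _ hp]

theorem BaseFacts.pd_time_half (hB : BaseFacts V) (k : Fin 4) (hk : k ≠ 0) (p : E) (hp : p ∈ Ω) :
    pd (eB k) (fun q => pd (eB 0) (baseCoef V.1 0) q / 2) p = 0 := by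
  rw [pd, ((((smoothOn_baseCoef V 0).pd _).hasPD hp _).div_const 2).eq, hB.pd_time k hk p hp,
    zero_div]

theorem DetEqs.pd_zz (H : DetEqs Ω a₁ a₂ a₃ b₁ b₂ (baseCoef V.1) (depCoef V.1))
    (hB : BaseFacts V) {p : E} (hp : p ∈ Ω) : pd (eB 3) (pd (eB 3) (baseCoef V.1 1)) p = 0 := by
  have d31 : ∀ p ∈ Ω, pd (eB 3) (baseCoef V.1 1) p = -pd (eB 1) (baseCoef V.1 3) p :=
    fun p hp => by rw [hB.d13 p hp, neg_neg]
  rw [pd_congr_on d31 _ hp, pd, ((((smoothOn_baseCoef V 3).pd _).hasPD hp _).neg).eq,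
    (smoothOn_baseCoef V 3).pd_comm hp, pd_congr_on H.s3 _ hp,
    hB.pd_time_half 1 (by decide) p hp, neg_zero]

theorem DetEqs.pd_xx (H : DetEqs Ω a₁ a₂ a₃ b₁ b₂ (baseCoef V.1) (depCoef V.1))
    (hB : BaseFacts V) {p : E} (hp : p ∈ Ω) : pd (eB 1) (pd (eB 1) (baseCoef V.1 3)) p = 0 := by
  rw [pd_congr_on hB.d13 _ hp, pd, ((((smoothOn_baseCoef V 1).pd _).hasPD hp _).neg).eq,
    (smoothOn_baseCoef V 1).pd_comm hp, pd_congr_on H.s1 _ hp,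
    hB.pd_time_half 3 (by decide) p hp, neg_zero]

/-- The coefficients of `∂_u, ∂_v, ∂_w` in a symmetry generator are determined by the coefficient
of `∂_t` and the rate `b` of rotation of `(u, v)`. -/
theorem DetEqs.exists_rotation (ha₁ : a₁ ≠ 0) (ha₂ : a₂ ≠ 0) (hB : BaseFacts V)
    (H : DetEqs Ω a₁ a₂ a₃ b₁ b₂ (baseCoef V.1) (depCoef V.1)) :
    ∃ b : E → ℝ, SmoothOn Ω b ∧ (∀ β, ∀ p ∈ Ω, pd (eD β) b p = 0) ∧
      (∀ p ∈ Ω, pd (eB 1) b p = 1 / 2 * pd (eB 0) (baseCoef V.1 1) p) ∧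
      (∀ p ∈ Ω, pd (eB 2) b p = 1 / (2 * a₁) * pd (eB 0) (baseCoef V.1 2) p) ∧
      (∀ p ∈ Ω, pd (eB 3) b p = 1 / 2 * pd (eB 0) (baseCoef V.1 3) p) ∧
      (∀ p ∈ Ω, depCoef V.1 0 p = -(pd (eB 0) (baseCoef V.1 0) p / 2 * p.2 0) - b p * p.2 1) ∧
      (∀ p ∈ Ω, depCoef V.1 1 p = b p * p.2 0 - pd (eB 0) (baseCoef V.1 0) p / 2 * p.2 1) ∧
      (∀ p ∈ Ω, depCoef V.1 2 p = -pd (eB 0) b p - pd (eB 0) (baseCoef V.1 0) p * p.2 2) ∧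
      (∀ p ∈ Ω, pd (eB 0) (pd (eB 0) (baseCoef V.1 0)) p
        = 4 * a₃ * pd (eB 0) (baseCoef V.1 0) p) ∧
      (∀ p ∈ Ω, (2 * a₁ + b₁) * pd (eB 0) (pd (eB 0) (pd (eB 0) (baseCoef V.1 0))) p = 0) := by
  have sS := smoothOn_baseCoef V
  have sP := smoothOn_depCoef V
  have sa : SmoothOn Ω (pd (eD 1) (depCoef V.1 1)) := (sP 1).pd _
  have sb : SmoothOn Ω (pd (eD 0) (depCoef V.1 1)) := (sP 1).pd _
  have sT : SmoothOn Ω (pd (eB 0) (baseCoef V.1 0)) := (sS 0).pd _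
  have Tk := hB.pd_time
  have Tβ : ∀ β, ∀ p ∈ Ω, pd (eD β) (pd (eB 0) (baseCoef V.1 0)) p = 0 :=
    fun β p hp => by rw [(sS 0).pd_comm hp, pd_eq_zero_on (hB.dep 0 β) _ hp]
  have aβ : ∀ β, ∀ p ∈ Ω, pd (eD β) (pd (eD 1) (depCoef V.1 1)) p = 0 := by
    intro β p hp
    fin_cases β
    · exact H.uv p hp
    · exact H.vv p hp
    · exact ((sP 1).pd_comm hp _ _).trans (pd_eq_zero_on H.w1 _ hp)
  have bβ : ∀ β, ∀ p ∈ Ω, pd (eD β) (pd (eD 0) (depCoef V.1 1)) p = 0 := by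
    intro β p hp
    fin_cases β
    · exact H.uu p hp
    · exact ((sP 1).pd_comm hp _ _).trans (H.uv p hp)
    · exact ((sP 1).pd_comm hp _ _).trans (pd_eq_zero_on H.w1 _ hp)
  -- the coefficients `P 0, P 1` have no inhomogeneous terms
  have w2 : ∀ p ∈ Ω, pd (eD 2) (depCoef V.1 2) p = 2 * pd (eD 1) (depCoef V.1 1) p := by
    intro p hp
    have e1 := ((HasPD.dep 1 p (eD 1)).mul (((sP 2).pd (eD 2)).hasPD hp (eD 1))).eq
    have e2 := (((sP 1).hasPD hp (eD 1)).add ((HasPD.dep 0 p (eD 1)).mul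
      (((sP 0).pd (eD 1)).hasPD hp (eD 1))) |>.add ((HasPD.dep 1 p (eD 1)).mul
      (sa.hasPD hp (eD 1)))).eq
    have h := e1.symm.trans ((pd_congr_on H.i1 (eD 1) hp).trans e2)
    have h2 : pd (eD 1) (fun q => -pd (eD 0) (depCoef V.1 1) q) p = 0 :=
      ((sb.hasPD hp _).neg.eq).trans (by rw [bβ 1 p hp, neg_zero])
    rw [(sP 2).pd_comm hp, pd_eq_zero_on H.v2 _ hp, aβ 1 p hp, pd_congr_on H.v0 _ hp, h2] at h
    have c1 : (eD 1).2 1 = 1 := by simp [eD]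
    have c0 : (eD 1).2 0 = 0 := by simp [eD]
    rw [c1, c0] at h
    linear_combination h
  have P1 : ∀ p ∈ Ω, depCoef V.1 1 p = pd (eD 0) (depCoef V.1 1) p * p.2 0
      + 1 * (pd (eD 1) (depCoef V.1 1) p * p.2 1) := fun p hp => by
    linear_combination p.2 1 * w2 p hp - H.i1 p hp - p.2 0 * H.v0 p hp
  have P0 : ∀ p ∈ Ω, depCoef V.1 0 p = pd (eD 1) (depCoef V.1 1) p * p.2 0
      + (-1) * (pd (eD 0) (depCoef V.1 1) p * p.2 1) := fun p hp => by
    linear_combination p.2 0 * w2 p hp - H.i0 p hp - p.2 0 * H.u0 p hp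
  have Th := hB.pd_time_half
  have a1 : ∀ p ∈ Ω, pd (eB 1) (pd (eD 1) (depCoef V.1 1)) p = 0 := fun p hp => by
    have h := H.y1 p hp
    rw [pd_congr_on H.s1 _ hp, Th 1 (by decide) p hp, H.pd_zz hB hp] at h
    linarith
  have a2 : ∀ p ∈ Ω, pd (eB 2) (pd (eD 1) (depCoef V.1 1)) p = 0 := fun p hp => by
    have h := H.y2 p hp
    rw [pd_congr_on H.s2 _ hp, Th 2 (by decide) p hp] at h
    linarith
  have a3 : ∀ p ∈ Ω, pd (eB 3) (pd (eD 1) (depCoef V.1 1)) p = 0 := fun p hp => by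
    have h := H.y3 p hp
    rw [pd_congr_on H.s3 _ hp, Th 3 (by decide) p hp, H.pd_xx hB hp] at h
    linarith
  have bkk : ∀ (k : Fin 4) (c : ℝ) (l : Fin 4),
      (∀ p ∈ Ω, pd (eB k) (pd (eD 0) (depCoef V.1 1)) p = c * pd (eB 0) (baseCoef V.1 l) p) →
      (∀ p ∈ Ω, pd (eB k) (baseCoef V.1 l) p = pd (eB 0) (baseCoef V.1 0) p / 2) →
      ∀ p ∈ Ω, pd (eB k) (pd (eB k) (pd (eD 0) (depCoef V.1 1))) p
        = c / 2 * pd (eB 0) (pd (eB 0) (baseCoef V.1 0)) p := fun k c l hb hs p hp => by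
    rw [pd_congr_on hb _ hp, pd_const_mul ((sS l).pd _) _ _ hp, (sS l).pd_comm hp,
      pd_congr_on hs _ hp, pd, ((sT.hasPD hp _).div_const 2).eq]
    ring
  have b11 := bkk 1 _ 1 H.x1 H.s1
  have b22 := bkk 2 _ 2 H.x2 H.s2
  have b33 := bkk 3 _ 3 H.x3 H.s3
  have P1i := fun i => pd_eB_linear sb sa P1 i
  have P0i := fun i => pd_eB_linear sa sb P0 i
  have P1ii := fun i => pd_eB_linear (sb.pd (eB i)) (sa.pd (eB i)) (P1i i) i
  have P0ii := fun i => pd_eB_linear (sa.pd (eB i)) (sb.pd (eB i)) (P0i i) i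
  -- the first two equations, modulo the system, are `u f - v g = 0` and `v f + u g = 0`
  have eq0 : ∀ p ∈ Ω, p.2 0 * (pd (eB 0) (pd (eD 1) (depCoef V.1 1)) p
        + 3 / 4 * pd (eB 0) (pd (eB 0) (baseCoef V.1 0)) p
        - a₃ * pd (eB 0) (baseCoef V.1 0) p)
      - p.2 1 * (pd (eB 0) (pd (eD 0) (depCoef V.1 1)) p + depCoef V.1 2 p
        + (a₂ * (p.2 0 ^ 2 + p.2 1 ^ 2) + p.2 2) * pd (eB 0) (baseCoef V.1 0) p
        + 2 * a₂ * (p.2 0 ^ 2 + p.2 1 ^ 2) * pd (eD 1) (depCoef V.1 1) p) = 0 := fun p hp => by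
    have h := H.z0 p hp _ _ rfl rfl
    rw [P0i 0 p hp, P1ii 1 p hp, P1ii 2 p hp, P1ii 3 p hp, b11 p hp, b22 p hp, b33 p hp,
      pd_eq_zero_on a1 _ hp, pd_eq_zero_on a2 _ hp, pd_eq_zero_on a3 _ hp, P0 p hp, P1 p hp] at h
    field_simp at h
    linear_combination h / 4
  have eq1 : ∀ p ∈ Ω, p.2 1 * (pd (eB 0) (pd (eD 1) (depCoef V.1 1)) p
        + 3 / 4 * pd (eB 0) (pd (eB 0) (baseCoef V.1 0)) p
        - a₃ * pd (eB 0) (baseCoef V.1 0) p)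
      + p.2 0 * (pd (eB 0) (pd (eD 0) (depCoef V.1 1)) p + depCoef V.1 2 p
        + (a₂ * (p.2 0 ^ 2 + p.2 1 ^ 2) + p.2 2) * pd (eB 0) (baseCoef V.1 0) p
        + 2 * a₂ * (p.2 0 ^ 2 + p.2 1 ^ 2) * pd (eD 1) (depCoef V.1 1) p) = 0 := fun p hp => by
    have h := H.z1 p hp _ _ rfl rfl
    rw [P1i 0 p hp, P0ii 1 p hp, P0ii 2 p hp, P0ii 3 p hp, b11 p hp, b22 p hp, b33 p hp,
      pd_eq_zero_on a1 _ hp, pd_eq_zero_on a2 _ hp, pd_eq_zero_on a3 _ hp, H.u0 p hp, H.v0 p hp,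
      P0 p hp, P1 p hp] at h
    field_simp at h
    linear_combination -h / 4
  have of_modSq : ∀ F : E → ℝ, SmoothOn Ω F → (∀ p ∈ Ω, (p.2 0 ^ 2 + p.2 1 ^ 2) * F p = 0) →
      ∀ p ∈ Ω, F p = 0 := fun F hF h =>
    eq_zero_of_dep_mul_eq_zero hF 0 fun p hp => by
      rcases mul_eq_zero.1 (h p hp) with h0 | h0
      · rw [show p.2 0 = 0 by nlinarith [sq_nonneg (p.2 0), sq_nonneg (p.2 1)], zero_mul]
      · rw [h0, mul_zero]
  have sc : ∀ α : Fin 3, SmoothOn Ω (fun p : E => p.2 α) := fun α p _ => by fun_prop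
  have sr : SmoothOn Ω (fun p : E => p.2 0 ^ 2 + p.2 1 ^ 2) := fun p _ => by fun_prop
  have f0 := of_modSq (fun p => pd (eB 0) (pd (eD 1) (depCoef V.1 1)) p
      + 3 / 4 * pd (eB 0) (pd (eB 0) (baseCoef V.1 0)) p - a₃ * pd (eB 0) (baseCoef V.1 0) p)
    (fun p hp => (((sa.pd _) p hp).add (contDiffAt_const.mul ((sT.pd _) p hp))).sub
      (contDiffAt_const.mul (sT p hp)))
    fun p hp => by linear_combination p.2 0 * eq0 p hp + p.2 1 * eq1 p hp
  have f1 := of_modSq (fun p => pd (eB 0) (pd (eD 0) (depCoef V.1 1)) p + depCoef V.1 2 p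
        + (a₂ * (p.2 0 ^ 2 + p.2 1 ^ 2) + p.2 2) * pd (eB 0) (baseCoef V.1 0) p
        + 2 * a₂ * (p.2 0 ^ 2 + p.2 1 ^ 2) * pd (eD 1) (depCoef V.1 1) p)
    (fun p hp => ((((sb.pd _) p hp).add (sP 2 p hp)).add
      (((contDiffAt_const.mul (sr p hp)).add (sc 2 p hp)).mul (sT p hp))).add
      ((contDiffAt_const.mul (sr p hp)).mul (sa p hp)))
    fun p hp => by linear_combination p.2 0 * eq1 p hp - p.2 1 * eq0 p hp
  -- the derivative of the second of these with respect to `u` determines `∂_v φ₂`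
  have aT : ∀ p ∈ Ω, pd (eD 1) (depCoef V.1 1) p + pd (eB 0) (baseCoef V.1 0) p / 2 = 0 := by
    refine eq_zero_of_dep_mul_eq_zero
      (fun p hp => (sa p hp).add ((sT p hp).div_const 2)) 0 fun p hp => ?_
    have hr := ((HasPD.dep 0 p (eD 0)).sq.add (HasPD.dep 1 p (eD 0)).sq)
    have e := (((((sb.pd (eB 0)).hasPD hp (eD 0)).add ((sP 2).hasPD hp (eD 0))).add
      ((((HasPD.const a₂ p (eD 0)).mul hr).add (HasPD.dep 2 p (eD 0))).mul
        (sT.hasPD hp (eD 0)))).add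
      (((HasPD.const (2 * a₂) p (eD 0)).mul hr).mul (sa.hasPD hp (eD 0)))).eq
    have h := e.symm.trans (pd_eq_zero_on f1 (eD 0) hp)
    rw [sb.pd_comm hp, pd_eq_zero_on (bβ 0) _ hp, H.u2 p hp, Tβ 0 p hp, aβ 0 p hp] at h
    have c0 : (eD 0).2 0 = 1 := by simp [eD]
    have c1 : (eD 0).2 1 = 0 := by simp [eD]
    have c2 : (eD 0).2 2 = 0 := by simp [eD]
    rw [c0, c1, c2] at h
    apply mul_left_cancel₀ ha₂
    linear_combination h / 4
  have aT' : ∀ p ∈ Ω, pd (eD 1) (depCoef V.1 1) p = -(pd (eB 0) (baseCoef V.1 0) p / 2) :=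
    fun p hp => by linear_combination aT p hp
  have P2 : ∀ p ∈ Ω, depCoef V.1 2 p = -pd (eB 0) (pd (eD 0) (depCoef V.1 1)) p
      - pd (eB 0) (baseCoef V.1 0) p * p.2 2 := fun p hp => by
    linear_combination f1 p hp - 2 * a₂ * (p.2 0 ^ 2 + p.2 1 ^ 2) * aT' p hp
  have at' : ∀ p ∈ Ω, pd (eB 0) (pd (eD 1) (depCoef V.1 1)) p
      = -(pd (eB 0) (pd (eB 0) (baseCoef V.1 0)) p / 2) := fun p hp => by
    rw [pd_congr_on aT' _ hp]
    exact ((sT.hasPD hp _).div_const 2).neg.eq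
  have P2kk : ∀ (k : Fin 4) (c : ℝ), k ≠ 0 →
      (∀ p ∈ Ω, pd (eB k) (pd (eB k) (pd (eD 0) (depCoef V.1 1))) p
        = c / 2 * pd (eB 0) (pd (eB 0) (baseCoef V.1 0)) p) →
      ∀ p ∈ Ω, pd (eB k) (pd (eB k) (depCoef V.1 2)) p
        = -(c / 2 * pd (eB 0) (pd (eB 0) (pd (eB 0) (baseCoef V.1 0))) p) := by
    intro k c hk hb p hp
    have cz : (eB k).2 2 = 0 := by simp [eB]
    have h1 : ∀ q ∈ Ω, pd (eB k) (depCoef V.1 2) q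
        = -pd (eB 0) (pd (eB k) (pd (eD 0) (depCoef V.1 1))) q := fun q hq => by
      rw [pd_congr_on P2 _ hq, sb.pd_comm hq]
      refine ((((sb.pd _).hasPD hq (eB k)).neg).sub
        ((sT.hasPD hq (eB k)).mul (HasPD.dep 2 q (eB k)))).eq.trans ?_
      rw [Tk k hk q hq, cz]
      ring
    rw [pd_congr_on h1 _ hp]
    refine (((((sb.pd _).pd _).hasPD hp (eB k)).neg).eq).trans ?_
    rw [(sb.pd _).pd_comm hp, pd_congr_on hb _ hp, pd_const_mul (sT.pd _) _ _ hp]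
  refine ⟨_, sb, bβ, H.x1, H.x2, H.x3, fun p hp => ?_, fun p hp => ?_, P2, fun p hp => ?_,
    fun p hp => ?_⟩
  · rw [P0 p hp, aT' p hp]; ring
  · rw [P1 p hp, aT' p hp]; ring
  · linear_combination 4 * f0 p hp - 4 * at' p hp
  · have h := H.z2 p hp _ _ rfl rfl
    rw [P2kk 1 _ (by decide) b11 p hp, P2kk 2 _ (by decide) b22 p hp, P2kk 3 _ (by decide) b33 p hp,
      P0ii 1 p hp, P0ii 3 p hp, P1ii 1 p hp, P1ii 3 p hp, pd_eq_zero_on a1 _ hp,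
      pd_eq_zero_on a3 _ hp, b11 p hp, b33 p hp, w2 p hp, H.u0 p hp, H.v0 p hp, P0 p hp, P1 p hp,
      aT' p hp] at h
    field_simp at h
    linear_combination -h

end

/-! ### The general form of a symmetry generator -/

section

variable {a₁ a₂ a₃ b₁ b₂ : ℝ} {V : VF Ω}

theorem pd_eB_timeFun (f : TimeFun Ω) {p : E} (hp : p ∈ Ω) :
    pd (eB 0) (fun p => f (p.1 0)) p = f.d (p.1 0) :=
  (pd_timeFun f hp _).trans (by simp [eB])

/-- Every symmetry generator has the form `IsGen`. -/
theorem IsSymmetry.exists_isGen (ha₁ : a₁ ≠ 0) (ha₂ : a₂ ≠ 0) (hb₁ : b₁ ≠ 0) (hb₂ : b₂ ≠ 0)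
    (hconv : Convex ℝ (Ω : Set E)) (hV : IsSymmetry a₁ a₂ a₃ b₁ b₂ V) :
    ∃ (τ : TimeFun Ω) (q : ℝ) (g h k m : TimeFun Ω), IsGen a₁ V τ q g h k m ∧
      (∀ t ∈ timeSet Ω, τ.d.d t = 4 * a₃ * τ.d t) ∧
      (∀ t ∈ timeSet Ω, (2 * a₁ + b₁) * τ.d.d.d t = 0) := by
  have hB := hV.baseFacts ha₁ hb₂
  have H := hV.detEqs ha₁ hb₁ hb₂ hB
  obtain ⟨b, sb, bβ, b1, b2, b3, P0, P1, P2, T1, T2⟩ := H.exists_rotation ha₁ ha₂ hB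
  have sS := smoothOn_baseCoef V
  obtain ⟨τ, hτ⟩ := exists_timeFun hconv (sS 0) hB.time (hB.dep 0)
  have hτ1 : ∀ p ∈ Ω, pd (eB 0) (baseCoef V.1 0) p = τ.d (p.1 0) := fun p hp =>
    (pd_congr_on hτ _ hp).trans (pd_eB_timeFun τ hp)
  have hτ2 : ∀ p ∈ Ω, pd (eB 0) (pd (eB 0) (baseCoef V.1 0)) p = τ.d.d (p.1 0) := fun p hp =>
    (pd_congr_on hτ1 _ hp).trans (pd_eB_timeFun τ.d hp)
  have hτ3 : ∀ p ∈ Ω, pd (eB 0) (pd (eB 0) (pd (eB 0) (baseCoef V.1 0))) p = τ.d.d.d (p.1 0) :=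
    fun p hp => (pd_congr_on hτ2 _ hp).trans (pd_eB_timeFun τ.d.d hp)
  -- the rate of rotation in the `(x, z)`-plane is constant
  obtain ⟨q, hq⟩ : ∃ q, ∀ p ∈ Ω, pd (eB 3) (baseCoef V.1 1) p = q := by
    refine exists_const_of_pd_eq_zero hconv ((sS 1).pd _) (fun i p hp => ?_) fun β p hp => by
      rw [(sS 1).pd_comm hp, pd_eq_zero_on (hB.dep 1 β) _ hp]
    fin_cases i
    · have c1 : ∀ p ∈ Ω, pd (eB 0) (baseCoef V.1 1) p = 2 * pd (eB 1) b p := fun p hp => by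
        rw [b1 p hp]; ring
      have c3 : ∀ p ∈ Ω, pd (eB 0) (baseCoef V.1 3) p = 2 * pd (eB 3) b p := fun p hp => by
        rw [b3 p hp]; ring
      have e1 : pd (eB 0) (pd (eB 3) (baseCoef V.1 1)) p = 2 * pd (eB 3) (pd (eB 1) b) p := by
        rw [(sS 1).pd_comm hp, pd_congr_on c1 _ hp, pd_const_mul (sb.pd _) _ _ hp]
      have e3 : pd (eB 0) (pd (eB 1) (baseCoef V.1 3)) p = 2 * pd (eB 1) (pd (eB 3) b) p := by
        rw [(sS 3).pd_comm hp, pd_congr_on c3 _ hp, pd_const_mul (sb.pd _) _ _ hp]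
      rw [pd_congr_on hB.d13 _ hp, sb.pd_comm hp, ← e1] at e3
      have e4 := e3.symm.trans (((sS 1).pd _).hasPD hp (eB 0)).neg.eq
      change pd (eB 0) (pd (eB 3) (baseCoef V.1 1)) p = 0
      linarith
    · exact ((sS 1).pd_comm hp _ _).trans
        ((pd_congr_on H.s1 _ hp).trans (hB.pd_time_half 3 (by decide) p hp))
    · exact ((sS 1).pd_comm hp _ _).trans (pd_eq_zero_on hB.d21 _ hp)
    · exact H.pd_zz hB hp
  have sc : ∀ i : Fin 4, SmoothOn Ω (fun p : E => p.1 i) := fun i p _ => by fun_prop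
  -- the translations
  have trans : ∀ (l n : Fin 4) (c : ℝ), l ≠ 0 → n ≠ 0 →
      (∀ i, i ≠ 0 → ∀ p ∈ Ω, pd (eB i) (baseCoef V.1 l) p
        = τ.d (p.1 0) / 2 * (eB i).1 l + c * (eB i).1 n) →
      ∃ g : TimeFun Ω, ∀ p ∈ Ω,
        baseCoef V.1 l p = τ.d (p.1 0) / 2 * p.1 l + c * p.1 n + g (p.1 0) := by
    intro l n c hl hn hder
    have hpd : ∀ p ∈ Ω, ∀ d, HasPD (fun p => baseCoef V.1 l p
        - (τ.d (p.1 0) / 2 * p.1 l + c * p.1 n)) p d (pd d (baseCoef V.1 l) p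
        - (τ.d.d (p.1 0) * d.1 0 / 2 * p.1 l + τ.d (p.1 0) / 2 * d.1 l + c * d.1 n)) :=
      fun p hp d => (((sS l).hasPD hp d).sub ((((HasPD.timeFun τ.d hp d).div_const 2).mul
        (HasPD.base l p d)).add ((HasPD.const c p d).mul (HasPD.base n p d)))).of_eq (by ring)
    obtain ⟨g, hg⟩ := exists_timeFun hconv (F := fun p => baseCoef V.1 l p
        - (τ.d (p.1 0) / 2 * p.1 l + c * p.1 n))
      (fun p hp => (sS l p hp).sub ((((smoothOn_timeFun τ.d p hp).div_const 2).mul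
        (sc l p hp)).add (contDiffAt_const.mul (sc n p hp))))
      (fun i hi p hp => (hpd p hp _).eq.trans (by
        rw [hder i hi p hp, show (eB i).1 0 = 0 by simp [eB, hi.symm]]; ring))
      (fun β p hp => (hpd p hp _).eq.trans (by
        rw [hB.dep l β p hp]; simp [eD]))
    exact ⟨g, fun p hp => by linear_combination hg p hp⟩
  obtain ⟨g, hg⟩ := trans 1 3 q (by decide) (by decide) fun i hi p hp => by
    fin_cases i
    · exact absurd rfl hi
    · exact (H.s1 p hp).trans (by rw [hτ1 p hp]; simp [eB])
    · exact (hB.d21 p hp).trans (by simp [eB])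
    · exact (hq p hp).trans (by simp [eB])
  obtain ⟨h, hh⟩ := trans 2 1 0 (by decide) (by decide) fun i hi p hp => by
    fin_cases i
    · exact absurd rfl hi
    · exact (hB.d12 p hp).trans (by simp [eB])
    · exact (H.s2 p hp).trans (by rw [hτ1 p hp]; simp [eB])
    · exact (hB.d32 p hp).trans (by simp [eB])
  obtain ⟨k, hk⟩ := trans 3 1 (-q) (by decide) (by decide) fun i hi p hp => by
    fin_cases i
    · exact absurd rfl hi
    · exact (hB.d13 p hp).trans (by rw [hq p hp]; simp [eB])
    · exact (hB.d23 p hp).trans (by simp [eB])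
    · exact (H.s3 p hp).trans (by rw [hτ1 p hp]; simp [eB])
  have dt : ∀ (l n : Fin 4) (c : ℝ) (g : TimeFun Ω), l ≠ 0 → n ≠ 0 → (∀ p ∈ Ω,
      baseCoef V.1 l p = τ.d (p.1 0) / 2 * p.1 l + c * p.1 n + g (p.1 0)) →
      ∀ p ∈ Ω, pd (eB 0) (baseCoef V.1 l) p = τ.d.d (p.1 0) / 2 * p.1 l + g.d (p.1 0) :=
    fun l n c g hl hn hg p hp => by
      rw [pd_congr_on hg _ hp]
      refine (((((HasPD.timeFun τ.d hp (eB 0)).div_const 2).mul (HasPD.base l p _)).add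
        ((HasPD.const c p _).mul (HasPD.base n p _))).add (HasPD.timeFun g hp _)).eq.trans ?_
      simp [eB, hl, hn]
  -- the phase
  obtain ⟨f, hf⟩ := exists_timeFun hconv (F := fun p => b p - phase a₁ τ g h k 0 p)
    (fun p hp => (sb p hp).sub (by
      have h0 := smoothOn_timeFun τ.d.d p hp
      have h1 := smoothOn_timeFun g.d p hp
      have h2 := smoothOn_timeFun h.d p hp
      have h3 := smoothOn_timeFun k.d p hp
      have h4 := smoothOn_timeFun (0 : TimeFun Ω) p hp
      unfold phase
      fun_prop))
    (fun i hi p hp => ((sb.hasPD hp _).sub (HasPD.phase a₁ τ g h k 0 hp _)).eq.trans (by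
      have h1 := (b1 p hp).trans (by rw [dt 1 3 q g (by decide) (by decide) hg p hp])
      have h2 := (b2 p hp).trans (by rw [dt 2 1 0 h (by decide) (by decide) hh p hp])
      have h3 := (b3 p hp).trans (by rw [dt 3 1 (-q) k (by decide) (by decide) hk p hp])
      fin_cases i
      · exact absurd rfl hi
      · simp only [Fin.mk_one, h1]; simp [eB]; ring
      · simp only [Fin.reduceFinMk, h2]; simp [eB]; field_simp; ring
      · simp only [Fin.reduceFinMk, h3]; simp [eB]; ring))
    (fun β p hp => ((sb.hasPD hp _).sub (HasPD.phase a₁ τ g h k 0 hp _)).eq.trans (by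
      rw [bβ β p hp]; simp [eD]))
  have hb : ∀ p ∈ Ω, b p = phase a₁ τ g h k ((-1 : ℝ) • f) p := fun p hp => by
    have := hf p hp
    simp only [phase, TimeFun.zero_apply, TimeFun.smul_apply] at this ⊢
    linear_combination this
  have hbt : ∀ p ∈ Ω, pd (eB 0) b p
      = phase a₁ τ.d g.d h.d k.d ((-1 : ℝ) • f).d p := fun p hp => by
    rw [pd_congr_on hb _ hp]
    refine (HasPD.phase a₁ τ g h k _ hp _).eq.trans ?_
    simp [eB]
  refine ⟨τ, q, g, h, k, (-1 : ℝ) • f, ⟨hτ, hg, fun p hp => by rw [hh p hp]; ring,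
    fun p hp => by rw [hk p hp]; ring, fun p hp => ?_, fun p hp => ?_, fun p hp => ?_⟩, ?_, ?_⟩
  · rw [P0 p hp, hτ1 p hp, hb p hp]
  · rw [P1 p hp, hτ1 p hp, hb p hp]
  · rw [P2 p hp, hτ1 p hp, hbt p hp]
  · rintro _ ⟨p, hp, rfl⟩
    exact (hτ2 p hp).symm.trans ((T1 p hp).trans (by rw [hτ1 p hp]))
  · rintro _ ⟨p, hp, rfl⟩
    exact (by rw [hτ3 p hp] : _ = _).symm.trans (T2 p hp)

end

/-! ### Linear structure on the parameters of a symmetry generator -/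

section

variable {a₁ a₂ a₃ b₁ b₂ : ℝ} {V W : VF Ω} {τ g h k m τ' g' h' k' m' : TimeFun Ω} {q q' : ℝ}

/-- The constant function of `t`. -/
def TimeFun.const (c : ℝ) : TimeFun Ω := ⟨fun _ => c, contDiffOn_const⟩

theorem TimeFun.d_const (c : ℝ) : (TimeFun.const c : TimeFun Ω).d = 0 := by
  change TimeFun.mk _ _ = TimeFun.mk _ _
  congr 1
  funext t
  exact deriv_const t c

/-- The function `c t`. -/
def TimeFun.lin (c : ℝ) : TimeFun Ω := ⟨fun t => c * t, by fun_prop⟩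

theorem TimeFun.d_lin (c : ℝ) : (TimeFun.lin c : TimeFun Ω).d = TimeFun.const c := by
  change TimeFun.mk _ _ = TimeFun.mk _ _
  congr 1
  funext t
  change deriv (fun t : ℝ => c * t) t = c
  simp

/-- The function `c exp (r t)`. -/
def TimeFun.exp (c r : ℝ) : TimeFun Ω := ⟨fun t => c * Real.exp (r * t), by fun_prop⟩

theorem TimeFun.d_exp (c r : ℝ) : (TimeFun.exp c r : TimeFun Ω).d = TimeFun.exp (c * r) r := by
  change TimeFun.mk _ _ = TimeFun.mk _ _
  congr 1
  funext t
  have h : HasDerivAt (fun t : ℝ => c * Real.exp (r * t)) (c * (Real.exp (r * t) * (r * 1))) t :=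
    (((hasDerivAt_id t).const_mul r).exp).const_mul c
  refine h.deriv.trans ?_
  ring

@[simp] theorem TimeFun.const_apply (c t : ℝ) : (TimeFun.const c : TimeFun Ω) t = c := rfl
@[simp] theorem TimeFun.lin_apply (c t : ℝ) : (TimeFun.lin c : TimeFun Ω) t = c * t := rfl
@[simp] theorem TimeFun.exp_apply (c r t : ℝ) :
    (TimeFun.exp c r : TimeFun Ω) t = c * Real.exp (r * t) := rfl

/-- A function of `t` with vanishing derivative is constant, as `t` ranges in an interval. -/
theorem TimeFun.exists_const (hconv : Convex ℝ (Ω : Set E)) {f : TimeFun Ω}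
    (hf : ∀ t ∈ timeSet Ω, f.d t = 0) : ∃ c, ∀ t ∈ timeSet Ω, f t = c := by
  obtain ⟨c, hc⟩ := exists_const_of_pd_eq_zero hconv (smoothOn_timeFun f)
    (fun i p hp => by rw [pd_timeFun f hp, hf _ (ct_mem hp), zero_mul])
    (fun α p hp => by rw [pd_timeFun f hp, hf _ (ct_mem hp), zero_mul])
  exact ⟨c, fun t ⟨p, hp, ht⟩ => ht ▸ hc p hp⟩

theorem phase_congr (hτ : ∀ t ∈ timeSet Ω, τ t = τ' t) (hg : ∀ t ∈ timeSet Ω, g t = g' t)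
    (hh : ∀ t ∈ timeSet Ω, h t = h' t) (hk : ∀ t ∈ timeSet Ω, k t = k' t)
    (hm : ∀ t ∈ timeSet Ω, m t = m' t) {p : E} (hp : p ∈ Ω) :
    phase a₁ τ g h k m p = phase a₁ τ' g' h' k' m' p := by
  have ht := ct_mem hp
  simp only [phase, TimeFun.d_congr (TimeFun.d_congr hτ) _ ht, TimeFun.d_congr hg _ ht,
    TimeFun.d_congr hh _ ht, TimeFun.d_congr hk _ ht, hm _ ht]

theorem phase_add {p : E} (hp : p ∈ Ω) :
    phase a₁ (τ + τ') (g + g') (h + h') (k + k') (m + m') p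
      = phase a₁ τ g h k m p + phase a₁ τ' g' h' k' m' p := by
  have ht := ct_mem hp
  simp only [phase, TimeFun.d_congr (fun s hs => TimeFun.d_add τ τ' hs) _ ht,
    TimeFun.d_add _ _ ht, TimeFun.add_apply]
  ring

theorem phase_smul (c : ℝ) {p : E} (hp : p ∈ Ω) :
    phase a₁ (c • τ) (c • g) (c • h) (c • k) (c • m) p = c * phase a₁ τ g h k m p := by
  have ht := ct_mem hp
  simp only [phase, TimeFun.d_congr (fun s hs => TimeFun.d_smul τ c hs) _ ht,
    TimeFun.d_smul _ _ ht, TimeFun.smul_apply]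
  ring

namespace IsGen

theorem congr (H : IsGen a₁ V τ q g h k m) (hτ : ∀ t ∈ timeSet Ω, τ t = τ' t) (hq : q = q')
    (hg : ∀ t ∈ timeSet Ω, g t = g' t) (hh : ∀ t ∈ timeSet Ω, h t = h' t)
    (hk : ∀ t ∈ timeSet Ω, k t = k' t) (hm : ∀ t ∈ timeSet Ω, m t = m' t) :
    IsGen a₁ V τ' q' g' h' k' m' := by
  have e := TimeFun.d_congr hτ
  constructor <;> intro p hp <;> have ht := ct_mem hp
  · rw [H.base0 p hp, hτ _ ht]
  · rw [H.base1 p hp, e _ ht, hq, hg _ ht]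
  · rw [H.base2 p hp, e _ ht, hh _ ht]
  · rw [H.base3 p hp, e _ ht, hq, hk _ ht]
  · rw [H.dep0 p hp, e _ ht, phase_congr hτ hg hh hk hm hp]
  · rw [H.dep1 p hp, e _ ht, phase_congr hτ hg hh hk hm hp]
  · rw [H.dep2 p hp, e _ ht, phase_congr e (TimeFun.d_congr hg) (TimeFun.d_congr hh)
      (TimeFun.d_congr hk) (TimeFun.d_congr hm) hp]

theorem ext (H : IsGen a₁ V τ q g h k m) (H' : IsGen a₁ W τ q g h k m) : V = W := by
  refine VF.ext_on fun p hp => Prod.ext (funext fun i => ?_) (funext fun α => ?_)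
  · fin_cases i
    · exact (H.base0 p hp).trans (H'.base0 p hp).symm
    · exact (H.base1 p hp).trans (H'.base1 p hp).symm
    · exact (H.base2 p hp).trans (H'.base2 p hp).symm
    · exact (H.base3 p hp).trans (H'.base3 p hp).symm
  · fin_cases α
    · exact (H.dep0 p hp).trans (H'.dep0 p hp).symm
    · exact (H.dep1 p hp).trans (H'.dep1 p hp).symm
    · exact (H.dep2 p hp).trans (H'.dep2 p hp).symm

theorem add (H : IsGen a₁ V τ q g h k m) (H' : IsGen a₁ W τ' q' g' h' k' m') :
    IsGen a₁ (V + W) (τ + τ') (q + q') (g + g') (h + h') (k + k') (m + m') := by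
  have eb : ∀ l p, baseCoef (V + W).1 l p = baseCoef V.1 l p + baseCoef W.1 l p := fun _ _ => rfl
  have ed : ∀ α p, depCoef (V + W).1 α p = depCoef V.1 α p + depCoef W.1 α p := fun _ _ => rfl
  constructor <;> intro p hp <;> have ht := ct_mem hp
  · rw [eb, H.base0 p hp, H'.base0 p hp]; rfl
  · rw [eb, H.base1 p hp, H'.base1 p hp, TimeFun.d_add _ _ ht]; simp only [TimeFun.add_apply]; ring
  · rw [eb, H.base2 p hp, H'.base2 p hp, TimeFun.d_add _ _ ht]; simp only [TimeFun.add_apply]; ring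
  · rw [eb, H.base3 p hp, H'.base3 p hp, TimeFun.d_add _ _ ht]; simp only [TimeFun.add_apply]; ring
  · rw [ed, H.dep0 p hp, H'.dep0 p hp, TimeFun.d_add _ _ ht, phase_add hp, TimeFun.add_apply]; ring
  · rw [ed, H.dep1 p hp, H'.dep1 p hp, TimeFun.d_add _ _ ht, phase_add hp, TimeFun.add_apply]; ring
  · rw [ed, H.dep2 p hp, H'.dep2 p hp, TimeFun.d_add _ _ ht, TimeFun.add_apply,
      phase_congr (fun _ => TimeFun.d_add _ _) (fun _ => TimeFun.d_add _ _)
        (fun _ => TimeFun.d_add _ _) (fun _ => TimeFun.d_add _ _) (fun _ => TimeFun.d_add _ _) hp,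
      phase_add hp]
    ring

theorem smul (c : ℝ) (H : IsGen a₁ V τ q g h k m) :
    IsGen a₁ (c • V) (c • τ) (c * q) (c • g) (c • h) (c • k) (c • m) := by
  have eb : ∀ l p, baseCoef (c • V).1 l p = c * baseCoef V.1 l p := fun _ _ => rfl
  have ed : ∀ α p, depCoef (c • V).1 α p = c * depCoef V.1 α p := fun _ _ => rfl
  constructor <;> intro p hp <;> have ht := ct_mem hp
  · rw [eb, H.base0 p hp]; rfl
  · rw [eb, H.base1 p hp, TimeFun.d_smul _ _ ht]; simp only [TimeFun.smul_apply]; ring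
  · rw [eb, H.base2 p hp, TimeFun.d_smul _ _ ht]; simp only [TimeFun.smul_apply]; ring
  · rw [eb, H.base3 p hp, TimeFun.d_smul _ _ ht]; simp only [TimeFun.smul_apply]; ring
  · rw [ed, H.dep0 p hp, TimeFun.d_smul _ _ ht, phase_smul c hp, TimeFun.smul_apply]; ring
  · rw [ed, H.dep1 p hp, TimeFun.d_smul _ _ ht, phase_smul c hp, TimeFun.smul_apply]; ring
  · rw [ed, H.dep2 p hp, TimeFun.d_smul _ _ ht, TimeFun.smul_apply,
      phase_congr (fun _ => TimeFun.d_smul _ _) (fun _ => TimeFun.d_smul _ _)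
        (fun _ => TimeFun.d_smul _ _) (fun _ => TimeFun.d_smul _ _) (fun _ => TimeFun.d_smul _ _) hp,
      phase_smul c hp]
    ring

theorem zero (a₁ : ℝ) : IsGen a₁ (0 : VF Ω) 0 0 0 0 0 0 := by
  constructor <;> intro p _ <;> simp [baseCoef, depCoef, phase, TimeFun.d_zero]

/-- The parameters of the zero field vanish. -/
theorem eq_zero (H : IsGen a₁ (0 : VF Ω) τ q g h k m) (hne : (Ω : Set E).Nonempty) :
    (∀ t ∈ timeSet Ω, τ t = 0) ∧ q = 0 ∧ (∀ t ∈ timeSet Ω, g t = 0) ∧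
      (∀ t ∈ timeSet Ω, h t = 0) ∧ (∀ t ∈ timeSet Ω, k t = 0) ∧ ∀ t ∈ timeSet Ω, m t = 0 := by
  have hτ : ∀ t ∈ timeSet Ω, τ t = (0 : TimeFun Ω) t := by
    rintro _ ⟨p, hp, rfl⟩
    exact (H.base0 p hp).symm
  have hτ1 : ∀ t ∈ timeSet Ω, τ.d t = 0 := fun t ht => by
    rw [TimeFun.d_congr hτ t ht, TimeFun.d_zero, TimeFun.zero_apply]
  have b1 : ∀ p ∈ Ω, q * p.1 3 + g (p.1 0) = 0 := fun p hp => by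
    have h1 : (0 : ℝ) = _ := H.base1 p hp
    rw [hτ1 _ (ct_mem hp)] at h1
    linear_combination -h1
  have hq : q = 0 := by
    obtain ⟨p, hp⟩ := hne
    have h1 := (((HasPD.const q p (eB 3)).mul (HasPD.base 3 p (eB 3))).add
      (HasPD.timeFun g hp (eB 3))).eq.symm.trans (pd_eq_zero_on b1 (eB 3) hp)
    simpa [eB] using h1
  have hg : ∀ t ∈ timeSet Ω, g t = (0 : TimeFun Ω) t := by
    rintro _ ⟨p, hp, rfl⟩
    simpa [hq] using b1 p hp
  have hh : ∀ t ∈ timeSet Ω, h t = (0 : TimeFun Ω) t := by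
    rintro _ ⟨p, hp, rfl⟩
    have h1 : (0 : ℝ) = _ := H.base2 p hp
    rw [hτ1 _ (ct_mem hp)] at h1
    simpa using h1.symm
  have hk : ∀ t ∈ timeSet Ω, k t = (0 : TimeFun Ω) t := by
    rintro _ ⟨p, hp, rfl⟩
    have h1 : (0 : ℝ) = _ := H.base3 p hp
    rw [hτ1 _ (ct_mem hp), hq] at h1
    simpa using h1.symm
  refine ⟨hτ, hq, hg, hh, hk, ?_⟩
  have hm := eq_zero_of_dep_mul_eq_zero (smoothOn_timeFun m) 0 fun p hp => by
    have h1 : (0 : ℝ) = _ := H.dep1 p hp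
    rw [hτ1 _ (ct_mem hp), phase_congr hτ hg hh hk (fun _ _ => rfl) hp] at h1
    simp only [phase, TimeFun.d_zero, TimeFun.zero_apply] at h1
    linear_combination h1
  rintro _ ⟨p, hp, rfl⟩
  exact hm p hp

/-- The parameters of a field are determined by the field. -/
theorem unique (H : IsGen a₁ V τ q g h k m) (H' : IsGen a₁ V τ' q' g' h' k' m')
    (hne : (Ω : Set E).Nonempty) :
    (∀ t ∈ timeSet Ω, τ t = τ' t) ∧ q = q' ∧ (∀ t ∈ timeSet Ω, g t = g' t) ∧
      (∀ t ∈ timeSet Ω, h t = h' t) ∧ (∀ t ∈ timeSet Ω, k t = k' t) ∧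
      ∀ t ∈ timeSet Ω, m t = m' t := by
  have h0 := H.add (H'.smul (-1))
  rw [neg_one_smul, add_neg_cancel] at h0
  obtain ⟨e0, eq, e1, e2, e3, e4⟩ := h0.eq_zero hne
  have aux : ∀ {f f' : TimeFun Ω}, (∀ t ∈ timeSet Ω, (f + (-1 : ℝ) • f') t = 0) →
      ∀ t ∈ timeSet Ω, f t = f' t := fun hf t ht => by
    have := hf t ht
    simp only [TimeFun.add_apply, TimeFun.smul_apply] at this
    linarith
  exact ⟨aux e0, by linarith, aux e1, aux e2, aux e3, aux e4⟩

end IsGen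

/-! ### The parameters of the named fields -/

theorem isGen_X1 (a₁ : ℝ) : IsGen a₁ (X1 Ω) (TimeFun.const 1) 0 0 0 0 0 := by
  constructor <;> intro p hp <;>
    simp [baseCoef, depCoef, X1, VF.of_apply _ _ hp, mkField, phase, TimeFun.d_zero,
      TimeFun.d_const]

theorem isGen_X2 (a₁ : ℝ) : IsGen a₁ (X2 Ω) (TimeFun.lin 2) 0 0 0 0 0 := by
  constructor <;> intro p hp <;>
    simp [baseCoef, depCoef, X2, VF.of_apply _ _ hp, mkField, phase, TimeFun.d_zero,
      TimeFun.d_const, TimeFun.d_lin]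

theorem isGen_X2t {a₃ : ℝ} (a₁ : ℝ) (ha₃ : a₃ ≠ 0) :
    IsGen a₁ (X2t Ω a₁ a₃) (TimeFun.exp (1 / (2 * a₃)) (4 * a₃)) 0 0 0 0 0 := by
  constructor <;> intro p hp <;>
    simp [baseCoef, depCoef, X2t, VF.of_apply _ _ hp, mkField, phase, TimeFun.d_zero,
      TimeFun.d_exp, rho] <;> field_simp <;> first | ring1 | (ring_nf; exact Or.inl trivial)

theorem isGen_X3 (a₁ : ℝ) : IsGen a₁ (X3 Ω) 0 1 0 0 0 0 := by
  constructor <;> intro p hp <;>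
    simp [baseCoef, depCoef, X3, VF.of_apply _ _ hp, mkField, phase, TimeFun.d_zero]

theorem isGen_Yf (a₁ : ℝ) (g : TimeFun Ω) : IsGen a₁ (Yf g) 0 0 g 0 0 0 := by
  constructor <;> intro p hp <;>
    simp [baseCoef, depCoef, Yf, VF.of_apply _ _ hp, mkField, phase, TimeFun.d_zero] <;> ring

theorem isGen_Zf (a₁ : ℝ) (h : TimeFun Ω) : IsGen a₁ (Zf a₁ h) 0 0 0 h 0 0 := by
  constructor <;> intro p hp <;>
    simp [baseCoef, depCoef, Zf, VF.of_apply _ _ hp, mkField, phase, TimeFun.d_zero] <;> ring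

theorem isGen_Qf (a₁ : ℝ) (k : TimeFun Ω) : IsGen a₁ (Qf k) 0 0 0 0 k 0 := by
  constructor <;> intro p hp <;>
    simp [baseCoef, depCoef, Qf, VF.of_apply _ _ hp, mkField, phase, TimeFun.d_zero] <;> ring

theorem isGen_Wf (a₁ : ℝ) (m : TimeFun Ω) : IsGen a₁ (Wf m) 0 0 0 0 0 m := by
  constructor <;> intro p hp <;>
    simp [baseCoef, depCoef, Wf, VF.of_apply _ _ hp, mkField, phase, TimeFun.d_zero]

theorem mem_kmSpan : V ∈ kmSpan Ω a₁ ↔ ∃ g h k m, IsGen a₁ V 0 0 g h k m := by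
  constructor
  · intro hV
    induction hV using Submodule.span_induction with
    | mem x hx =>
      rcases hx with ((⟨f, rfl⟩ | ⟨f, rfl⟩) | ⟨f, rfl⟩) | ⟨f, rfl⟩
      · exact ⟨_, _, _, _, isGen_Yf a₁ f⟩
      · exact ⟨_, _, _, _, isGen_Zf a₁ f⟩
      · exact ⟨_, _, _, _, isGen_Qf a₁ f⟩
      · exact ⟨_, _, _, _, isGen_Wf a₁ f⟩
    | zero => exact ⟨_, _, _, _, .zero a₁⟩
    | add x y _ _ hx hy =>
      obtain ⟨g, h, k, m, H⟩ := hx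
      obtain ⟨g', h', k', m', H'⟩ := hy
      exact ⟨_, _, _, _, (H.add H').congr (by simp) (by simp) (fun _ _ => rfl) (fun _ _ => rfl)
        (fun _ _ => rfl) (fun _ _ => rfl)⟩
    | smul c x _ hx =>
      obtain ⟨g, h, k, m, H⟩ := hx
      exact ⟨_, _, _, _, (H.smul c).congr (by simp) (by simp) (fun _ _ => rfl) (fun _ _ => rfl)
        (fun _ _ => rfl) (fun _ _ => rfl)⟩
  · rintro ⟨g, h, k, m, H⟩
    have H' : IsGen a₁ (Yf g + Zf a₁ h + Qf k + Wf m) 0 0 g h k m :=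
      ((((isGen_Yf a₁ g).add (isGen_Zf a₁ h)).add (isGen_Qf a₁ k)).add (isGen_Wf a₁ m)).congr
        (by simp) (by simp) (by simp) (by simp) (by simp) (by simp)
    rw [H.ext H']
    refine add_mem (add_mem (add_mem ?_ ?_) ?_) ?_ <;> apply Submodule.subset_span <;>
      simp [mem_union]

/-- The commutator of a field of the general form with an element of the Kac--Moody algebra is
in the Kac--Moody algebra. -/
theorem IsGen.lie_mem_kmSpan (H : IsGen a₁ V τ q g h k m) (hW : W ∈ kmSpan Ω a₁) :
    ⁅V, W⁆ ∈ kmSpan Ω a₁ := by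
  obtain ⟨g', h', k', m', H'⟩ := mem_kmSpan.1 hW
  exact mem_kmSpan.2 ⟨_, _, _, _, (H.lie H').congr (by simp [TimeFun.d_zero]) rfl
    (fun _ _ => rfl) (fun _ _ => rfl) (fun _ _ => rfl) (fun _ _ => rfl)⟩

theorem IsGen.lie_translation (H : IsGen a₁ V 0 0 g h k m) (H' : IsGen a₁ W 0 0 g' h' k' m') :
    IsGen a₁ ⁅V, W⁆ 0 0 0 0 0 ((1 / 2 : ℝ) • (g.d * g' - g * g'.d)
      + (1 / (2 * a₁)) • (h.d * h' - h * h'.d) + (1 / 2 : ℝ) • (k.d * k' - k * k'.d)) :=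
  (H.lie H').congr (by simp) rfl (by simp [TimeFun.d_zero]) (by simp [TimeFun.d_zero])
    (by simp [TimeFun.d_zero]) (by simp)

theorem IsGen.lie_eq_Wf (H : IsGen a₁ V 0 0 g h k m) (H' : IsGen a₁ W 0 0 g' h' k' m')
    {n : TimeFun Ω} (hn : ∀ t ∈ timeSet Ω, ((1 / 2 : ℝ) • (g.d * g' - g * g'.d)
      + (1 / (2 * a₁)) • (h.d * h' - h * h'.d) + (1 / 2 : ℝ) • (k.d * k' - k * k'.d)) t = n t) :
    ⁅V, W⁆ = Wf n :=
  ((H.lie_translation H').congr (fun _ _ => rfl) rfl (fun _ _ => rfl) (fun _ _ => rfl)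
    (fun _ _ => rfl) hn).ext (isGen_Wf a₁ n)

theorem Wf_zero : Wf (0 : TimeFun Ω) = 0 := (isGen_Wf 1 0).ext (.zero 1)

theorem kmRelations (Ω : TopologicalSpace.Opens E) (a₁ : ℝ) : KMRelations Ω a₁ := by
  have Y := fun f : TimeFun Ω => isGen_Yf a₁ f
  have Z := fun f : TimeFun Ω => isGen_Zf a₁ f
  have Q := fun f : TimeFun Ω => isGen_Qf a₁ f
  have W := fun f : TimeFun Ω => isGen_Wf a₁ f
  constructor <;> intro f f'
  · exact (Y f).lie_eq_Wf (Y f') (by simp [TimeFun.d_zero, TimeFun.wr])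
  · exact (Z f).lie_eq_Wf (Z f') (by simp [TimeFun.d_zero, TimeFun.wr])
  · exact (Q f).lie_eq_Wf (Q f') (by simp [TimeFun.d_zero, TimeFun.wr])
  all_goals rw [← Wf_zero]
  · exact (Y f).lie_eq_Wf (Z f') (by simp [TimeFun.d_zero])
  · exact (Y f).lie_eq_Wf (Q f') (by simp [TimeFun.d_zero])
  · exact (Z f).lie_eq_Wf (Q f') (by simp [TimeFun.d_zero])
  · exact (Y f).lie_eq_Wf (W f') (by simp [TimeFun.d_zero])
  · exact (Z f).lie_eq_Wf (W f') (by simp [TimeFun.d_zero])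
  · exact (Q f).lie_eq_Wf (W f') (by simp [TimeFun.d_zero])
  · exact (W f).lie_eq_Wf (W f') (by simp [TimeFun.d_zero])

end

/-! ### The embedding of the Kac--Moody algebra into a loop algebra -/

/-- The matrix with the entries `x₀, x₁, x₂, s` in its first row and `c₀ y₀, c₁ y₁, c₂ y₂` in its
last column, where `c = (-1/2, -1/(2a₁), -1/2)`. These matrices form a Heisenberg algebra. -/
def heisenberg (a₁ : ℝ) (x y : Fin 3 → ℝ) (s : ℝ) : Matrix (Fin 5) (Fin 5) ℝ :=
  !![0, x 0, x 1, x 2, s;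
     0, 0, 0, 0, -(1 / 2) * y 0;
     0, 0, 0, 0, -(1 / (2 * a₁)) * y 1;
     0, 0, 0, 0, -(1 / 2) * y 2;
     0, 0, 0, 0, 0]

theorem trace_heisenberg (a₁ : ℝ) (x y : Fin 3 → ℝ) (s : ℝ) : (heisenberg a₁ x y s).trace = 0 := by
  simp [heisenberg, Matrix.trace, Fin.sum_univ_five]

theorem heisenberg_add (a₁ : ℝ) (x y x' y' : Fin 3 → ℝ) (s s' : ℝ) :
    heisenberg a₁ (x + x') (y + y') (s + s') = heisenberg a₁ x y s + heisenberg a₁ x' y' s' := by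
  ext i j
  fin_cases i <;> fin_cases j <;> simp [heisenberg] <;> ring

theorem heisenberg_smul (a₁ c : ℝ) (x y : Fin 3 → ℝ) (s : ℝ) :
    heisenberg a₁ (c • x) (c • y) (c * s) = c • heisenberg a₁ x y s := by
  ext i j
  fin_cases i <;> fin_cases j <;> simp [heisenberg] <;> ring

theorem heisenberg_commutator (a₁ : ℝ) (x y x' y' : Fin 3 → ℝ) (s s' : ℝ) :
    heisenberg a₁ x y s * heisenberg a₁ x' y' s' - heisenberg a₁ x' y' s' * heisenberg a₁ x y s
      = heisenberg a₁ 0 0 (1 / 2 * (y 0 * x' 0 - x 0 * y' 0)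
        + 1 / (2 * a₁) * (y 1 * x' 1 - x 1 * y' 1) + 1 / 2 * (y 2 * x' 2 - x 2 * y' 2)) := by
  ext i j
  fin_cases i <;> fin_cases j <;> simp [heisenberg]
  ring

section

variable {a₁ : ℝ} {V W : VF Ω} {g h k m : TimeFun Ω}

/-- The loop in the Heisenberg algebra that belongs to `𝒴(g) + 𝒵(h) + 𝒬(k) + 𝒲(m)`. -/
def loop (a₁ : ℝ) (g h k m : TimeFun Ω) (t : ℝ) : Matrix (Fin 5) (Fin 5) ℝ :=
  heisenberg a₁ ![g t, h t, k t] ![g.d t, h.d t, k.d t] (m t)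

/-- The loop that represents a field in the Kac--Moody algebra, for some choice of the functions
in terms of which the field is written. -/
def kmLoop (hV : V ∈ kmSpan Ω a₁) (t : ℝ) : Matrix (Fin 5) (Fin 5) ℝ :=
  loop a₁ (mem_kmSpan.1 hV).choose (mem_kmSpan.1 hV).choose_spec.choose
    (mem_kmSpan.1 hV).choose_spec.choose_spec.choose
    (mem_kmSpan.1 hV).choose_spec.choose_spec.choose_spec.choose t

theorem IsGen.kmLoop_eq (hne : (Ω : Set E).Nonempty) (hV : V ∈ kmSpan Ω a₁)
    (H : IsGen a₁ V 0 0 g h k m) {t : ℝ} (ht : t ∈ timeSet Ω) :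
    kmLoop hV t = loop a₁ g h k m t := by
  obtain ⟨-, -, hg, hh, hk, hm⟩ :=
    (mem_kmSpan.1 hV).choose_spec.choose_spec.choose_spec.choose_spec.unique H hne
  rw [kmLoop, loop, loop, hg t ht, hh t ht, hk t ht, hm t ht, TimeFun.d_congr hg t ht,
    TimeFun.d_congr hh t ht, TimeFun.d_congr hk t ht]

theorem loop_add {g' h' k' m' : TimeFun Ω} {t : ℝ} (ht : t ∈ timeSet Ω) :
    loop a₁ (g + g') (h + h') (k + k') (m + m') t
      = loop a₁ g h k m t + loop a₁ g' h' k' m' t := by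
  simp only [loop, ← heisenberg_add, TimeFun.d_add _ _ ht, TimeFun.add_apply]
  simp

theorem loop_smul (c : ℝ) {t : ℝ} (ht : t ∈ timeSet Ω) :
    loop a₁ (c • g) (c • h) (c • k) (c • m) t = c • loop a₁ g h k m t := by
  simp only [loop, ← heisenberg_smul, TimeFun.d_smul _ _ ht, TimeFun.smul_apply]
  simp

theorem isKacMoodyType (hne : (Ω : Set E).Nonempty) {N : LieSubalgebra ℝ (VF Ω)}
    (hN : N.toSubmodule = kmSpan Ω a₁) : IsKacMoodyType a₁ N := by
  have mem : ∀ X : N, (X : VF Ω) ∈ kmSpan Ω a₁ := fun X => hN ▸ X.2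
  let ρ : N →ₗ[ℝ] (timeSet Ω → Matrix (Fin 5) (Fin 5) ℝ) :=
    { toFun := fun X t => kmLoop (mem X) t
      map_add' := fun X Y => funext fun t => by
        obtain ⟨g, h, k, m, H⟩ := mem_kmSpan.1 (mem X)
        obtain ⟨g', h', k', m', H'⟩ := mem_kmSpan.1 (mem Y)
        have HH : IsGen a₁ ((X + Y : N) : VF Ω) 0 0 _ _ _ _ :=
          (H.add H').congr (by simp) (by simp) (fun _ _ => rfl) (fun _ _ => rfl) (fun _ _ => rfl)
            (fun _ _ => rfl)
        rw [HH.kmLoop_eq hne _ t.2, Pi.add_apply, H.kmLoop_eq hne _ t.2, H'.kmLoop_eq hne _ t.2,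
          loop_add t.2]
      map_smul' := fun c X => funext fun t => by
        obtain ⟨g, h, k, m, H⟩ := mem_kmSpan.1 (mem X)
        have HH : IsGen a₁ ((c • X : N) : VF Ω) 0 0 _ _ _ _ :=
          (H.smul c).congr (by simp) (by simp) (fun _ _ => rfl) (fun _ _ => rfl) (fun _ _ => rfl)
            (fun _ _ => rfl)
        rw [HH.kmLoop_eq hne _ t.2, Pi.smul_apply, H.kmLoop_eq hne _ t.2, loop_smul c t.2]
        rfl }
  have hρ : ∀ (X : N) (g h k m : TimeFun Ω), IsGen a₁ (X : VF Ω) 0 0 g h k m →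
      ∀ t : timeSet Ω, ρ X t = loop a₁ g h k m t := fun X g h k m H t =>
    H.kmLoop_eq hne (mem X) t.2
  refine ⟨ρ, ?_, ?_, fun i => heisenberg a₁ (Pi.single i 1) 0 0,
    fun i => heisenberg a₁ 0 (Pi.single i 1) 0, heisenberg a₁ 0 0 1, fun i => trace_heisenberg ..,
    fun i => trace_heisenberg .., trace_heisenberg .., ?_, ?_, ?_, ?_⟩
  · rw [injective_iff_map_eq_zero]
    intro X hX
    obtain ⟨g, h, k, m, H⟩ := mem_kmSpan.1 (mem X)
    have e : ∀ t ∈ timeSet Ω, loop a₁ g h k m t = 0 := fun t ht => by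
      rw [← hρ X g h k m H ⟨t, ht⟩, hX]
      rfl
    have ent := fun (j : Fin 5) t ht => congrFun (congrFun (e t ht) 0) j
    refine Subtype.ext ((H.congr (fun _ _ => rfl) rfl (fun t ht => ?_) (fun t ht => ?_)
      (fun t ht => ?_) (fun t ht => ?_)).ext (IsGen.zero a₁))
    · exact ent 1 t ht
    · exact ent 2 t ht
    · exact ent 3 t ht
    · exact ent 4 t ht
  · intro X Y t
    obtain ⟨g, h, k, m, H⟩ := mem_kmSpan.1 (mem X)
    obtain ⟨g', h', k', m', H'⟩ := mem_kmSpan.1 (mem Y)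
    have HH : IsGen a₁ ((⁅X, Y⁆ : N) : VF Ω) 0 0 _ _ _ _ := H.lie_translation H'
    rw [hρ _ _ _ _ _ HH, hρ _ _ _ _ _ H, hρ _ _ _ _ _ H', loop, loop, loop,
      heisenberg_commutator]
    simp only [TimeFun.d_zero]
    congr 1 <;> ext i <;> fin_cases i <;> rfl
  · intro g X hX t
    rw [hρ X _ _ _ _ (hX ▸ isGen_Yf a₁ g), loop, ← heisenberg_smul, ← heisenberg_smul,
      ← heisenberg_add]
    congr 1 <;> [ext i; ext i; skip] <;> (try fin_cases i) <;> simp [TimeFun.d_zero]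
  · intro g X hX t
    rw [hρ X _ _ _ _ (hX ▸ isGen_Zf a₁ g), loop, ← heisenberg_smul, ← heisenberg_smul,
      ← heisenberg_add]
    congr 1 <;> [ext i; ext i; skip] <;> (try fin_cases i) <;> simp [TimeFun.d_zero]
  · intro g X hX t
    rw [hρ X _ _ _ _ (hX ▸ isGen_Qf a₁ g), loop, ← heisenberg_smul, ← heisenberg_smul,
      ← heisenberg_add]
    congr 1 <;> [ext i; ext i; skip] <;> (try fin_cases i) <;> simp [TimeFun.d_zero]
  · intro m X hX t
    rw [hρ X _ _ _ _ (hX ▸ isGen_Wf a₁ m), loop, ← heisenberg_smul]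
    congr 1 <;> [ext i; ext i; skip] <;> (try fin_cases i) <;> simp [TimeFun.d_zero]

end

/-! ### The symmetry algebra -/

section

variable {a₁ a₂ a₃ b₁ b₂ : ℝ} {V W : VF Ω} {τ g h k m τ' : TimeFun Ω} {q : ℝ}

/-- The conditions on the coefficient `τ` of `∂_t` in a symmetry generator. -/
structure Admissible (a₁ a₃ b₁ : ℝ) (τ : TimeFun Ω) : Prop where
  snd : ∀ t ∈ timeSet Ω, τ.d.d t = 4 * a₃ * τ.d t
  trd : ∀ t ∈ timeSet Ω, (2 * a₁ + b₁) * τ.d.d.d t = 0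

namespace Admissible

theorem zero : Admissible a₁ a₃ b₁ (0 : TimeFun Ω) :=
  ⟨by simp [TimeFun.d_zero], by simp [TimeFun.d_zero]⟩

theorem trd_eq (H : Admissible a₁ a₃ b₁ τ) {t : ℝ} (ht : t ∈ timeSet Ω) :
    τ.d.d.d t = (4 * a₃) ^ 2 * τ.d t := by
  have h := TimeFun.d_congr (f := τ.d.d) (g := (4 * a₃) • τ.d) H.snd t ht
  rw [h, TimeFun.d_smul _ _ ht, TimeFun.smul_apply, H.snd t ht]
  ring

theorem add (H : Admissible a₁ a₃ b₁ τ) (H' : Admissible a₁ a₃ b₁ τ') :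
    Admissible a₁ a₃ b₁ (τ + τ') := by
  have d1 : ∀ t ∈ timeSet Ω, (τ + τ').d t = (τ.d + τ'.d) t := fun t ht => TimeFun.d_add _ _ ht
  have d2 : ∀ t ∈ timeSet Ω, (τ + τ').d.d t = (τ.d.d + τ'.d.d) t := fun t ht =>
    (TimeFun.d_congr d1 t ht).trans (TimeFun.d_add _ _ ht)
  have d3 : ∀ t ∈ timeSet Ω, (τ + τ').d.d.d t = (τ.d.d.d + τ'.d.d.d) t := fun t ht =>
    (TimeFun.d_congr d2 t ht).trans (TimeFun.d_add _ _ ht)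
  refine ⟨fun t ht => ?_, fun t ht => ?_⟩
  · rw [d1 t ht, d2 t ht, TimeFun.add_apply, TimeFun.add_apply]
    linear_combination H.snd t ht + H'.snd t ht
  · rw [d3 t ht, TimeFun.add_apply]
    linear_combination H.trd t ht + H'.trd t ht

theorem smul (c : ℝ) (H : Admissible a₁ a₃ b₁ τ) : Admissible a₁ a₃ b₁ (c • τ) := by
  have d1 : ∀ t ∈ timeSet Ω, (c • τ).d t = (c • τ.d) t := fun t ht => TimeFun.d_smul _ _ ht
  have d2 : ∀ t ∈ timeSet Ω, (c • τ).d.d t = (c • τ.d.d) t := fun t ht =>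
    (TimeFun.d_congr d1 t ht).trans (TimeFun.d_smul _ _ ht)
  have d3 : ∀ t ∈ timeSet Ω, (c • τ).d.d.d t = (c • τ.d.d.d) t := fun t ht =>
    (TimeFun.d_congr d2 t ht).trans (TimeFun.d_smul _ _ ht)
  refine ⟨fun t ht => ?_, fun t ht => ?_⟩
  · rw [d1 t ht, d2 t ht, TimeFun.smul_apply, TimeFun.smul_apply]
    linear_combination c * H.snd t ht
  · rw [d3 t ht, TimeFun.smul_apply]
    linear_combination c * H.trd t ht

theorem lie (H : Admissible a₁ a₃ b₁ τ) (H' : Admissible a₁ a₃ b₁ τ') :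
    Admissible a₁ a₃ b₁ (τ * τ'.d - τ.d * τ') := by
  have d1 : ∀ t ∈ timeSet Ω,
      (τ * τ'.d - τ.d * τ').d t = ((4 * a₃) • (τ * τ'.d - τ.d * τ')) t := fun t ht => by
    simp only [TimeFun.d_sub _ _ ht, TimeFun.d_mul _ _ ht, TimeFun.sub_apply, TimeFun.add_apply,
      TimeFun.mul_apply, TimeFun.smul_apply, H.snd t ht, H'.snd t ht]
    ring
  have d2 : ∀ t ∈ timeSet Ω,
      (τ * τ'.d - τ.d * τ').d.d t = ((4 * a₃) • (τ * τ'.d - τ.d * τ').d) t := fun t ht =>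
    (TimeFun.d_congr d1 t ht).trans (TimeFun.d_smul _ _ ht)
  refine ⟨d2, fun t ht => ?_⟩
  rw [(TimeFun.d_congr d2 t ht).trans (TimeFun.d_smul _ _ ht), TimeFun.smul_apply, d2 t ht,
    TimeFun.smul_apply, d1 t ht, TimeFun.smul_apply, TimeFun.sub_apply, TimeFun.mul_apply,
    TimeFun.mul_apply]
  have h1 := H.trd t ht
  have h2 := H'.trd t ht
  rw [H.trd_eq ht] at h1
  rw [H'.trd_eq ht] at h2
  linear_combination 4 * a₃ * (τ t * h2 - τ' t * h1)

end Admissible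

theorem IsGen.isSymmetry_of_admissible (ha₁ : a₁ ≠ 0) (H : IsGen a₁ V τ q g h k m)
    (hτ : Admissible a₁ a₃ b₁ τ) : IsSymmetry a₁ a₂ a₃ b₁ b₂ V := H.isSymmetry ha₁ hτ.snd hτ.trd

/-- The Lie algebra of all symmetry generators. -/
def symmetryAlgebra (a₃ : ℝ) (ha₁ : a₁ ≠ 0) (ha₂ : a₂ ≠ 0) (hb₁ : b₁ ≠ 0) (hb₂ : b₂ ≠ 0)
    (hconv : Convex ℝ (Ω : Set E)) : LieSubalgebra ℝ (VF Ω) where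
  carrier := {V | IsSymmetry a₁ a₂ a₃ b₁ b₂ V}
  add_mem' := fun hV hW => by
    obtain ⟨τ, q, g, h, k, m, H, h2, h3⟩ := hV.exists_isGen ha₁ ha₂ hb₁ hb₂ hconv
    obtain ⟨τ', q', g', h', k', m', H', h2', h3'⟩ := hW.exists_isGen ha₁ ha₂ hb₁ hb₂ hconv
    exact (H.add H').isSymmetry_of_admissible ha₁ (.add ⟨h2, h3⟩ ⟨h2', h3'⟩)
  zero_mem' := (IsGen.zero a₁).isSymmetry_of_admissible ha₁ .zero
  smul_mem' := fun c V hV => by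
    obtain ⟨τ, q, g, h, k, m, H, h2, h3⟩ := hV.exists_isGen ha₁ ha₂ hb₁ hb₂ hconv
    exact (H.smul c).isSymmetry_of_admissible ha₁ (.smul c ⟨h2, h3⟩)
  lie_mem' := fun hV hW => by
    obtain ⟨τ, q, g, h, k, m, H, h2, h3⟩ := hV.exists_isGen ha₁ ha₂ hb₁ hb₂ hconv
    obtain ⟨τ', q', g', h', k', m', H', h2', h3'⟩ := hW.exists_isGen ha₁ ha₂ hb₁ hb₂ hconv
    exact (H.lie H').isSymmetry_of_admissible ha₁ (.lie ⟨h2, h3⟩ ⟨h2', h3'⟩)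

theorem isSymmetry_of_mem_kmSpan (ha₁ : a₁ ≠ 0) (hV : V ∈ kmSpan Ω a₁) :
    IsSymmetry a₁ a₂ a₃ b₁ b₂ V := by
  obtain ⟨g, h, k, m, H⟩ := mem_kmSpan.1 hV
  exact H.isSymmetry_of_admissible ha₁ .zero

variable (Ω) in
/-- The Kac--Moody algebra `{𝒴(g), 𝒵(h), 𝒬(k), 𝒲(m)}`. -/
def kmAlgebra (a₁ : ℝ) : LieSubalgebra ℝ (VF Ω) where
  toSubmodule := kmSpan Ω a₁
  lie_mem' := fun hV hW => by
    obtain ⟨g, h, k, m, H⟩ := mem_kmSpan.1 hV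
    exact H.lie_mem_kmSpan hW

theorem not_isLieAbelian_kmAlgebra (hne : (Ω : Set E).Nonempty) :
    ¬ IsLieAbelian (kmAlgebra Ω a₁) := by
  intro hab
  have mem : ∀ f : TimeFun Ω, Yf f ∈ kmAlgebra Ω a₁ := fun f =>
    mem_kmSpan.2 ⟨_, _, _, _, isGen_Yf a₁ f⟩
  have h0 := congrArg Subtype.val (hab.trivial ⟨Yf (.const 1), mem _⟩ ⟨Yf (.lin 1), mem _⟩)
  have h1 : Wf (TimeFun.wr (1 / 2) (.const 1) (.lin 1) : TimeFun Ω) = 0 :=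
    ((kmRelations Ω a₁).YY _ _).symm.trans h0
  obtain ⟨p, hp⟩ := hne
  have h2 := ((h1 ▸ isGen_Wf a₁ _ : IsGen a₁ (0 : VF Ω) _ _ _ _ _ _).eq_zero ⟨p, hp⟩).2.2.2.2.2 _
    (ct_mem hp)
  simp [TimeFun.wr, TimeFun.d_const, TimeFun.d_lin] at h2

/-- The fields `𝒲(m)` with `m` a polynomial form an infinite-dimensional space. -/
theorem not_finiteDimensional_of_kmAlgebra_le (hne : (Ω : Set E).Nonempty)
    {L : LieSubalgebra ℝ (VF Ω)} (hL : kmAlgebra Ω a₁ ≤ L) : ¬ FiniteDimensional ℝ L := by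
  intro hfin
  let w : Polynomial ℝ → TimeFun Ω := fun P => ⟨fun t => P.eval t, by
    simpa using (P.contDiff_aeval (𝕜 := ℝ) ∞).contDiffOn⟩
  have mem : ∀ f : TimeFun Ω, Wf f ∈ L := fun f =>
    hL (mem_kmSpan.2 ⟨_, _, _, _, isGen_Wf a₁ f⟩)
  let φ : Polynomial ℝ →ₗ[ℝ] L :=
    { toFun := fun P => ⟨Wf (w P), mem _⟩
      map_add' := fun P Q => Subtype.ext <| (isGen_Wf a₁ (w (P + Q))).ext <|
        ((isGen_Wf a₁ (w P)).add (isGen_Wf a₁ (w Q))).congr (by simp) (by simp) (by simp)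
          (by simp) (by simp) (by simp [w])
      map_smul' := fun c P => Subtype.ext <| (isGen_Wf a₁ (w (c • P))).ext <|
        ((isGen_Wf a₁ (w P)).smul c).congr (by simp) (by simp) (by simp)
          (by simp) (by simp) (by simp [w]) }
  have hφ : Function.Injective φ := by
    rw [injective_iff_map_eq_zero]
    intro P hP
    have h0 : Wf (w P) = 0 := congrArg Subtype.val hP
    have h1 := ((h0 ▸ isGen_Wf a₁ (w P) : IsGen a₁ (0 : VF Ω) _ _ _ _ _ _).eq_zero hne).2.2.2.2.2
    obtain ⟨p, hp⟩ := hne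
    exact Polynomial.eq_zero_of_infinite_isRoot P
      ((infinite_of_mem_nhds _ (isOpen_timeSet.mem_nhds (ct_mem hp))).mono h1)
  have := Module.Finite.of_injective φ hφ
  exact Polynomial.not_finite this

/-! ### Semidirect sums -/

variable (Ω) in
/-- The symmetry generators that consist of a time change and a rotation in the `(x, z)`-plane. -/
def complementSpace (a₁ a₃ b₁ : ℝ) : Submodule ℝ (VF Ω) where
  carrier := {V | ∃ τ q, IsGen a₁ V τ q 0 0 0 0 ∧ Admissible a₁ a₃ b₁ τ}
  add_mem' := by
    rintro V W ⟨τ, q, H, hτ⟩ ⟨τ', q', H', hτ'⟩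
    exact ⟨_, _, (H.add H').congr (fun _ _ => rfl) rfl (by simp) (by simp) (by simp) (by simp),
      hτ.add hτ'⟩
  zero_mem' := ⟨_, _, .zero a₁, .zero⟩
  smul_mem' := by
    rintro c V ⟨τ, q, H, hτ⟩
    exact ⟨_, _, (H.smul c).congr (fun _ _ => rfl) rfl (by simp) (by simp) (by simp) (by simp),
      hτ.smul c⟩

theorem disjoint_complementSpace (hne : (Ω : Set E).Nonempty) :
    Disjoint (complementSpace Ω a₁ a₃ b₁) (kmSpan Ω a₁) := by
  rw [Submodule.disjoint_def]
  rintro V ⟨τ, q, H, -⟩ hV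
  obtain ⟨g, h, k, m, H'⟩ := mem_kmSpan.1 hV
  obtain ⟨hτ, hq, -⟩ := H.unique H' hne
  exact (H.congr hτ hq (fun _ _ => rfl) (fun _ _ => rfl) (fun _ _ => rfl) (fun _ _ => rfl)).ext
    (.zero a₁)

theorem lie_mem_span {s : Set (VF Ω)}
    (hs : ∀ x ∈ s, ∀ y ∈ s, ⁅x, y⁆ ∈ Submodule.span ℝ s) {x y : VF Ω}
    (hx : x ∈ Submodule.span ℝ s) (hy : y ∈ Submodule.span ℝ s) :
    ⁅x, y⁆ ∈ Submodule.span ℝ s := by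
  induction hx using Submodule.span_induction with
  | mem x hx =>
    induction hy using Submodule.span_induction with
    | mem y hy => exact hs x hx y hy
    | zero => simp
    | add y z _ _ hy hz => rw [lie_add]; exact add_mem hy hz
    | smul c y _ hy => rw [lie_smul]; exact Submodule.smul_mem _ c hy
  | zero => simp
  | add x z _ _ hx hz => rw [add_lie]; exact add_mem hx hz
  | smul c x _ hx => rw [smul_lie]; exact Submodule.smul_mem _ c hx

/-- A subalgebra of time changes and rotations is a complement of the Kac--Moody algebra, if all
time changes and rotations that occur in symmetry generators occur in it. -/
theorem isSemidirectSum (ha₁ : a₁ ≠ 0) (ha₂ : a₂ ≠ 0) (hb₁ : b₁ ≠ 0) (hb₂ : b₂ ≠ 0)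
    (hconv : Convex ℝ (Ω : Set E)) (hne : (Ω : Set E).Nonempty) {S : LieSubalgebra ℝ (VF Ω)}
    (hS : S.toSubmodule ≤ complementSpace Ω a₁ a₃ b₁)
    (hgen : ∀ (τ : TimeFun Ω) (q : ℝ), Admissible a₁ a₃ b₁ τ →
      ∃ X ∈ S, ∃ τ', (∀ t ∈ timeSet Ω, τ t = τ' t) ∧ IsGen a₁ X τ' q 0 0 0 0) :
    IsSemidirectSum (symmetryAlgebra a₃ ha₁ ha₂ hb₁ hb₂ hconv) S (kmAlgebra Ω a₁) := by
  have left : S ≤ symmetryAlgebra a₃ ha₁ ha₂ hb₁ hb₂ hconv := fun X hX => by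
    obtain ⟨τ, q, H, hτ⟩ := hS hX
    exact H.isSymmetry_of_admissible ha₁ hτ
  have right : kmAlgebra Ω a₁ ≤ symmetryAlgebra a₃ ha₁ ha₂ hb₁ hb₂ hconv := fun X hX =>
    isSymmetry_of_mem_kmSpan ha₁ hX
  refine ⟨left, right, fun X hX Y hY => ?_, (disjoint_complementSpace hne).mono_left hS,
    le_antisymm (sup_le left right) fun X hX => ?_⟩
  · obtain ⟨τ, q, g, h, k, m, H, -⟩ := IsSymmetry.exists_isGen ha₁ ha₂ hb₁ hb₂ hconv hX
    exact H.lie_mem_kmSpan hY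
  · obtain ⟨τ, q, g, h, k, m, H, h2, h3⟩ := IsSymmetry.exists_isGen ha₁ ha₂ hb₁ hb₂ hconv hX
    obtain ⟨Y, hY, τ', hτ, H'⟩ := hgen τ q ⟨h2, h3⟩
    refine Submodule.mem_sup.2 ⟨Y, hY, X + (-1 : ℝ) • Y, mem_kmSpan.2 ⟨_, _, _, _,
      (H.add (H'.smul (-1))).congr (fun t ht => ?_) (by ring) (fun _ _ => rfl) (fun _ _ => rfl)
      (fun _ _ => rfl) (fun _ _ => rfl)⟩, by module⟩
    simp [hτ t ht]

/-! ### Time changes and rotations -/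

theorem lie_X3 (H : IsGen a₁ V τ 0 0 0 0 0) : ⁅V, X3 Ω⁆ = 0 :=
  ((H.lie (isGen_X3 a₁)).congr (by simp [TimeFun.d_zero]) rfl (by simp [TimeFun.d_zero])
    (by simp [TimeFun.d_zero]) (by simp [TimeFun.d_zero]) (by simp [TimeFun.d_zero])).ext
    (.zero a₁)

theorem lie_X1_X2 : ⁅X1 Ω, X2 Ω⁆ = (2 : ℝ) • X1 Ω :=
  (((isGen_X1 1).lie (isGen_X2 1)).congr (by simp [TimeFun.d_const, TimeFun.d_lin]) (by simp)
    (by simp [TimeFun.d_zero]) (by simp [TimeFun.d_zero]) (by simp [TimeFun.d_zero])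
    (by simp [TimeFun.d_zero])).ext ((isGen_X1 1).smul 2)

theorem lie_X1_X2t (ha₃ : a₃ ≠ 0) : ⁅X1 Ω, X2t Ω a₁ a₃⁆ = (4 * a₃) • X2t Ω a₁ a₃ :=
  (((isGen_X1 a₁).lie (isGen_X2t a₁ ha₃)).congr (fun t _ => by
      simp [TimeFun.d_const, TimeFun.d_exp]; ring) (by simp)
    (by simp [TimeFun.d_zero]) (by simp [TimeFun.d_zero]) (by simp [TimeFun.d_zero])
    (by simp [TimeFun.d_zero])).ext ((isGen_X2t a₁ ha₃).smul (4 * a₃))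

/-- A time change with nonconstant `τ` is independent of the time translation and the rotation. -/
theorem linearIndependent_X1_X3 (hne : (Ω : Set E).Nonempty) (H : IsGen a₁ V τ 0 0 0 0 0)
    (hτ : ∀ t ∈ timeSet Ω, τ.d t ≠ 0) : LinearIndependent ℝ ![X1 Ω, V, X3 Ω] := by
  rw [Fintype.linearIndependent_iff]
  intro c hc
  rw [Fin.sum_univ_three] at hc
  have HH := (((isGen_X1 a₁).smul (c 0)).add (H.smul (c 1))).add ((isGen_X3 a₁).smul (c 2))
  obtain ⟨e, eq, -⟩ := (hc ▸ HH : IsGen a₁ (0 : VF Ω) _ _ _ _ _ _).eq_zero hne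
  obtain ⟨p, hp⟩ := hne
  have ht := ct_mem hp
  have e' : ∀ t ∈ timeSet Ω, (TimeFun.const (c 0) + c 1 • τ : TimeFun Ω) t = (0 : TimeFun Ω) t :=
    fun t ht => by simpa using e t ht
  have h1 := TimeFun.d_congr e' _ ht
  rw [TimeFun.d_add _ _ ht, TimeFun.add_apply, TimeFun.d_const, TimeFun.d_smul _ _ ht,
    TimeFun.d_zero] at h1
  have c1 : c 1 = 0 := by simpa [hτ _ ht] using h1
  have c0 : c 0 = 0 := by simpa [c1] using e' _ ht
  have c2 : c 2 = 0 := by simpa using eq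
  intro i
  fin_cases i <;> assumption

end

section

variable {a₁ a₂ a₃ b₁ b₂ : ℝ} {V W : VF Ω} {τ τ' : TimeFun Ω}

/-! ### The possible time changes -/

theorem Admissible.const (c : ℝ) : Admissible a₁ a₃ b₁ (TimeFun.const c : TimeFun Ω) :=
  ⟨by simp [TimeFun.d_const, TimeFun.d_zero], by simp [TimeFun.d_const, TimeFun.d_zero]⟩

theorem Admissible.lin (ha₃ : a₃ = 0) (c : ℝ) :
    Admissible a₁ a₃ b₁ (TimeFun.lin c : TimeFun Ω) :=
  ⟨by simp [TimeFun.d_lin, TimeFun.d_const, ha₃],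
    by simp [TimeFun.d_lin, TimeFun.d_const, TimeFun.d_zero]⟩

theorem Admissible.exp (hb : b₁ = -2 * a₁) (c : ℝ) :
    Admissible a₁ a₃ b₁ (TimeFun.exp c (4 * a₃) : TimeFun Ω) :=
  ⟨fun t _ => by simp [TimeFun.d_exp]; ring, fun t _ => by simp [hb]⟩

theorem Admissible.eq_lin (hconv : Convex ℝ (Ω : Set E)) (H : Admissible a₁ a₃ b₁ τ)
    (ha₃ : a₃ = 0) :
    ∃ c r : ℝ, ∀ t ∈ timeSet Ω, τ t = (c • TimeFun.const 1 + r • TimeFun.lin 2 : TimeFun Ω) t := by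
  obtain ⟨r, hr⟩ := TimeFun.exists_const hconv (f := τ.d) fun t ht => by rw [H.snd t ht, ha₃]; ring
  obtain ⟨c, hc⟩ := TimeFun.exists_const hconv (f := τ - TimeFun.lin r) fun t ht => by
    rw [TimeFun.d_sub _ _ ht, TimeFun.sub_apply, hr t ht, TimeFun.d_lin]
    simp
  refine ⟨c, r / 2, fun t ht => ?_⟩
  have := hc t ht
  simp only [TimeFun.sub_apply, TimeFun.add_apply, TimeFun.smul_apply, TimeFun.lin_apply,
    TimeFun.const_apply] at this ⊢
  linarith

theorem Admissible.eq_exp (hconv : Convex ℝ (Ω : Set E)) (H : Admissible a₁ a₃ b₁ τ)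
    (ha₃ : a₃ ≠ 0) : ∃ c r : ℝ, ∀ t ∈ timeSet Ω,
      τ t = (c • TimeFun.const 1 + r • TimeFun.exp (1 / (2 * a₃)) (4 * a₃) : TimeFun Ω) t := by
  -- `τ' exp(-4a₃t)` is constant
  obtain ⟨r, hr⟩ := TimeFun.exists_const hconv (f := TimeFun.exp 1 (-(4 * a₃)) * τ.d)
    fun t ht => by
      rw [TimeFun.d_mul _ _ ht, TimeFun.add_apply, TimeFun.mul_apply, TimeFun.mul_apply,
        H.snd t ht, TimeFun.d_exp, TimeFun.exp_apply, TimeFun.exp_apply]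
      ring
  have hr' : ∀ t ∈ timeSet Ω, τ.d t = r * Real.exp (4 * a₃ * t) := fun t ht => by
    rw [← hr t ht, TimeFun.mul_apply, TimeFun.exp_apply, mul_right_comm, mul_assoc 1,
      ← Real.exp_add]
    ring_nf
    simp
  obtain ⟨c, hc⟩ := TimeFun.exists_const hconv
    (f := τ - TimeFun.exp (r / (4 * a₃)) (4 * a₃)) fun t ht => by
      rw [TimeFun.d_sub _ _ ht, TimeFun.sub_apply, hr' t ht, TimeFun.d_exp, TimeFun.exp_apply,
        div_mul_cancel₀ _ (by positivity), sub_self]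
  refine ⟨c, r / 2, fun t ht => ?_⟩
  have := hc t ht
  simp only [TimeFun.sub_apply, TimeFun.add_apply, TimeFun.smul_apply, TimeFun.exp_apply,
    TimeFun.const_apply] at this ⊢
  rw [← this]
  field_simp
  ring

theorem Admissible.eq_const (hconv : Convex ℝ (Ω : Set E)) (H : Admissible a₁ a₃ b₁ τ)
    (ha₃ : a₃ ≠ 0) (hb : b₁ ≠ -2 * a₁) :
    ∃ c : ℝ, ∀ t ∈ timeSet Ω, τ t = (c • TimeFun.const 1 : TimeFun Ω) t := by
  have h0 : 2 * a₁ + b₁ ≠ 0 := fun h => hb (by linarith)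
  obtain ⟨c, hc⟩ := TimeFun.exists_const hconv (f := τ) fun t ht => by
    have h := H.trd t ht
    rw [H.trd_eq ht] at h
    simpa [h0, ha₃] using h
  exact ⟨c, fun t ht => by simp [hc t ht]⟩

/-! ### The complements of the Kac--Moody algebra -/

/-- The complement of the Kac--Moody algebra if the possible time changes are spanned by `1` and one
more function `τ`. -/
theorem exists_complement_three (ha₁ : a₁ ≠ 0) (ha₂ : a₂ ≠ 0) (hb₁ : b₁ ≠ 0) (hb₂ : b₂ ≠ 0)
    (hconv : Convex ℝ (Ω : Set E)) (hne : (Ω : Set E).Nonempty)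
    (H : IsGen a₁ V τ 0 0 0 0 0) (hτ : Admissible a₁ a₃ b₁ τ) (hd : ∀ t ∈ timeSet Ω, τ.d t ≠ 0)
    (hlie : ⁅X1 Ω, V⁆ ∈ Submodule.span ℝ {X1 Ω, V, X3 Ω})
    (hgen : ∀ σ : TimeFun Ω, Admissible a₁ a₃ b₁ σ →
      ∃ c r : ℝ, ∀ t ∈ timeSet Ω, σ t = (c • TimeFun.const 1 + r • τ : TimeFun Ω) t) :
    ∃ S : LieSubalgebra ℝ (VF Ω), S.toSubmodule = Submodule.span ℝ {X1 Ω, V, X3 Ω} ∧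
      Module.finrank ℝ S = 3 ∧
      IsSemidirectSum (symmetryAlgebra a₃ ha₁ ha₂ hb₁ hb₂ hconv) S (kmAlgebra Ω a₁) := by
  have hlie' : ⁅V, X1 Ω⁆ ∈ Submodule.span ℝ {X1 Ω, V, X3 Ω} := by
    rw [← lie_skew]; exact neg_mem hlie
  have h13 : ⁅X1 Ω, X3 Ω⁆ = 0 := lie_X3 (isGen_X1 a₁)
  have h31 : ⁅X3 Ω, X1 Ω⁆ = 0 := by rw [← lie_skew, h13, neg_zero]
  have h23 : ⁅V, X3 Ω⁆ = 0 := lie_X3 H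
  have h32 : ⁅X3 Ω, V⁆ = 0 := by rw [← lie_skew, h23, neg_zero]
  let S : LieSubalgebra ℝ (VF Ω) :=
    { Submodule.span ℝ {X1 Ω, V, X3 Ω} with
      lie_mem' := lie_mem_span <| by
        rintro _ (rfl | rfl | rfl) _ (rfl | rfl | rfl) <;>
          simp only [lie_self, h13, h31, h23, h32, zero_mem, hlie, hlie'] }
  have hX : ∀ X ∈ ({X1 Ω, V, X3 Ω} : Set (VF Ω)), X ∈ S := fun X hX => Submodule.subset_span hX
  refine ⟨S, rfl, ?_, isSemidirectSum ha₁ ha₂ hb₁ hb₂ hconv hne ?_ fun σ q hσ => ?_⟩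
  · have := finrank_span_eq_card (linearIndependent_X1_X3 hne H hd)
    rw [Matrix.range_cons, Matrix.range_cons, Matrix.range_cons, Matrix.range_empty, union_empty,
      singleton_union, singleton_union, Fintype.card_fin] at this
    exact this
  · refine Submodule.span_le.2 ?_
    rintro _ (rfl | rfl | rfl)
    · exact ⟨_, _, isGen_X1 a₁, .const 1⟩
    · exact ⟨_, _, H, hτ⟩
    · exact ⟨_, _, isGen_X3 a₁, .zero⟩
  · obtain ⟨c, r, hcr⟩ := hgen σ hσ
    refine ⟨c • X1 Ω + r • V + q • X3 Ω, add_mem (add_mem (S.smul_mem c (hX _ (by simp)))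
      (S.smul_mem r (hX _ (by simp)))) (S.smul_mem q (hX _ (by simp))), _, hcr,
      (((isGen_X1 a₁).smul c).add (H.smul r) |>.add ((isGen_X3 a₁).smul q)).congr (by simp)
        (by simp) (by simp) (by simp) (by simp) (by simp)⟩

/-- The complement of the Kac--Moody algebra if only constant time changes are possible. -/
theorem exists_complement_two (ha₁ : a₁ ≠ 0) (ha₂ : a₂ ≠ 0) (hb₁ : b₁ ≠ 0) (hb₂ : b₂ ≠ 0)
    (hconv : Convex ℝ (Ω : Set E)) (hne : (Ω : Set E).Nonempty) (ha₃ : a₃ ≠ 0)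
    (hb : b₁ ≠ -2 * a₁) :
    ∃ S : LieSubalgebra ℝ (VF Ω), S.toSubmodule = Submodule.span ℝ {X1 Ω, X3 Ω} ∧
      Module.finrank ℝ S = 2 ∧
      IsSemidirectSum (symmetryAlgebra a₃ ha₁ ha₂ hb₁ hb₂ hconv) S (kmAlgebra Ω a₁) := by
  have h13 : ⁅X1 Ω, X3 Ω⁆ = 0 := lie_X3 (isGen_X1 a₁)
  have h31 : ⁅X3 Ω, X1 Ω⁆ = 0 := by rw [← lie_skew, h13, neg_zero]
  let S : LieSubalgebra ℝ (VF Ω) :=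
    { Submodule.span ℝ {X1 Ω, X3 Ω} with
      lie_mem' := lie_mem_span <| by
        rintro _ (rfl | rfl) _ (rfl | rfl) <;> simp only [lie_self, h13, h31, zero_mem] }
  have hX : ∀ X ∈ ({X1 Ω, X3 Ω} : Set (VF Ω)), X ∈ S := fun X hX => Submodule.subset_span hX
  refine ⟨S, rfl, ?_, isSemidirectSum ha₁ ha₂ hb₁ hb₂ hconv hne ?_ fun σ q hσ => ?_⟩
  · have hind := (linearIndependent_X1_X3 hne (isGen_X2 a₁)
      (by simp [TimeFun.d_lin])).comp ![0, 2] (by decide)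
    have := finrank_span_eq_card hind
    rw [show (![X1 Ω, X2 Ω, X3 Ω] ∘ ![0, 2]) = ![X1 Ω, X3 Ω] by
      ext i : 1; fin_cases i <;> rfl, Matrix.range_cons, Matrix.range_cons,
      Matrix.range_empty, union_empty, singleton_union, Fintype.card_fin] at this
    exact this
  · refine Submodule.span_le.2 ?_
    rintro _ (rfl | rfl)
    · exact ⟨_, _, isGen_X1 a₁, .const 1⟩
    · exact ⟨_, _, isGen_X3 a₁, .zero⟩
  · obtain ⟨c, hc⟩ := hσ.eq_const hconv ha₃ hb
    refine ⟨c • X1 Ω + q • X3 Ω, add_mem (S.smul_mem c (hX _ (by simp)))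
      (S.smul_mem q (hX _ (by simp))), _, hc,
      (((isGen_X1 a₁).smul c).add ((isGen_X3 a₁).smul q)).congr (by simp)
        (by simp) (by simp) (by simp) (by simp) (by simp)⟩

end

end

end MDS

theorem theorem2p1 (a₁ a₂ a₃ b₁ b₂ : ℝ) (ha₁ : a₁ ≠ 0) (ha₂ : a₂ ≠ 0) (hb₁ : b₁ ≠ 0)
    (hb₂ : b₂ ≠ 0) (Ω : TopologicalSpace.Opens MDS.E) (hne : (Ω : Set MDS.E).Nonempty)
    (hconv : Convex ℝ (Ω : Set MDS.E)) :
    (∀ g h k m : MDS.TimeFun Ω,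
      MDS.IsSymmetry a₁ a₂ a₃ b₁ b₂ (MDS.Yf g) ∧ MDS.IsSymmetry a₁ a₂ a₃ b₁ b₂ (MDS.Zf a₁ h) ∧
      MDS.IsSymmetry a₁ a₂ a₃ b₁ b₂ (MDS.Qf k) ∧ MDS.IsSymmetry a₁ a₂ a₃ b₁ b₂ (MDS.Wf m)) ∧
    ∃ L N : LieSubalgebra ℝ (MDS.VF Ω),
      (∀ V : MDS.VF Ω, V ∈ L ↔ MDS.IsSymmetry a₁ a₂ a₃ b₁ b₂ V) ∧
      N.toSubmodule = MDS.kmSpan Ω a₁ ∧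
      ¬ FiniteDimensional ℝ L ∧
      (∀ X ∈ L, ∀ Y ∈ N, ⁅X, Y⁆ ∈ N) ∧ ¬ IsLieAbelian N ∧
      MDS.KMRelations Ω a₁ ∧ MDS.IsKacMoodyType a₁ N ∧
      (a₃ = 0 → ∃ S : LieSubalgebra ℝ (MDS.VF Ω),
        S.toSubmodule = Submodule.span ℝ {MDS.X1 Ω, MDS.X2 Ω, MDS.X3 Ω} ∧
        Module.finrank ℝ S = 3 ∧
        ⁅MDS.X1 Ω, MDS.X2 Ω⁆ = (2 : ℝ) • MDS.X1 Ω ∧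
        ⁅MDS.X1 Ω, MDS.X3 Ω⁆ = 0 ∧ ⁅MDS.X2 Ω, MDS.X3 Ω⁆ = 0 ∧
        MDS.IsSemidirectSum L S N) ∧
      (a₃ ≠ 0 → b₁ = -2 * a₁ → ∃ S : LieSubalgebra ℝ (MDS.VF Ω),
        S.toSubmodule = Submodule.span ℝ {MDS.X1 Ω, MDS.X2t Ω a₁ a₃, MDS.X3 Ω} ∧
        Module.finrank ℝ S = 3 ∧
        ⁅MDS.X1 Ω, MDS.X2t Ω a₁ a₃⁆ = (4 * a₃) • MDS.X2t Ω a₁ a₃ ∧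
        ⁅MDS.X1 Ω, MDS.X3 Ω⁆ = 0 ∧ ⁅MDS.X2t Ω a₁ a₃, MDS.X3 Ω⁆ = 0 ∧
        MDS.IsSemidirectSum L S N) ∧
      (a₃ ≠ 0 → b₁ ≠ -2 * a₁ → ∃ S : LieSubalgebra ℝ (MDS.VF Ω),
        S.toSubmodule = Submodule.span ℝ {MDS.X1 Ω, MDS.X3 Ω} ∧
        Module.finrank ℝ S = 2 ∧
        ⁅MDS.X1 Ω, MDS.X3 Ω⁆ = 0 ∧
        MDS.IsSemidirectSum L S N) := by
  obtain hkm := fun V (hV : V ∈ MDS.kmSpan Ω a₁) =>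
    MDS.isSymmetry_of_mem_kmSpan (a₂ := a₂) (a₃ := a₃) (b₁ := b₁) (b₂ := b₂) ha₁ hV
  refine ⟨fun g h k m => ⟨hkm _ ?_, hkm _ ?_, hkm _ ?_, hkm _ ?_⟩,
    MDS.symmetryAlgebra a₃ ha₁ ha₂ hb₁ hb₂ hconv, MDS.kmAlgebra Ω a₁, fun V => Iff.rfl, rfl,
    MDS.not_finiteDimensional_of_kmAlgebra_le hne fun V hV => hkm V hV, fun X hX Y hY => ?_,
    MDS.not_isLieAbelian_kmAlgebra hne, MDS.kmRelations Ω a₁, MDS.isKacMoodyType hne rfl,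
    fun h0 => ?_, fun h0 hb => ?_, fun h0 hb => ?_⟩
  · exact MDS.mem_kmSpan.2 ⟨_, _, _, _, MDS.isGen_Yf a₁ g⟩
  · exact MDS.mem_kmSpan.2 ⟨_, _, _, _, MDS.isGen_Zf a₁ h⟩
  · exact MDS.mem_kmSpan.2 ⟨_, _, _, _, MDS.isGen_Qf a₁ k⟩
  · exact MDS.mem_kmSpan.2 ⟨_, _, _, _, MDS.isGen_Wf a₁ m⟩
  · obtain ⟨τ, q, g, h, k, m, H, -⟩ :=
      MDS.IsSymmetry.exists_isGen ha₁ ha₂ hb₁ hb₂ hconv (show MDS.IsSymmetry _ _ _ _ _ X from hX)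
    exact H.lie_mem_kmSpan hY
  · obtain ⟨S, hS, hdim, hsum⟩ := MDS.exists_complement_three ha₁ ha₂ hb₁ hb₂ hconv hne
      (MDS.isGen_X2 a₁) (MDS.Admissible.lin h0 2) (by simp [MDS.TimeFun.d_lin])
      (by rw [MDS.lie_X1_X2]; exact Submodule.smul_mem _ _ (Submodule.subset_span (by simp)))
      fun σ hσ => hσ.eq_lin hconv h0
    exact ⟨S, hS, hdim, MDS.lie_X1_X2, MDS.lie_X3 (MDS.isGen_X1 a₁), MDS.lie_X3 (MDS.isGen_X2 a₁),
      hsum⟩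
  · obtain ⟨S, hS, hdim, hsum⟩ := MDS.exists_complement_three ha₁ ha₂ hb₁ hb₂ hconv hne
      (MDS.isGen_X2t a₁ h0) (MDS.Admissible.exp hb _)
      (by simp [MDS.TimeFun.d_exp, h0])
      (by rw [MDS.lie_X1_X2t h0]; exact Submodule.smul_mem _ _ (Submodule.subset_span (by simp)))
      fun σ hσ => hσ.eq_exp hconv h0
    exact ⟨S, hS, hdim, MDS.lie_X1_X2t h0, MDS.lie_X3 (MDS.isGen_X1 a₁),
      MDS.lie_X3 (MDS.isGen_X2t a₁ h0), hsum⟩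
  · obtain ⟨S, hS, hdim, hsum⟩ :=
      MDS.exists_complement_two ha₁ ha₂ hb₁ hb₂ hconv hne h0 hb
    exact ⟨S, hS, hdim, MDS.lie_X3 (MDS.isGen_X1 a₁), hsum⟩
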